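/- Let $d$ be an odd prime, $\omega=e^{2\pi i/d}$, $X|j\rangle=|j+1 \bmod d\rangle$, $Z|j\rangle=\omega^j|j\rangle$, $P_{(a|b)}=X^aZ^b$ and $P_{(x_1,x_2|z_1,z_2)}=(X^{x_1}\otimes X^{x_2})(Z^{z_1}\otimes Z^{z_2})$; for $P$ one of these operators and $k\in\mathbb Z_d$ write $\Pi_{[k]}=\frac1d\sum_{m=0}^{d-1}\omega^{-mk}P^m$. A Clifford gate is a $d\times d$ unitary that maps the Pauli group $\{\omega^cP_{(a|b)}\}$ to itself under conjugation. The Clifford polytope is the convex hull of the channels $\rho\mapsto C\rho C^\dagger$ with $C$ a Clifford gate. For a unitary $U$ and $p\in[0,1]$ let $\mathcal E_{U,p}(\rho)=(1-p)U\rho U^\dagger+p\,\mathrm{tr}(\rho)\,I/d$, let $p^\star(U)$ be the least $p\in[0,1]$ for which $\mathcal E_{U,p}$ is in the Clifford polytope, and let $|J_U\rangle=(I\otimes U)\sum_j|jj\rangle/\sqrt d$. A facet is a Hermitian operator $W$ with $\mathrm{tr}\,W=1$ such that $\langle J_C|W|J_C\rangle\ge 0$ for all Clifford gates $C$, and such that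 the projectors $|J_C\rangle\langle J_C|$ with $\langle J_C|W|J_C\rangle=0$ span a real space of dimension $(d^2-1)^2$. For $u\in\mathbb Z_d^{d+1}$ let $A(u)=\frac1d\big(\Pi_{(0|1)[u_1]}+\sum_{j=2}^{d+1}\Pi_{(1|j-2)[u_j]}-I\big)$, let $V|j\rangle=|j,-j\rangle$ be the encoder of the parity code, and let the $B$-type witness $W_B^u$ be the part of $VA(u)V^\dagger$ in the span of the identity and the weight-two Pauli operators $P_{(x_1,x_2|z_1,z_2)}$, $(x_1,z_1)\ne(0,0)\ne(x_2,z_2)$, scaled to trace one. Then the following holds for the gates $U=U_d$ and witnesses $W=W_d$, $d=3,5,7$, given below. (i) $U_d$ is unitary, and $W_d$ is a $B$-type witness and a facet of the Clifford polytope. Here $W_3=W_B^{(0,2,2,0)}$, $W_5=W_B^{(0,0,0,1,3,1)}$, $W_7=W_B^{(0,0,0,3,2,4,2,3)}$, and, explicitly, $W_3=\frac13\big(\sum\Pi_{(x_1,x_2|z_1,z_2)[k]}-\frac{10}3I\big)$ and $W_5=\frac1{10}\big(\sum\Pi_{(x_1,x_2|z_1,z_2)[k]}-\frac{56}5I\big)$,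 with the sums over the lists below. (ii) Put $p_d=1-\frac{1}{d^2|\langle J_{U_d}|W_d|J_{U_d}\rangle|+1}$. For all $0\le p<p_d$, the Choi state $\tau=(\mathcal I\otimes\mathcal E_{U_d,p})\big(\frac1d\sum_{j,k}|jj\rangle\langle kk|\big)$ has $\mathrm{Tr}(W_d\tau)<0$, and $\mathcal E_{U_d,p}$ is outside the Clifford polytope. Moreover $p^\star(U_d)=p_d$. (iii) For $d=3$: $\langle J_U|W|J_U\rangle=\frac19\big(3-\sqrt3\cos\frac\pi{18}-6\cos\frac\pi9-3\sin\frac\pi{18}+2\sqrt3\sin\frac\pi9\big)$ and $|p_3-0.7863|\le 5\cdot10^{-5}$. For $d=5$: $\langle J_U|W|J_U\rangle=-\frac45$ and $p_5=\frac{20}{21}$. For $d=7$: $|\langle J_U|W|J_U\rangle+0.8411|\le5\cdot10^{-5}$ and $|p_7-0.9763|\le5\cdot10^{-5}$. The gates, with rows and columns indexed by $0,\dots,d-1$, are given by their non-zero entries, with $e(t)=e^{i\pi t}$. $U_3$: entry $1$ at $(0,0)$, $e(\frac29)$ at $(1,2)$, $e(-\frac29)$ at $(2,1)$. $U_5$: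 $1$ at $(0,0)$, $e(-\frac25)$ at $(1,4)$, $e(\frac45)$ at $(2,3)$, $e(-\frac45)$ at $(3,2)$, $e(\frac25)$ at $(4,1)$. $U_7$: $1$ at $(0,0)$, $(4,3)$ and $(6,1)$, $e(\frac{10}7)$ at $(1,6)$, $e(\frac67)$ at $(2,5)$, $(3,4)$ and $(5,2)$. The lists, with $x_1x_2z_1z_2\_k$ for the projector $\Pi_{(x_1,x_2|z_1,z_2)[k]}$. For $d=3$: $0011\_0$, $0012\_0$, $1200\_2$, $1201\_0$, $1202\_2$, $1210\_2$, $1211\_2$, $1212\_0$, $1220\_0$, $1221\_2$, $1222\_2$. For $d=5$: $0011\_0$, $0012\_0$, $0013\_0$, $0014\_0$, $0021\_0$, $0022\_0$, $0023\_0$, $0024\_0$, $1400\_0$, $1401\_1$, $1402\_3$, $1403\_1$, $1404\_0$, $1410\_0$, $1411\_0$, $1412\_1$, $1413\_3$, $1414\_1$, $1420\_1$, $1421\_0$, $1422\_0$, $1423\_1$, $1424\_3$, $1430\_3$, $1431\_1$, $1432\_0$, $1433\_0$, $1434\_1$, $1440\_1$, $1441\_3$, $1442\_1$, $1443\_0$,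 $1444\_0$, $2300\_0$, $2301\_0$, $2302\_3$, $2303\_4$, $2304\_3$, $2310\_3$, $2311\_0$, $2312\_0$, $2313\_3$, $2314\_4$, $2320\_4$, $2321\_3$, $2322\_0$, $2323\_0$, $2324\_3$, $2330\_3$, $2331\_4$, $2332\_3$, $2333\_0$, $2334\_0$, $2340\_0$, $2341\_3$, $2342\_4$, $2343\_3$, $2344\_0$. -/

import Mathlib

open Matrix Complex
open scoped Kronecker

namespace QuditClifford

noncomputable section

/-- The primitive root of unity `ω = exp(2πi/d)`. -/
def omega (d : ℕ) : ℂ := Complex.exp (2 * Real.pi * Complex.I / d)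

/-- The shift `X|j⟩ = |j+1 mod d⟩`. -/
def shiftX (d : ℕ) : Matrix (ZMod d) (ZMod d) ℂ :=
  Matrix.of fun i j => if i = j + 1 then 1 else 0

/-- The clock `Z|j⟩ = ω^j|j⟩`. -/
def clockZ (d : ℕ) : Matrix (ZMod d) (ZMod d) ℂ :=
  Matrix.diagonal fun j => omega d ^ j.val

variable {d : ℕ} [NeZero d]

/-- The one-qudit Pauli operator `P_(a|b) = X^a Z^b` (odd `d`). -/
def pauli (a b : ZMod d) : Matrix (ZMod d) (ZMod d) ℂ :=
  shiftX d ^ a.val * clockZ d ^ b.val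

/-- The two-qudit Pauli operator `P_(x₁,x₂|z₁,z₂) = (X^x₁ ⊗ X^x₂)(Z^z₁ ⊗ Z^z₂)`. -/
def pauliTwo (x₁ x₂ z₁ z₂ : ZMod d) : Matrix (ZMod d × ZMod d) (ZMod d × ZMod d) ℂ :=
  ((shiftX d ^ x₁.val) ⊗ₖ (shiftX d ^ x₂.val)) * ((clockZ d ^ z₁.val) ⊗ₖ (clockZ d ^ z₂.val))

/-- The projector `d⁻¹ ∑_m ω^(-mk) A^m` onto the `ω^k`-eigenspace of an operator `A` with
`A^d = 1`. -/
def eigenProj {ι : Type*} [Fintype ι] [DecidableEq ι] (A : Matrix ι ι ℂ) (k : ZMod d) :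
    Matrix ι ι ℂ :=
  (d : ℂ)⁻¹ • ∑ m ∈ Finset.range d, ((omega d)⁻¹ ^ (m * k.val)) • A ^ m

/-- The phase point operator
`A(u) = d⁻¹ (Π_(0|1)[u₁] + Π_(1|0)[u₂] + Π_(1|1)[u₃] + ⋯ + Π_(1|d-1)[u_(d+1)] - I)`. -/
def phasePoint (u : Fin (d + 1) → ZMod d) : Matrix (ZMod d) (ZMod d) ℂ :=
  (d : ℂ)⁻¹ • (eigenProj (pauli (d := d) 0 1) (u 0)
    + ∑ b : Fin d, eigenProj (pauli (d := d) 1 (b : ℕ)) (u b.succ) - 1)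

/-- The one-qudit Pauli group `{ω^c P_(a|b)}`. -/
def pauliGroup (d : ℕ) [NeZero d] : Set (Matrix (ZMod d) (ZMod d) ℂ) :=
  {P | ∃ c a b : ZMod d, P = (omega d ^ c.val) • pauli a b}

/-- Clifford gates: unitaries that map the Pauli group to itself under conjugation. -/
def IsClifford (C : Matrix (ZMod d) (ZMod d) ℂ) : Prop :=
  C ∈ Matrix.unitaryGroup (ZMod d) ℂ ∧ ∀ P ∈ pauliGroup d, C * P * Cᴴ ∈ pauliGroup d

/-- Linear maps on one-qudit operators. -/
abbrev QuditMap (d : ℕ) : Type :=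
  Matrix (ZMod d) (ZMod d) ℂ →ₗ[ℂ] Matrix (ZMod d) (ZMod d) ℂ

/-- The channel `ρ ↦ U ρ U†`. -/
def unitaryChannel (U : Matrix (ZMod d) (ZMod d) ℂ) : QuditMap d :=
  LinearMap.mulLeft ℂ U ∘ₗ LinearMap.mulRight ℂ Uᴴ

/-- The completely depolarizing map `ρ ↦ tr(ρ) I/d`. -/
def fullyDepolarizing (d : ℕ) [NeZero d] : QuditMap d :=
  (Matrix.traceLinearMap (ZMod d) ℂ ℂ).smulRight
    ((d : ℂ)⁻¹ • (1 : Matrix (ZMod d) (ZMod d) ℂ))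

/-- The depolarized gate `ρ ↦ (1-p) U ρ U† + p I/d` (on states `ρ`, i.e. `tr ρ = 1`). -/
def depolarized (U : Matrix (ZMod d) (ZMod d) ℂ) (p : ℝ) : QuditMap d :=
  (1 - p) • unitaryChannel U + p • fullyDepolarizing d

/-- The Clifford polytope: convex combinations `ρ ↦ ∑ᵢ qᵢ Cᵢ ρ Cᵢ†` of Clifford gates. -/
def cliffordPolytope (d : ℕ) [NeZero d] : Set (QuditMap d) :=
  convexHull ℝ {E | ∃ C : Matrix (ZMod d) (ZMod d) ℂ, IsClifford C ∧ E = unitaryChannel C}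

/-- The noise rates at which the depolarized gate lies in the Clifford polytope; the robustness
`p⋆(U)` is the least element of this set. -/
def cliffordNoise (U : Matrix (ZMod d) (ZMod d) ℂ) : Set ℝ :=
  {p | p ∈ Set.Icc (0 : ℝ) 1 ∧ depolarized U p ∈ cliffordPolytope d}

/-- The Choi state `τ = (I ⊗ E)(d⁻¹ ∑_{j,k} |jj⟩⟨kk|)` of a map `E`. -/
def choiState (E : QuditMap d) : Matrix (ZMod d × ZMod d) (ZMod d × ZMod d) ℂ :=
  (d : ℂ)⁻¹ • ∑ j : ZMod d, ∑ k : ZMod d,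
    Matrix.single j k (1 : ℂ) ⊗ₖ E (Matrix.single j k 1)

/-- The Choi vector `|J_U⟩ = (I ⊗ U) ∑_j |jj⟩/√d`. -/
def choiVec (U : Matrix (ZMod d) (ZMod d) ℂ) : ZMod d × ZMod d → ℂ :=
  ((1 : Matrix (ZMod d) (ZMod d) ℂ) ⊗ₖ U) *ᵥ
    fun p => if p.1 = p.2 then ((Real.sqrt d : ℝ) : ℂ)⁻¹ else 0

/-- `⟨J_U|W|J_U⟩`, as a real number (used for Hermitian `W`). -/
def choiExpect (W : Matrix (ZMod d × ZMod d) (ZMod d × ZMod d) ℂ)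
    (U : Matrix (ZMod d) (ZMod d) ℂ) : ℝ :=
  (star (choiVec U) ⬝ᵥ (W *ᵥ choiVec U)).re

/-- The Hermitian operator `W`, scaled to trace one, is a facet `⟨J_C|W|J_C⟩ ≥ 0` of the
Clifford polytope (odd prime `d`, where the polytope has dimension `(d²-1)²`): every vertex
satisfies the inequality, and `(d²-1)²` linearly independent vertices satisfy it with equality. -/
structure IsCliffordFacet (W : Matrix (ZMod d × ZMod d) (ZMod d × ZMod d) ℂ) : Prop where
  isHermitian : W.IsHermitian
  trace_eq_one : W.trace = 1
  nonneg : ∀ C : Matrix (ZMod d) (ZMod d) ℂ, IsClifford C → 0 ≤ choiExpect W C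
  rank_eq : Module.finrank ℝ (Submodule.span ℝ
    {V : Matrix (ZMod d × ZMod d) (ZMod d × ZMod d) ℂ |
      ∃ C : Matrix (ZMod d) (ZMod d) ℂ, IsClifford C ∧ choiExpect W C = 0 ∧
        V = Matrix.vecMulVec (choiVec C) (star (choiVec C))}) = (d ^ 2 - 1) ^ 2

/-- The encoding isometry `|j⟩ ↦ |j, -j⟩` of the parity code: `|j, -j⟩` is the state stabilized
by `P_(0,0|1,1)` and `ω^j P_(0,0|0,1)`. -/
def parityEncoder (d : ℕ) [NeZero d] : Matrix (ZMod d × ZMod d) (ZMod d) ℂ :=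
  Matrix.of fun p j => if p = (j, -j) then 1 else 0

/-- The part of an operator spanned by the identity and the weight-two Pauli operators, i.e.
the part which is seen by Choi states of unital channels. -/
def weightTwoPart (M : Matrix (ZMod d × ZMod d) (ZMod d × ZMod d) ℂ) :
    Matrix (ZMod d × ZMod d) (ZMod d × ZMod d) ℂ :=
  ((d : ℂ) ^ 2)⁻¹ • ∑ x₁ : ZMod d, ∑ x₂ : ZMod d, ∑ z₁ : ZMod d, ∑ z₂ : ZMod d,
    if (x₁ = 0 ∧ z₁ = 0 ↔ x₂ = 0 ∧ z₂ = 0) then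
      (pauliTwo x₁ x₂ z₁ z₂ * M).trace • (pauliTwo x₁ x₂ z₁ z₂)ᴴ
    else 0

/-- The `B`-type witness of `u`, scaled to trace one: decode a two-qudit state `τ` with the
parity code, `τ ↦ V† τ V`, and test the output with the phase point operator `A(u)`,
as an observable on the weight-two states `τ`. -/
def witnessB (u : Fin (d + 1) → ZMod d) : Matrix (ZMod d × ZMod d) (ZMod d × ZMod d) ℂ :=
  (parityEncoder d * phasePoint u * (parityEncoder d)ᴴ).trace⁻¹ •
    weightTwoPart (parityEncoder d * phasePoint u * (parityEncoder d)ᴴ)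

/-- The sum of the projectors `Π_(x₁,x₂|z₁,z₂)[k]` over a list of tuples `(x₁,x₂,z₁,z₂,k)`. -/
def projSum (l : List (ZMod d × ZMod d × ZMod d × ZMod d × ZMod d)) :
    Matrix (ZMod d × ZMod d) (ZMod d × ZMod d) ℂ :=
  (l.map fun t => eigenProj (pauliTwo t.1 t.2.1 t.2.2.1 t.2.2.2.1) t.2.2.2.2).sum

/-- The tuples `(x₁,x₂,z₁,z₂,k)` of the projectors in the explicit qutrit facet. -/
def qutritList : List (ZMod 3 × ZMod 3 × ZMod 3 × ZMod 3 × ZMod 3) :=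
  [(0, 0, 1, 1, 0), (0, 0, 1, 2, 0), (1, 2, 0, 0, 2), (1, 2, 0, 1, 0), (1, 2, 0, 2, 2),
   (1, 2, 1, 0, 2), (1, 2, 1, 1, 2), (1, 2, 1, 2, 0), (1, 2, 2, 0, 0), (1, 2, 2, 1, 2),
   (1, 2, 2, 2, 2)]

/-- The explicit qutrit facet `W_B`. -/
def qutritW : Matrix (ZMod 3 × ZMod 3) (ZMod 3 × ZMod 3) ℂ :=
  (1 / 3 : ℂ) • (projSum qutritList - (10 / 3 : ℂ) • 1)

/-- The explicit qutrit gate. -/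
def qutritU : Matrix (ZMod 3) (ZMod 3) ℂ :=
  (!![1, 0, 0;
      0, 0, Complex.exp (2 * Real.pi * Complex.I / 9);
      0, Complex.exp (-(2 * Real.pi * Complex.I / 9)), 0] : Matrix (Fin 3) (Fin 3) ℂ)

/-- The tuples `(x₁,x₂,z₁,z₂,k)` of the projectors in the explicit facet for `d = 5`. -/
def ququintList : List (ZMod 5 × ZMod 5 × ZMod 5 × ZMod 5 × ZMod 5) :=
  [(0, 0, 1, 1, 0), (0, 0, 1, 2, 0), (0, 0, 1, 3, 0), (0, 0, 1, 4, 0), (0, 0, 2, 1, 0),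
   (0, 0, 2, 2, 0), (0, 0, 2, 3, 0), (0, 0, 2, 4, 0), (1, 4, 0, 0, 0), (1, 4, 0, 1, 1),
   (1, 4, 0, 2, 3), (1, 4, 0, 3, 1), (1, 4, 0, 4, 0), (1, 4, 1, 0, 0), (1, 4, 1, 1, 0),
   (1, 4, 1, 2, 1), (1, 4, 1, 3, 3), (1, 4, 1, 4, 1), (1, 4, 2, 0, 1), (1, 4, 2, 1, 0),
   (1, 4, 2, 2, 0), (1, 4, 2, 3, 1), (1, 4, 2, 4, 3), (1, 4, 3, 0, 3), (1, 4, 3, 1, 1),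
   (1, 4, 3, 2, 0), (1, 4, 3, 3, 0), (1, 4, 3, 4, 1), (1, 4, 4, 0, 1), (1, 4, 4, 1, 3),
   (1, 4, 4, 2, 1), (1, 4, 4, 3, 0), (1, 4, 4, 4, 0), (2, 3, 0, 0, 0), (2, 3, 0, 1, 0),
   (2, 3, 0, 2, 3), (2, 3, 0, 3, 4), (2, 3, 0, 4, 3), (2, 3, 1, 0, 3), (2, 3, 1, 1, 0),
   (2, 3, 1, 2, 0), (2, 3, 1, 3, 3), (2, 3, 1, 4, 4), (2, 3, 2, 0, 4), (2, 3, 2, 1, 3),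
   (2, 3, 2, 2, 0), (2, 3, 2, 3, 0), (2, 3, 2, 4, 3), (2, 3, 3, 0, 3), (2, 3, 3, 1, 4),
   (2, 3, 3, 2, 3), (2, 3, 3, 3, 0), (2, 3, 3, 4, 0), (2, 3, 4, 0, 0), (2, 3, 4, 1, 3),
   (2, 3, 4, 2, 4), (2, 3, 4, 3, 3), (2, 3, 4, 4, 0)]

/-- The explicit facet `W_B` for `d = 5`: the sum of 58 projectors, normalized (shift by a
multiple of the identity, and scaling) so that the trace is one and the bound is zero. -/
def ququintW : Matrix (ZMod 5 × ZMod 5) (ZMod 5 × ZMod 5) ℂ :=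
  (1 / 10 : ℂ) • (projSum ququintList - (56 / 5 : ℂ) • 1)

/-- The explicit gate for `d = 5`. -/
def ququintU : Matrix (ZMod 5) (ZMod 5) ℂ :=
  (!![1, 0, 0, 0, 0;
      0, 0, 0, 0, Complex.exp (-(2 * Real.pi * Complex.I / 5));
      0, 0, 0, Complex.exp (4 * Real.pi * Complex.I / 5), 0;
      0, 0, Complex.exp (-(4 * Real.pi * Complex.I / 5)), 0, 0;
      0, Complex.exp (2 * Real.pi * Complex.I / 5), 0, 0, 0] : Matrix (Fin 5) (Fin 5) ℂ)

/-- The facet `W_B` for `d = 7`. -/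
def quseptW : Matrix (ZMod 7 × ZMod 7) (ZMod 7 × ZMod 7) ℂ :=
  witnessB (d := 7) ![0, 0, 0, 3, 2, 4, 2, 3]

/-- The explicit gate for `d = 7`. -/
def quseptU : Matrix (ZMod 7) (ZMod 7) ℂ :=
  (!![1, 0, 0, 0, 0, 0, 0;
      0, 0, 0, 0, 0, 0, Complex.exp (10 * Real.pi * Complex.I / 7);
      0, 0, 0, 0, 0, Complex.exp (6 * Real.pi * Complex.I / 7), 0;
      0, 0, 0, 0, Complex.exp (6 * Real.pi * Complex.I / 7), 0, 0;
      0, 0, 0, 1, 0, 0, 0;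
      0, 0, Complex.exp (6 * Real.pi * Complex.I / 7), 0, 0, 0, 0;
      0, 1, 0, 0, 0, 0, 0] : Matrix (Fin 7) (Fin 7) ℂ)

/-- The noise threshold `1 - 1/(d² |⟨J_U|W|J_U⟩| + 1)` that the witness `W` gives for `U`. -/
def threshold (W : Matrix (ZMod d × ZMod d) (ZMod d × ZMod d) ℂ)
    (U : Matrix (ZMod d) (ZMod d) ℂ) : ℝ :=
  1 - 1 / ((d : ℝ) ^ 2 * |choiExpect W U| + 1)

/-- `W` certifies that the depolarized versions of the gate `U` are outside the Clifford polytope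
for every noise rate `p < r`: the Choi state `τ` has `Tr(W τ) < 0`. -/
def Certifies (W : Matrix (ZMod d × ZMod d) (ZMod d × ZMod d) ℂ)
    (U : Matrix (ZMod d) (ZMod d) ℂ) (r : ℝ) : Prop :=
  ∀ p : ℝ, 0 ≤ p → p < r →
    (W * choiState (depolarized U p)).trace.re < 0 ∧ depolarized U p ∉ cliffordPolytope d

end

end QuditClifford

namespace QuditClifford

noncomputable section

variable {d : ℕ} [NeZero d]

-- Compressing the Choi vector of a gate `C` with the parity code leaves, up to 1/√d, the vector of
-- amplitudes `C (-j) j`. The marginals of the Choi state of a unitary are maximally mixed, so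
-- discarding the weight-one part does not change expectations, and ⟨J_C|W|J_C⟩ is the quadratic
-- form of A(u) at that vector (`expect_witnessB`). Up to the factor 1/d, A(u) is a sum of one
-- projector from each of the d+1 mutually unbiased bases, minus the identity; the bases are the
-- standard one and, for each y, the quadratic phases ω^(yj²+kj). A multiple of a basis vector
-- therefore has value zero unless A(u) selects it, and then the value is nonnegative. Clifford
-- gates give only such multiples (`IsClifford.phaseForm_nonneg`), so every vertex satisfies the
-- inequality.
--
-- For the facet rank, one computes the annihilator of the saturating Choi projectors. It contains A
-- ⊗ 1 + 1 ⊗ B + cW with A, B traceless, a space of dimension 2(d²-1)+1, and d⁴ minus this is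
-- (d²-1)². That nothing else occurs is `eq_zero_of_expect_eq_zero`: expectations on the Clifford
-- gates with full support are Fourier transforms of Weyl coefficients, saturation confines each
-- transform to a line, and the resulting phase relations contradict each other unless the labels
-- κ(y) are affine in y. One nonzero second difference of κ therefore suffices.
--
-- The witness bounds the robustness from below. For an antidiagonal gate with phases w, the
-- matching upper bound is an explicit mixture (`depolarized_mem_cliffordPolytope`): antidiagonal
-- quadratic gates weighted by the overlaps |⟨ψ_(y,k)|w⟩|² minus their minimum over k, together with
-- shifted gates that supply the missing depolarization. The weights are nonnegative exactly when
-- κ(y) minimizes the overlap in each basis, and they have total mass one at the noise rate where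
-- the witness vanishes.
--
-- The three gates are antidiagonal. What remains is to find the minimizing overlaps: cosines of
-- multiples of π/9 for d = 3, and cubic exponential sums for d = 5 and d = 7, where completing the
-- cube makes the minimum independent of y.

/-- The additive character `x ↦ ω^x` of `ZMod d`. -/
abbrev chi : AddChar (ZMod d) ℂ := ZMod.stdAddChar

-- Characters and matrix entries of Pauli operators

theorem omega_pow (n : ℕ) : omega d ^ n = chi (n : ZMod d) := by
  have h := ZMod.stdAddChar_coe (N := d) (n : ℤ)
  rw [Int.cast_natCast] at h
  rw [h, omega, ← Complex.exp_nat_mul]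
  congr 1
  push_cast
  ring

theorem omega_pow_val (x : ZMod d) : omega d ^ x.val = chi x := by
  rw [omega_pow, ZMod.natCast_zmod_val]

theorem omega_inv_pow (n : ℕ) : (omega d)⁻¹ ^ n = chi (-(n : ZMod d)) := by
  rw [inv_pow, omega_pow, AddChar.map_neg_eq_inv]

theorem star_chi (x : ZMod d) : (starRingEnd ℂ) (chi x) = chi (-x) :=
  (AddChar.map_neg_eq_conj _ x).symm

theorem normSq_chi (x : ZMod d) : Complex.normSq (chi x) = 1 := by
  rw [Complex.normSq_eq_norm_sq, AddChar.norm_apply, one_pow]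

theorem chi_mul_neg (x : ZMod d) : chi x * chi (-x) = 1 := by
  rw [← AddChar.map_add_eq_mul, add_neg_cancel, AddChar.map_zero_eq_one]

theorem sum_chi_mul (b : ZMod d) : ∑ x : ZMod d, chi (x * b) = if b = 0 then (d : ℂ) else 0 := by
  rw [AddChar.sum_mulShift b (ZMod.isPrimitive_stdAddChar d), ZMod.card]
  split_ifs <;> simp

theorem natCast_dim_ne_zero : (d : ℂ) ≠ 0 := by exact_mod_cast NeZero.ne d

theorem shiftX_apply (i j : ZMod d) : shiftX d i j = if i = j + 1 then 1 else 0 := rfl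

theorem shiftX_pow_apply (n : ℕ) (i j : ZMod d) :
    (shiftX d ^ n) i j = if i = j + n then 1 else 0 := by
  induction n generalizing i j with
  | zero => simp [Matrix.one_apply]
  | succ n ih =>
    rw [pow_succ, Matrix.mul_apply]
    simp only [ih, shiftX_apply, mul_ite, mul_one, mul_zero]
    rw [Finset.sum_ite_eq' Finset.univ (j + 1)]
    simp only [Finset.mem_univ, if_true, Nat.cast_succ]
    congr 1
    rw [add_assoc, add_comm (1 : ZMod d)]

theorem clockZ_pow (n : ℕ) :
    clockZ d ^ n = Matrix.diagonal fun j => chi ((n : ZMod d) * j) := by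
  rw [clockZ, Matrix.diagonal_pow]
  congr 1
  funext j
  rw [Pi.pow_apply, omega_pow_val, ← AddChar.map_nsmul_eq_pow, nsmul_eq_mul]

theorem pauli_apply (a b i j : ZMod d) :
    pauli a b i j = if i = j + a then chi (b * j) else 0 := by
  rw [pauli, clockZ_pow, Matrix.mul_diagonal, shiftX_pow_apply]
  simp

theorem pauliTwo_apply (x₁ x₂ z₁ z₂ : ZMod d) (i j : ZMod d × ZMod d) :
    pauliTwo x₁ x₂ z₁ z₂ i j =
      if i.1 = j.1 + x₁ ∧ i.2 = j.2 + x₂ then chi (z₁ * j.1 + z₂ * j.2) else 0 := by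
  rw [pauliTwo, ← Matrix.mul_kronecker_mul, Matrix.kronecker_apply]
  change pauli x₁ z₁ i.1 j.1 * pauli x₂ z₂ i.2 j.2 = _
  rw [pauli_apply, pauli_apply, AddChar.map_add_eq_mul]
  split_ifs <;> simp_all

/-- The sum over exponents `m < d` as a sum over `ZMod d`. -/
theorem sum_range_eq_sum_zmod {M : Type*} [AddCommMonoid M] (f : ZMod d → M) :
    ∑ m ∈ Finset.range d, f (m : ZMod d) = ∑ x : ZMod d, f x := by
  rw [Finset.sum_range]
  refine Fintype.sum_equiv (ZMod.finEquiv d).toEquiv _ _ fun i => ?_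
  congr 1
  -- For a successor modulus `ZMod` is `Fin` by definition, so `ZMod.finEquiv` unfolds to the
  -- identity.
  obtain ⟨n, rfl⟩ := Nat.exists_eq_succ_of_ne_zero (NeZero.ne d)
  simp [ZMod.finEquiv]
  exact Fin.cast_val_eq_self i

-- Eigenprojectors and phase point operators in coordinates

section Prime

variable [Fact d.Prime]

/-- The triangular number `j(j-1)/2` in `ZMod d`. -/
def tri (j : ZMod d) : ZMod d := (j ^ 2 - j) / 2

theorem tri_succ (h2 : (2 : ZMod d) ≠ 0) (j : ZMod d) : tri (j + 1) = tri j + j := by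
  unfold tri
  field_simp
  ring

/-- Each step j → j+1 contributes the phase ω^(bj), and these exponents sum to b times a difference
of triangular numbers. -/
theorem pauli_one_pow_apply (h2 : (2 : ZMod d) ≠ 0) (b : ZMod d) (m : ℕ) (i j : ZMod d) :
    (pauli 1 b ^ m) i j = if i = j + m then chi (b * (tri i - tri j)) else 0 := by
  induction m generalizing i j with
  | zero =>
    rw [pow_zero, Matrix.one_apply, Nat.cast_zero, add_zero]
    split_ifs with h <;> simp [h]
  | succ n ih =>
    rw [pow_succ, Matrix.mul_apply]
    simp only [ih, pauli_apply, mul_ite, mul_zero]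
    rw [Finset.sum_ite_eq' Finset.univ (j + 1)]
    simp only [Finset.mem_univ, if_true, Nat.cast_succ]
    rw [add_assoc, add_comm (1 : ZMod d)]
    split_ifs with h
    · rw [← AddChar.map_add_eq_mul, tri_succ h2]
      congr 1
      ring
    · simp

theorem pauli_zero_pow_apply (b : ZMod d) (m : ℕ) (i j : ZMod d) :
    (pauli 0 b ^ m) i j = if i = j then chi ((m : ZMod d) * (b * j)) else 0 := by
  have h : pauli 0 b = Matrix.diagonal fun j => chi (b * j) := by
    ext i j
    rw [pauli_apply, Matrix.diagonal_apply, add_zero]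
    split_ifs with h <;> simp [h]
  rw [h, Matrix.diagonal_pow, Matrix.diagonal_apply, Pi.pow_apply,
    ← AddChar.map_nsmul_eq_pow, nsmul_eq_mul]
  split_ifs with h <;> simp [h]

/-- Only the power m = i - j connects j to i, so the defining sum has a single term. The result
factors in i and j: the projector is of rank one, onto a quadratic phase vector. -/
theorem eigenProj_pauli_one_apply (h2 : (2 : ZMod d) ≠ 0) (b k i j : ZMod d) :
    eigenProj (pauli 1 b) k i j =
      (d : ℂ)⁻¹ * chi (b * (tri i - tri j) - k * (i - j)) := by
  rw [eigenProj, Matrix.smul_apply, Matrix.sum_apply, smul_eq_mul]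
  congr 1
  simp only [Matrix.smul_apply, pauli_one_pow_apply h2, omega_inv_pow, smul_eq_mul,
    Nat.cast_mul, ZMod.natCast_zmod_val]
  rw [sum_range_eq_sum_zmod fun m : ZMod d =>
    chi (-(m * k)) * if i = j + m then chi (b * (tri i - tri j)) else 0]
  rw [Finset.sum_eq_single (i - j)]
  · rw [if_pos (by ring), ← AddChar.map_add_eq_mul]
    congr 1
    ring
  · intro m _ hm
    rw [if_neg, mul_zero]
    rintro rfl
    exact hm (by ring)
  · simp

theorem eigenProj_pauli_zero_apply (k i j : ZMod d) :
    eigenProj (pauli 0 1) k i j = if i = j ∧ j = k then 1 else 0 := by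
  rw [eigenProj, Matrix.smul_apply, Matrix.sum_apply, smul_eq_mul]
  simp only [Matrix.smul_apply, pauli_zero_pow_apply, omega_inv_pow, smul_eq_mul,
    Nat.cast_mul, ZMod.natCast_zmod_val]
  rw [sum_range_eq_sum_zmod fun m : ZMod d =>
    chi (-(m * k)) * if i = j then chi (m * (1 * j)) else 0]
  by_cases hij : i = j
  · simp only [hij, true_and, if_true, ← AddChar.map_add_eq_mul]
    have : ∀ m : ZMod d, -(m * k) + m * (1 * j) = m * (j - k) := fun m => by ring
    simp only [this, sum_chi_mul, sub_eq_zero]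
    split_ifs
    · exact inv_mul_cancel₀ natCast_dim_ne_zero
    · simp
  · simp [hij]

/-- The labels `u₂, …, u_(d+1)` as a function on `ZMod d`. -/
def label (u : Fin (d + 1) → ZMod d) (b : ZMod d) : ZMod d :=
  u (Fin.succ ⟨b.val, ZMod.val_lt b⟩)

/-- The eigenvalue labels in the coordinates `ψ_(y,k)(j) = ω^(y j² + k j)` of the
mutually unbiased bases. -/
def kappa (u : Fin (d + 1) → ZMod d) (y : ZMod d) : ZMod d := -y - label u (2 * y)

theorem phasePoint_apply (h2 : (2 : ZMod d) ≠ 0) (u : Fin (d + 1) → ZMod d) (i j : ZMod d) :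
    phasePoint u i j = (d : ℂ)⁻¹ * ((if i = j ∧ j = u 0 then 1 else 0)
      + (d : ℂ)⁻¹ * ∑ y : ZMod d, chi (y * (i ^ 2 - j ^ 2) + kappa u y * (i - j))
      - if i = j then 1 else 0) := by
  rw [phasePoint, Matrix.smul_apply, smul_eq_mul, Matrix.sub_apply, Matrix.add_apply,
    Matrix.sum_apply, eigenProj_pauli_zero_apply, Matrix.one_apply]
  simp only [eigenProj_pauli_one_apply h2]
  rw [← Finset.mul_sum]
  congr 4
  have hb : ∑ b : Fin d, chi (((b : ℕ) : ZMod d) * (tri i - tri j) - u b.succ * (i - j)) =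
      ∑ b : ZMod d, chi (b * (tri i - tri j) - label u b * (i - j)) := by
    rw [← sum_range_eq_sum_zmod, Finset.sum_range]
    refine Finset.sum_congr rfl fun b _ => ?_
    congr 4
    simp [ZMod.val_natCast, Nat.mod_eq_of_lt b.2]
  rw [hb]
  symm
  refine Fintype.sum_equiv (Equiv.mulLeft₀ (2 : ZMod d) h2) _ _ fun y => ?_
  congr 1
  simp only [Equiv.mulLeft₀_apply, kappa, tri]
  field_simp
  ring

end Prime

-- The weight-two part through partial traces

section PartialTrace

/-- The partial trace over the second factor. -/
def traceSnd (M : Matrix (ZMod d × ZMod d) (ZMod d × ZMod d) ℂ) : Matrix (ZMod d) (ZMod d) ℂ :=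
  Matrix.of fun i j => ∑ k, M (i, k) (j, k)

/-- The partial trace over the first factor. -/
def traceFst (M : Matrix (ZMod d × ZMod d) (ZMod d × ZMod d) ℂ) : Matrix (ZMod d) (ZMod d) ℂ :=
  Matrix.of fun i j => ∑ k, M (k, i) (k, j)

theorem traceSnd_apply (M : Matrix (ZMod d × ZMod d) (ZMod d × ZMod d) ℂ) (i j : ZMod d) :
    traceSnd M i j = ∑ k, M (i, k) (j, k) := rfl

theorem traceFst_apply (M : Matrix (ZMod d × ZMod d) (ZMod d × ZMod d) ℂ) (i j : ZMod d) :
    traceFst M i j = ∑ k, M (k, i) (k, j) := rfl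

theorem trace_traceSnd (M : Matrix (ZMod d × ZMod d) (ZMod d × ZMod d) ℂ) :
    (traceSnd M).trace = M.trace := by
  simp only [Matrix.trace, Matrix.diag_apply, traceSnd_apply, Fintype.sum_prod_type]

theorem trace_traceFst (M : Matrix (ZMod d × ZMod d) (ZMod d × ZMod d) ℂ) :
    (traceFst M).trace = M.trace := by
  simp only [Matrix.trace, Matrix.diag_apply, traceFst_apply, Fintype.sum_prod_type]
  exact Finset.sum_comm

/-- Fourier inversion on `ZMod d`: the sum over z isolates q = i. -/
theorem sum_sum_chi_sub (f : ZMod d → ℂ) (i : ZMod d) :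
    ∑ z : ZMod d, ∑ q : ZMod d, chi (z * (q - i)) * f q = d * f i := by
  rw [Finset.sum_comm]
  simp only [← Finset.sum_mul, sum_chi_mul, sub_eq_zero, ite_mul, zero_mul]
  simp

theorem trace_pauliTwo_mul (x₁ x₂ z₁ z₂ : ZMod d)
    (M : Matrix (ZMod d × ZMod d) (ZMod d × ZMod d) ℂ) :
    (pauliTwo x₁ x₂ z₁ z₂ * M).trace =
      ∑ q₁, ∑ q₂, chi (z₁ * q₁ + z₂ * q₂) * M (q₁, q₂) (q₁ + x₁, q₂ + x₂) := by
  rw [Matrix.trace_mul_comm]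
  simp only [Matrix.trace, Matrix.diag_apply, Matrix.mul_apply, pauliTwo_apply,
    Fintype.sum_prod_type, mul_ite, mul_zero, ite_and, Finset.sum_ite_irrel,
    Finset.sum_const_zero, Finset.sum_ite_eq', Finset.mem_univ, if_true]
  refine Finset.sum_congr rfl fun q₁ _ => Finset.sum_congr rfl fun q₂ _ => mul_comm _ _

/-- By inclusion-exclusion on trivial tensor factors: Pauli operators trivial on one side assemble
into a partial trace tensored with the identity. The identity operator is removed twice and must be
kept once, whence the factor 2. -/
theorem weightTwoPart_eq (M : Matrix (ZMod d × ZMod d) (ZMod d × ZMod d) ℂ) :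
    weightTwoPart M = M - (d : ℂ)⁻¹ • (traceSnd M ⊗ₖ (1 : Matrix (ZMod d) (ZMod d) ℂ))
      - (d : ℂ)⁻¹ • ((1 : Matrix (ZMod d) (ZMod d) ℂ) ⊗ₖ traceFst M)
      + (2 * ((d : ℂ) ^ 2)⁻¹ * M.trace) • 1 := by
  have hd : (d : ℂ) ≠ 0 := natCast_dim_ne_zero
  ext ⟨i₁, i₂⟩ ⟨j₁, j₂⟩
  -- With a and b the indicators of a trivial first and second factor, the condition "both or
  -- neither" is 1 - a - b + 2ab.
  have hterm : ∀ x₁ x₂ z₁ z₂ : ZMod d,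
      (if (x₁ = 0 ∧ z₁ = 0 ↔ x₂ = 0 ∧ z₂ = 0) then
        (pauliTwo x₁ x₂ z₁ z₂ * M).trace • (pauliTwo x₁ x₂ z₁ z₂)ᴴ else 0) (i₁, i₂) (j₁, j₂) =
      if x₁ = j₁ - i₁ then (if x₂ = j₂ - i₂ then
        (1 - (if x₁ = 0 then (if z₁ = 0 then 1 else 0) else 0)
          - (if x₂ = 0 then (if z₂ = 0 then 1 else 0) else 0)
          + 2 * ((if x₁ = 0 then (if z₁ = 0 then 1 else 0) else 0) *
            (if x₂ = 0 then (if z₂ = 0 then 1 else 0) else 0))) *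
        ∑ q₁, ∑ q₂, chi (z₁ * (q₁ - i₁)) * (chi (z₂ * (q₂ - i₂)) *
          M (q₁, q₂) (q₁ + x₁, q₂ + x₂)) else 0) else (0 : ℂ) := by
    intro x₁ x₂ z₁ z₂
    have e1 : j₁ = i₁ + x₁ ↔ x₁ = j₁ - i₁ := by
      constructor
      · rintro rfl; ring
      · rintro rfl; ring
    have e2 : j₂ = i₂ + x₂ ↔ x₂ = j₂ - i₂ := by
      constructor
      · rintro rfl; ring
      · rintro rfl; ring
    have hval : (pauliTwo x₁ x₂ z₁ z₂ * M).trace * (pauliTwo x₁ x₂ z₁ z₂)ᴴ (i₁, i₂) (j₁, j₂) =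
        if x₁ = j₁ - i₁ then (if x₂ = j₂ - i₂ then
        ∑ q₁, ∑ q₂, chi (z₁ * (q₁ - i₁)) * (chi (z₂ * (q₂ - i₂)) *
          M (q₁, q₂) (q₁ + x₁, q₂ + x₂)) else 0) else 0 := by
      rw [trace_pauliTwo_mul, Matrix.conjTranspose_apply, pauliTwo_apply]
      simp only [e1, e2, ite_and]
      split_ifs with h1 h2
      · rw [Finset.sum_mul]
        refine Finset.sum_congr rfl fun q₁ _ => ?_
        rw [Finset.sum_mul]
        refine Finset.sum_congr rfl fun q₂ _ => ?_
        rw [← mul_assoc (chi (z₁ * (q₁ - i₁))), ← AddChar.map_add_eq_mul, mul_right_comm]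
        congr 1
        change _ * (starRingEnd ℂ) _ = _
        rw [star_chi, ← AddChar.map_add_eq_mul]
        congr 1
        ring
      · simp
      · simp
    rw [apply_ite (fun N : Matrix (ZMod d × ZMod d) (ZMod d × ZMod d) ℂ =>
      N (i₁, i₂) (j₁, j₂)), Matrix.smul_apply, smul_eq_mul, hval, Matrix.zero_apply]
    by_cases ha : x₁ = 0 <;> by_cases hb : z₁ = 0 <;> by_cases hc : x₂ = 0 <;>
      by_cases hd' : z₂ = 0 <;> simp only [ha, hb, hc, hd', and_true, and_false,
      if_true, if_false, iff_true, iff_false, iff_self, not_true] <;>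
      split_ifs <;> ring
  set f : ZMod d → ZMod d → ℂ := fun q₁ q₂ => M (q₁, q₂) (q₁ + (j₁ - i₁), q₂ + (j₂ - i₂)) with hf
  set g : ZMod d → ZMod d → ℂ := fun z₁ z₂ =>
    ∑ q₁, ∑ q₂, chi (z₁ * (q₁ - i₁)) * (chi (z₂ * (q₂ - i₂)) * f q₁ q₂) with hg
  -- Summing over all characters returns an entry of `M`, summing over one side with the other
  -- character trivial returns a partial trace entry, and the term with both characters trivial
  -- returns a sum along both displacements.
  have g0 : ∑ z₁, ∑ z₂, g z₁ z₂ = d * (d * f i₁ i₂) := by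
    rw [← sum_sum_chi_sub (fun q => f i₁ q) i₂, Finset.sum_comm, Finset.mul_sum]
    refine Finset.sum_congr rfl fun z₂ _ => ?_
    rw [← sum_sum_chi_sub (fun q => ∑ q₂, chi (z₂ * (q₂ - i₂)) * f q q₂) i₁]
    simp only [hg, Finset.mul_sum]
  have g1 : ∑ z₂, g 0 z₂ = d * ∑ q₁, f q₁ i₂ := by
    rw [Finset.mul_sum]
    simp only [hg, zero_mul, AddChar.map_zero_eq_one, one_mul]
    rw [Finset.sum_comm]
    exact Finset.sum_congr rfl fun q₁ _ => sum_sum_chi_sub (fun q => f q₁ q) i₂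
  have g2 : ∑ z₁, g z₁ 0 = d * ∑ q₂, f i₁ q₂ := by
    rw [← sum_sum_chi_sub (fun q => ∑ q₂, f q q₂) i₁]
    simp only [hg, zero_mul, AddChar.map_zero_eq_one, one_mul, Finset.mul_sum]
  have g3 : g 0 0 = ∑ q₁, ∑ q₂, f q₁ q₂ := by
    simp only [hg, zero_mul, AddChar.map_zero_eq_one, one_mul]
  have hsum : (weightTwoPart M) (i₁, i₂) (j₁, j₂) = ((d : ℂ) ^ 2)⁻¹ *
      (∑ z₁, ∑ z₂, g z₁ z₂ - (if j₁ - i₁ = 0 then ∑ z₂, g 0 z₂ else 0)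
        - (if j₂ - i₂ = 0 then ∑ z₁, g z₁ 0 else 0)
        + 2 * (if j₁ - i₁ = 0 then (if j₂ - i₂ = 0 then g 0 0 else 0) else 0)) := by
    rw [weightTwoPart, Matrix.smul_apply, smul_eq_mul]
    congr 1
    simp only [Matrix.sum_apply, hterm, Finset.sum_ite_irrel, Finset.sum_const_zero]
    simp only [Finset.sum_ite_eq', Finset.mem_univ, if_true]
    have : ∀ z₁ z₂ : ZMod d, ∑ q₁, ∑ q₂, chi (z₁ * (q₁ - i₁)) * (chi (z₂ * (q₂ - i₂)) *
          M (q₁, q₂) (q₁ + (j₁ - i₁), q₂ + (j₂ - i₂))) = g z₁ z₂ := fun _ _ => rfl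
    simp only [this]
    by_cases h1 : j₁ - i₁ = 0 <;> by_cases h2 : j₂ - i₂ = 0 <;>
      simp only [h1, h2, if_true, if_false, sub_zero, mul_zero, zero_mul, add_zero, one_mul,
        add_mul, sub_mul, Finset.sum_add_distrib, Finset.sum_sub_distrib, ite_mul, mul_ite,
        Finset.sum_ite_irrel, Finset.sum_const_zero, Finset.sum_ite_eq', Finset.mem_univ,
        mul_one]
  rw [hsum, g0, g1, g2, g3]
  simp only [Matrix.add_apply, Matrix.sub_apply, Matrix.smul_apply, Matrix.kronecker_apply,
    smul_eq_mul, traceSnd_apply, traceFst_apply, Matrix.one_apply, Matrix.trace,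
    Matrix.diag_apply, Fintype.sum_prod_type, Prod.mk.injEq, hf, sub_eq_zero]
  have s1 : ∀ i j : ZMod d, i + (j - i) = j := fun i j => by ring
  simp only [s1]
  by_cases h1 : i₁ = j₁
  · subst h1
    by_cases h2 : i₂ = j₂
    · subst h2
      simp only [sub_self, add_zero, if_true, and_self, mul_one, one_mul]
      field_simp
      ring
    · have h2' : ¬ j₂ = i₂ := fun h => h2 h.symm
      simp only [h2, h2', sub_self, add_zero, if_true, if_false, and_false, one_mul]
      field_simp
      ring
  · have h1' : ¬ j₁ = i₁ := fun h => h1 h.symm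
    by_cases h2 : i₂ = j₂
    · subst h2
      simp only [h1, h1', sub_self, add_zero, if_true, if_false, false_and, mul_one]
      field_simp
      ring
    · have h2' : ¬ j₂ = i₂ := fun h => h2 h.symm
      simp only [h1, h1', h2, h2', if_false, false_and]
      field_simp
      ring

end PartialTrace

-- Expectations in Choi vectors

section ChoiVec

theorem choiVec_apply (C : Matrix (ZMod d) (ZMod d) ℂ) (p : ZMod d × ZMod d) :
    choiVec C p = ((Real.sqrt d : ℝ) : ℂ)⁻¹ * C p.2 p.1 := by
  obtain ⟨a, b⟩ := p
  simp only [choiVec, Matrix.mulVec, dotProduct, Matrix.kronecker_apply, Fintype.sum_prod_type,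
    Matrix.one_apply, ite_mul, mul_ite, one_mul, zero_mul, mul_zero,
    Finset.sum_ite_eq, Finset.mem_univ, if_true]
  rw [mul_comm]

/-- The expectation `⟨J_C|W|J_C⟩` as a complex number. -/
def expect (W : Matrix (ZMod d × ZMod d) (ZMod d × ZMod d) ℂ)
    (C : Matrix (ZMod d) (ZMod d) ℂ) : ℂ :=
  star (choiVec C) ⬝ᵥ (W *ᵥ choiVec C)

theorem sqrt_inv_mul_self :
    ((Real.sqrt d : ℝ) : ℂ)⁻¹ * ((Real.sqrt d : ℝ) : ℂ)⁻¹ = (d : ℂ)⁻¹ := by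
  rw [← mul_inv, ← Complex.ofReal_mul, Real.mul_self_sqrt (Nat.cast_nonneg d),
    Complex.ofReal_natCast]

theorem expect_apply (W : Matrix (ZMod d × ZMod d) (ZMod d × ZMod d) ℂ)
    (C : Matrix (ZMod d) (ZMod d) ℂ) :
    expect W C = (d : ℂ)⁻¹ * ∑ a, ∑ b, ∑ a', ∑ b',
      (starRingEnd ℂ) (C b a) * W (a, b) (a', b') * C b' a' := by
  simp only [expect, dotProduct, Matrix.mulVec, Fintype.sum_prod_type, choiVec_apply,
    Finset.mul_sum, Pi.star_apply, star_mul', RCLike.star_def, map_inv₀, Complex.conj_ofReal]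
  rw [← sqrt_inv_mul_self]
  refine Finset.sum_congr rfl fun a _ => Finset.sum_congr rfl fun b _ =>
    Finset.sum_congr rfl fun a' _ => Finset.sum_congr rfl fun b' _ => ?_
  ring

theorem expect_add (W W' : Matrix (ZMod d × ZMod d) (ZMod d × ZMod d) ℂ)
    (C : Matrix (ZMod d) (ZMod d) ℂ) : expect (W + W') C = expect W C + expect W' C := by
  rw [expect, Matrix.add_mulVec, dotProduct_add, expect, expect]

theorem expect_sub (W W' : Matrix (ZMod d × ZMod d) (ZMod d × ZMod d) ℂ)
    (C : Matrix (ZMod d) (ZMod d) ℂ) : expect (W - W') C = expect W C - expect W' C := by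
  rw [expect, Matrix.sub_mulVec, dotProduct_sub, expect, expect]

theorem expect_smul (c : ℂ) (W : Matrix (ZMod d × ZMod d) (ZMod d × ZMod d) ℂ)
    (C : Matrix (ZMod d) (ZMod d) ℂ) : expect (c • W) C = c * expect W C := by
  rw [expect, Matrix.smul_mulVec, dotProduct_smul, expect, smul_eq_mul]

theorem conjTranspose_mul_self_apply {C : Matrix (ZMod d) (ZMod d) ℂ}
    (hC : C ∈ Matrix.unitaryGroup (ZMod d) ℂ) (a a' : ZMod d) :
    ∑ b, (starRingEnd ℂ) (C b a) * C b a' = if a = a' then 1 else 0 := by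
  have h := congrFun (congrFun (Matrix.mem_unitaryGroup_iff'.mp hC) a) a'
  rwa [Matrix.mul_apply, Matrix.one_apply] at h

theorem mul_conjTranspose_self_apply {C : Matrix (ZMod d) (ZMod d) ℂ}
    (hC : C ∈ Matrix.unitaryGroup (ZMod d) ℂ) (b b' : ZMod d) :
    ∑ a, C b a * (starRingEnd ℂ) (C b' a) = if b = b' then 1 else 0 := by
  have h := congrFun (congrFun (Matrix.mem_unitaryGroup_iff.mp hC) b) b'
  rwa [Matrix.mul_apply, Matrix.one_apply] at h

/-- The columns of a unitary are orthonormal, so the first marginal of its Choi state is the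
maximally mixed state. -/
theorem expect_kronecker_one {C : Matrix (ZMod d) (ZMod d) ℂ}
    (hC : C ∈ Matrix.unitaryGroup (ZMod d) ℂ) (A : Matrix (ZMod d) (ZMod d) ℂ) :
    expect (A ⊗ₖ (1 : Matrix (ZMod d) (ZMod d) ℂ)) C = (d : ℂ)⁻¹ * A.trace := by
  rw [expect_apply]
  congr 1
  simp only [Matrix.kronecker_apply, Matrix.one_apply, mul_ite, mul_one, mul_zero, ite_mul,
    zero_mul, Finset.sum_ite_eq, Finset.mem_univ, if_true]
  rw [Matrix.trace]
  refine Finset.sum_congr rfl fun a _ => ?_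
  rw [Finset.sum_comm]
  have : ∀ a' : ZMod d, ∑ b, (starRingEnd ℂ) (C b a) * A a a' * C b a' =
      A a a' * if a = a' then 1 else 0 := by
    intro a'
    rw [← conjTranspose_mul_self_apply hC, Finset.mul_sum]
    exact Finset.sum_congr rfl fun b _ => by ring
  simp only [this]
  simp

theorem expect_one_kronecker {C : Matrix (ZMod d) (ZMod d) ℂ}
    (hC : C ∈ Matrix.unitaryGroup (ZMod d) ℂ) (B : Matrix (ZMod d) (ZMod d) ℂ) :
    expect ((1 : Matrix (ZMod d) (ZMod d) ℂ) ⊗ₖ B) C = (d : ℂ)⁻¹ * B.trace := by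
  rw [expect_apply]
  congr 1
  simp only [Matrix.kronecker_apply, Matrix.one_apply, mul_ite, mul_zero, ite_mul, one_mul,
    zero_mul, Finset.sum_ite_irrel, Finset.sum_const_zero, Finset.sum_ite_eq, Finset.mem_univ,
    if_true]
  rw [Finset.sum_comm, Matrix.trace]
  refine Finset.sum_congr rfl fun b _ => ?_
  rw [Finset.sum_comm]
  have : ∀ b' : ZMod d, ∑ a, (starRingEnd ℂ) (C b a) * B b b' * C b' a =
      B b b' * if b' = b then 1 else 0 := by
    intro b'
    rw [← mul_conjTranspose_self_apply hC, Finset.mul_sum]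
    exact Finset.sum_congr rfl fun a _ => by ring
  simp only [this]
  simp

theorem expect_one {C : Matrix (ZMod d) (ZMod d) ℂ}
    (hC : C ∈ Matrix.unitaryGroup (ZMod d) ℂ) : expect 1 C = 1 := by
  rw [← Matrix.one_kronecker_one, expect_kronecker_one hC, Matrix.trace_one, ZMod.card]
  exact inv_mul_cancel₀ natCast_dim_ne_zero

/-- Each of the two partial-trace terms has expectation tr M / d², which the identity term restores.
-/
theorem expect_weightTwoPart {C : Matrix (ZMod d) (ZMod d) ℂ}
    (hC : C ∈ Matrix.unitaryGroup (ZMod d) ℂ)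
    (M : Matrix (ZMod d × ZMod d) (ZMod d × ZMod d) ℂ) :
    expect (weightTwoPart M) C = expect M C := by
  rw [weightTwoPart_eq, expect_add, expect_sub, expect_sub, expect_smul, expect_smul,
    expect_smul, expect_kronecker_one hC, expect_one_kronecker hC, expect_one hC,
    trace_traceSnd, trace_traceFst]
  ring

end ChoiVec

-- The witness as a quadratic form on the antidiagonal

section Witness

variable [Fact d.Prime]

/-- The (unnormalized) quadratic phase vector `ψ_(y,k)(j) = ω^(y j² + k j)`. -/
def quadPhase (y k : ZMod d) : ZMod d → ℂ := fun j => chi (y * j ^ 2 + k * j)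

/-- The overlap `⟨ψ_(y,k)|v⟩`. -/
def ampl (y k : ZMod d) (v : ZMod d → ℂ) : ℂ := star (quadPhase y k) ⬝ᵥ v

theorem ampl_eq_sum (y k : ZMod d) (v : ZMod d → ℂ) :
    ampl y k v = ∑ j, chi (-(y * j ^ 2 + k * j)) * v j := by
  simp only [ampl, dotProduct, quadPhase, Pi.star_apply, RCLike.star_def, star_chi]

/-- The quadratic form `⟨v|A(u)|v⟩` of the phase point operator. -/
def phaseForm (u : Fin (d + 1) → ZMod d) (v : ZMod d → ℂ) : ℝ :=
  (d : ℝ)⁻¹ * (normSq (v (u 0)) + (d : ℝ)⁻¹ * ∑ y, normSq (ampl y (kappa u y) v)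
    - ∑ j, normSq (v j))

theorem phasePoint_eq (h2 : (2 : ZMod d) ≠ 0) (u : Fin (d + 1) → ZMod d) :
    phasePoint u = (d : ℂ)⁻¹ • (Matrix.single (u 0) (u 0) 1
      + (d : ℂ)⁻¹ • ∑ y, vecMulVec (quadPhase y (kappa u y)) (star (quadPhase y (kappa u y)))
      - 1) := by
  ext i j
  rw [phasePoint_apply h2]
  simp only [Matrix.smul_apply, Matrix.sub_apply, Matrix.add_apply, Matrix.sum_apply, smul_eq_mul,
    Matrix.vecMulVec_apply, quadPhase, Pi.star_apply, RCLike.star_def, star_chi,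
    ← AddChar.map_add_eq_mul, Matrix.one_apply, Matrix.single_apply]
  have hif : i = j ∧ j = u 0 ↔ u 0 = i ∧ u 0 = j := by
    constructor
    · rintro ⟨rfl, rfl⟩; exact ⟨rfl, rfl⟩
    · rintro ⟨rfl, rfl⟩; exact ⟨rfl, rfl⟩
  have hs : ∀ y k : ZMod d, y * i ^ 2 + k * i + -(y * j ^ 2 + k * j) =
      y * (i ^ 2 - j ^ 2) + k * (i - j) := fun y k => by ring
  simp only [hif, hs]

theorem quadForm_vecMulVec (a v : ZMod d → ℂ) :
    star v ⬝ᵥ (vecMulVec a (star a) *ᵥ v) = (normSq (star a ⬝ᵥ v) : ℂ) := by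
  rw [Complex.normSq_eq_conj_mul_self, Matrix.vecMulVec_mulVec, dotProduct_smul,
    ← RCLike.star_def, ← Matrix.star_dotProduct]
  simp [mul_comm]

theorem phasePoint_quadForm (h2 : (2 : ZMod d) ≠ 0) (u : Fin (d + 1) → ZMod d)
    (v : ZMod d → ℂ) : star v ⬝ᵥ (phasePoint u *ᵥ v) = (phaseForm u v : ℂ) := by
  rw [phasePoint_eq h2, Matrix.smul_mulVec, dotProduct_smul, Matrix.sub_mulVec, dotProduct_sub,
    Matrix.add_mulVec, dotProduct_add, Matrix.smul_mulVec, dotProduct_smul, Matrix.sum_mulVec,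
    dotProduct_sum, Matrix.one_mulVec]
  simp only [quadForm_vecMulVec, phaseForm, smul_eq_mul, ampl]
  push_cast
  congr 3
  · rw [Complex.normSq_eq_conj_mul_self]
    simp [dotProduct, Matrix.mulVec, Matrix.single_apply, ite_and]
  · simp only [Complex.normSq_eq_conj_mul_self]
    rfl

theorem phasePoint_isHermitian (h2 : (2 : ZMod d) ≠ 0) (u : Fin (d + 1) → ZMod d) :
    (phasePoint u).IsHermitian := by
  rw [Matrix.IsHermitian, phasePoint_eq h2]
  simp only [Matrix.conjTranspose_smul, Matrix.conjTranspose_sub, Matrix.conjTranspose_add,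
    Matrix.conjTranspose_sum, Matrix.conjTranspose_vecMulVec, star_star,
    Matrix.conjTranspose_single, Matrix.conjTranspose_one, star_one, star_inv₀, star_natCast]

theorem trace_phasePoint (h2 : (2 : ZMod d) ≠ 0) (u : Fin (d + 1) → ZMod d) :
    (phasePoint u).trace = (d : ℂ)⁻¹ := by
  have hd : (d : ℂ) ≠ 0 := natCast_dim_ne_zero
  rw [phasePoint_eq h2]
  have h : ∀ y k : ZMod d, (vecMulVec (quadPhase y k) (star (quadPhase y k))).trace = d := by
    intro y k
    rw [Matrix.trace_vecMulVec]
    simp only [dotProduct, quadPhase, Pi.star_apply, RCLike.star_def, star_chi, chi_mul_neg]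
    simp
  simp only [Matrix.trace_smul, Matrix.trace_sub, Matrix.trace_add, Matrix.trace_sum, h,
    Matrix.trace_single_eq_same, Matrix.trace_one, smul_eq_mul, Finset.sum_const,
    Finset.card_univ, ZMod.card, nsmul_eq_mul]
  field_simp
  ring

/-- The absolute values of the quadratic Gauss sums. -/
theorem normSq_sum_chi_quadratic (h2 : (2 : ZMod d) ≠ 0) (a b : ZMod d) :
    normSq (∑ j : ZMod d, chi (a * j ^ 2 + b * j)) =
      if a = 0 then (if b = 0 then (d : ℝ) ^ 2 else 0) else d := by
  have hd : (d : ℂ) ≠ 0 := natCast_dim_ne_zero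
  by_cases ha : a = 0
  · subst ha
    have h : ∀ j : ZMod d, chi (0 * j ^ 2 + b * j) = chi (j * b) := fun j => by
      congr 1; ring
    simp only [h, sum_chi_mul]
    split_ifs
    · simp [sq]
    · simp
  · rw [if_neg ha]
    have : ((normSq (∑ j : ZMod d, chi (a * j ^ 2 + b * j)) : ℝ) : ℂ) = (d : ℝ) := by
      rw [Complex.normSq_eq_conj_mul_self, map_sum, Finset.sum_mul]
      have h : ∀ j : ZMod d, (starRingEnd ℂ) (chi (a * j ^ 2 + b * j)) *
          ∑ i : ZMod d, chi (a * i ^ 2 + b * i) =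
          ∑ h : ZMod d, chi (a * h ^ 2 + b * h) * chi (j * (2 * a * h)) := by
        intro j
        rw [Finset.mul_sum, ← Equiv.sum_comp (Equiv.addLeft j)]
        refine Finset.sum_congr rfl fun i _ => ?_
        rw [star_chi, ← AddChar.map_add_eq_mul, ← AddChar.map_add_eq_mul]
        congr 1
        simp only [Equiv.coe_addLeft]
        ring
      simp only [h]
      rw [Finset.sum_comm]
      simp only [← Finset.mul_sum, sum_chi_mul, mul_eq_zero, h2, ha, false_or]
      simp
    exact_mod_cast this

theorem normSq_ampl_quadPhase (h2 : (2 : ZMod d) ≠ 0) (y k y' k' : ZMod d) :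
    normSq (ampl y' k' (quadPhase y k)) =
      if y' = y then (if k' = k then (d : ℝ) ^ 2 else 0) else d := by
  have h : ampl y' k' (quadPhase y k) = ∑ j, chi ((y - y') * j ^ 2 + (k - k') * j) := by
    rw [ampl_eq_sum]
    refine Finset.sum_congr rfl fun j _ => ?_
    rw [quadPhase, ← AddChar.map_add_eq_mul]
    congr 1
    ring
  rw [h, normSq_sum_chi_quadratic h2]
  simp only [sub_eq_zero, eq_comm]

theorem ampl_smul (y k : ZMod d) (c : ℂ) (v : ZMod d → ℂ) :
    ampl y k (c • v) = c * ampl y k v := by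
  rw [ampl, dotProduct_smul, smul_eq_mul, ampl]

/-- Mutual unbiasedness: the d bases other than the vector's own contribute 1/d each, which cancels
the subtracted identity. What is left is the overlap within its own basis, 0 or 1 up to scale. -/
theorem phaseForm_smul_quadPhase (h2 : (2 : ZMod d) ≠ 0) (u : Fin (d + 1) → ZMod d) (c : ℂ)
    (y k : ZMod d) :
    phaseForm u (c • quadPhase y k) = if kappa u y = k then normSq c else 0 := by
  have hd : (d : ℝ) ≠ 0 := by exact_mod_cast NeZero.ne d
  have hq : ∀ j, normSq ((c • quadPhase y k) j) = normSq c := fun j => by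
    rw [Pi.smul_apply, smul_eq_mul, normSq_mul, quadPhase, normSq_chi, mul_one]
  simp only [phaseForm, hq, ampl_smul, normSq_mul, normSq_ampl_quadPhase h2,
    Finset.sum_const, Finset.card_univ, ZMod.card, nsmul_eq_mul, ← Finset.mul_sum]
  rw [← Finset.add_sum_erase _ _ (Finset.mem_univ y), if_pos rfl,
    Finset.sum_congr rfl fun x hx => if_neg (Finset.ne_of_mem_erase hx), Finset.sum_const,
    Finset.card_erase_of_mem (Finset.mem_univ y), Finset.card_univ, ZMod.card, nsmul_eq_mul,
    Nat.cast_sub (NeZero.one_le)]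
  push_cast
  split_ifs
  · field_simp
    ring
  · field_simp
    ring

theorem phaseForm_single (u : Fin (d + 1) → ZMod d) (c : ℂ) (j : ZMod d) :
    phaseForm u (Pi.single j c) = if j = u 0 then (d : ℝ)⁻¹ * normSq c else 0 := by
  have hd : (d : ℝ) ≠ 0 := by exact_mod_cast NeZero.ne d
  have ha : ∀ y k, normSq (ampl y k (Pi.single j c)) = normSq c := fun y k => by
    rw [ampl, dotProduct_single, normSq_mul, Pi.star_apply, RCLike.star_def, Complex.normSq_conj,
      quadPhase, normSq_chi, one_mul]
  have hs : ∑ i, normSq ((Pi.single j c : ZMod d → ℂ) i) = normSq c := by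
    rw [Finset.sum_eq_single j]
    · simp
    · intro i _ hi
      simp [hi]
    · simp
  simp only [phaseForm, ha, hs, Finset.sum_const, Finset.card_univ, ZMod.card, nsmul_eq_mul]
  split_ifs with h
  · subst h
    simp only [Pi.single_eq_same]
    field_simp
    ring
  · rw [Pi.single_eq_of_ne' h]
    simp only [map_zero]
    field_simp
    ring

/-- The amplitudes `C_(-j,j)` that the parity code sees. -/
def antidiag (C : Matrix (ZMod d) (ZMod d) ℂ) : ZMod d → ℂ := fun j => C (-j) j

/-- The code words are |j,-j⟩, so the adjoint of the encoder reads off exactly the amplitudes `C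
(-j) j` of the Choi vector. -/
theorem expect_parityEncoder (A C : Matrix (ZMod d) (ZMod d) ℂ) :
    expect (parityEncoder d * A * (parityEncoder d)ᴴ) C =
      (d : ℂ)⁻¹ * (star (antidiag C) ⬝ᵥ (A *ᵥ antidiag C)) := by
  have h : (parityEncoder d)ᴴ *ᵥ choiVec C = ((Real.sqrt d : ℝ) : ℂ)⁻¹ • antidiag C := by
    ext j
    simp only [Matrix.mulVec, dotProduct, Matrix.conjTranspose_apply, parityEncoder,
      Matrix.of_apply, choiVec_apply, Pi.smul_apply, antidiag, smul_eq_mul, apply_ite star,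
      star_one, star_zero, ite_mul, one_mul, zero_mul]
    rw [Finset.sum_ite_eq' Finset.univ (j, -j)]
    simp
  have h' : star (choiVec C) ᵥ* parityEncoder d = star ((parityEncoder d)ᴴ *ᵥ choiVec C) := by
    rw [Matrix.star_mulVec, Matrix.conjTranspose_conjTranspose]
  rw [expect, ← Matrix.mulVec_mulVec, ← Matrix.mulVec_mulVec, Matrix.dotProduct_mulVec,
    h', h, Matrix.mulVec_smul, dotProduct_smul, star_smul,
    smul_dotProduct, smul_eq_mul, smul_eq_mul, ← mul_assoc, star_inv₀, RCLike.star_def,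
    Complex.conj_ofReal, sqrt_inv_mul_self]

theorem parityEncoder_conj_mul : (parityEncoder d)ᴴ * parityEncoder d = 1 := by
  ext i j
  simp only [Matrix.mul_apply, Matrix.conjTranspose_apply, parityEncoder, Matrix.of_apply,
    apply_ite star, star_one, star_zero, ite_mul, one_mul, zero_mul]
  rw [Finset.sum_ite_eq' Finset.univ (i, -i)]
  simp [Matrix.one_apply]

theorem trace_encoded (h2 : (2 : ZMod d) ≠ 0) (u : Fin (d + 1) → ZMod d) :
    (parityEncoder d * phasePoint u * (parityEncoder d)ᴴ).trace = (d : ℂ)⁻¹ := by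
  rw [Matrix.trace_mul_comm, ← Matrix.mul_assoc, parityEncoder_conj_mul, Matrix.one_mul,
    trace_phasePoint h2]

/-- The trace normalization multiplies by d, which cancels the 1/d coming from the norm of the Choi
vector. -/
theorem expect_witnessB (h2 : (2 : ZMod d) ≠ 0) (u : Fin (d + 1) → ZMod d)
    {C : Matrix (ZMod d) (ZMod d) ℂ} (hC : C ∈ Matrix.unitaryGroup (ZMod d) ℂ) :
    expect (witnessB u) C = (phaseForm u (antidiag C) : ℂ) := by
  rw [witnessB, expect_smul, expect_weightTwoPart hC, expect_parityEncoder, trace_encoded h2,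
    phasePoint_quadForm h2, inv_inv, ← mul_assoc, mul_inv_cancel₀ natCast_dim_ne_zero, one_mul]

theorem choiExpect_witnessB (h2 : (2 : ZMod d) ≠ 0) (u : Fin (d + 1) → ZMod d)
    {C : Matrix (ZMod d) (ZMod d) ℂ} (hC : C ∈ Matrix.unitaryGroup (ZMod d) ℂ) :
    choiExpect (witnessB u) C = phaseForm u (antidiag C) := by
  change (expect (witnessB u) C).re = _
  rw [expect_witnessB h2 u hC, Complex.ofReal_re]

theorem trace_weightTwoPart (M : Matrix (ZMod d × ZMod d) (ZMod d × ZMod d) ℂ) :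
    (weightTwoPart M).trace = M.trace := by
  have hd : (d : ℂ) ≠ 0 := natCast_dim_ne_zero
  rw [weightTwoPart_eq]
  simp only [Matrix.trace_add, Matrix.trace_sub, Matrix.trace_smul, Matrix.trace_kronecker,
    trace_traceSnd, trace_traceFst, Matrix.trace_one, ZMod.card, Fintype.card_prod, smul_eq_mul]
  push_cast
  field_simp
  ring

theorem trace_witnessB (h2 : (2 : ZMod d) ≠ 0) (u : Fin (d + 1) → ZMod d) :
    (witnessB u).trace = 1 := by
  rw [witnessB, Matrix.trace_smul, trace_weightTwoPart, trace_encoded h2, smul_eq_mul]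
  exact inv_mul_cancel₀ (inv_ne_zero natCast_dim_ne_zero)

theorem weightTwoPart_isHermitian {M : Matrix (ZMod d × ZMod d) (ZMod d × ZMod d) ℂ}
    (hM : M.IsHermitian) : (weightTwoPart M).IsHermitian := by
  have h1 : (traceSnd M)ᴴ = traceSnd M := by
    ext i j
    simp only [Matrix.conjTranspose_apply, traceSnd_apply, star_sum, hM.apply]
  have h2 : (traceFst M)ᴴ = traceFst M := by
    ext i j
    simp only [Matrix.conjTranspose_apply, traceFst_apply, star_sum, hM.apply]
  have h3 : star M.trace = M.trace := by
    rw [← Matrix.trace_conjTranspose, hM.eq]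
  rw [Matrix.IsHermitian, weightTwoPart_eq]
  simp only [Matrix.conjTranspose_add, Matrix.conjTranspose_sub, Matrix.conjTranspose_smul,
    Matrix.conjTranspose_kronecker, h1, h2, h3, hM.eq, Matrix.conjTranspose_one, star_inv₀,
    star_natCast, star_mul', star_pow, star_ofNat]

theorem witnessB_isHermitian (h2 : (2 : ZMod d) ≠ 0) (u : Fin (d + 1) → ZMod d) :
    (witnessB u).IsHermitian := by
  have h : (weightTwoPart (parityEncoder d * phasePoint u * (parityEncoder d)ᴴ)).IsHermitian := by
    apply weightTwoPart_isHermitian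
    rw [Matrix.IsHermitian, Matrix.conjTranspose_mul, Matrix.conjTranspose_mul,
      Matrix.conjTranspose_conjTranspose, (phasePoint_isHermitian h2 u).eq, Matrix.mul_assoc]
  rw [Matrix.IsHermitian, witnessB, Matrix.conjTranspose_smul, h.eq, trace_encoded h2, inv_inv,
    star_natCast]

end Witness

-- Clifford gates and their values on the witness

section Clifford

/-- The Pauli group element `ω^c P_(a|b)` acting on the left, and `P_(p|q)` on the right. -/
theorem mul_pauli_eq_iff (C : Matrix (ZMod d) (ZMod d) ℂ) (p q c a b : ZMod d) :
    C * pauli p q = (omega d ^ c.val) • pauli a b * C ↔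
      ∀ x y, C x (y + p) * chi (q * y) = chi (c + b * (x - a)) * C (x - a) y := by
  have hl : ∀ x y, (C * pauli p q) x y = C x (y + p) * chi (q * y) := by
    intro x y
    simp only [Matrix.mul_apply, pauli_apply, mul_ite, mul_zero]
    rw [Finset.sum_ite_eq' Finset.univ (y + p)]
    simp
  have hr : ∀ x y, ((omega d ^ c.val) • pauli a b * C) x y =
      chi (c + b * (x - a)) * C (x - a) y := by
    intro x y
    rw [Matrix.smul_mul, Matrix.smul_apply, omega_pow_val, smul_eq_mul, AddChar.map_add_eq_mul,
      mul_assoc]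
    congr 1
    have e : ∀ k : ZMod d, x = k + a ↔ k = x - a := fun k => by
      constructor
      · rintro rfl; ring
      · rintro rfl; ring
    simp only [Matrix.mul_apply, pauli_apply, e, ite_mul, zero_mul]
    rw [Finset.sum_ite_eq' Finset.univ (x - a)]
    simp
  rw [← Matrix.ext_iff]
  simp only [hl, hr]

theorem pauli_mem_pauliGroup (a b : ZMod d) : pauli a b ∈ pauliGroup d :=
  ⟨0, a, b, by simp⟩

/-- The form in which the Clifford condition is used: conjugating one Pauli operator gives a phase
relation between two shifted copies of the matrix of `C`. -/
theorem IsClifford.exists_relation {C : Matrix (ZMod d) (ZMod d) ℂ} (hC : IsClifford C)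
    (p q : ZMod d) : ∃ c a b : ZMod d, ∀ x y,
      C x (y + p) * chi (q * y) = chi (c + b * (x - a)) * C (x - a) y := by
  obtain ⟨c, a, b, h⟩ := hC.2 _ (pauli_mem_pauliGroup p q)
  refine ⟨c, a, b, (mul_pauli_eq_iff C p q c a b).mp ?_⟩
  rw [← h, Matrix.mul_assoc, ← Matrix.star_eq_conjTranspose,
    Matrix.mem_unitaryGroup_iff'.mp hC.1, Matrix.mul_one]

theorem isClifford_of_relation {C : Matrix (ZMod d) (ZMod d) ℂ}
    (hC : C ∈ Matrix.unitaryGroup (ZMod d) ℂ)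
    (h : ∀ p q : ZMod d, ∃ c a b : ZMod d, ∀ x y,
      C x (y + p) * chi (q * y) = chi (c + b * (x - a)) * C (x - a) y) : IsClifford C := by
  refine ⟨hC, ?_⟩
  rintro P ⟨e, p, q, rfl⟩
  obtain ⟨c, a, b, hr⟩ := h p q
  refine ⟨e + c, a, b, ?_⟩
  rw [Matrix.mul_smul, (mul_pauli_eq_iff C p q c a b).mpr hr, Matrix.smul_mul, Matrix.mul_assoc,
    ← Matrix.star_eq_conjTranspose, Matrix.mem_unitaryGroup_iff.mp hC, Matrix.mul_one, smul_smul,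
    omega_pow_val, omega_pow_val, omega_pow_val, AddChar.map_add_eq_mul]

variable [Fact d.Prime]

/-- Summing the affine exponents a·i + b over i < n gives a n(n-1)/2 + b n, a quadratic phase. -/
theorem eq_smul_quadPhase_of_succ (h2 : (2 : ZMod d) ≠ 0) {w : ZMod d → ℂ} {a b : ZMod d}
    (h : ∀ j, w (j + 1) = chi (a * j + b) * w j) :
    w = w 0 • quadPhase (a / 2) (b - a / 2) := by
  have hn : ∀ n : ℕ, w n = w 0 * chi (a / 2 * (n : ZMod d) ^ 2 + (b - a / 2) * (n : ZMod d)) := by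
    intro n
    induction n with
    | zero => simp
    | succ n ih =>
      rw [Nat.cast_succ, h, ih, mul_left_comm, ← AddChar.map_add_eq_mul]
      congr 2
      field_simp
      ring
  funext j
  have := hn j.val
  rw [ZMod.natCast_zmod_val] at this
  exact this

theorem phaseForm_nonneg_of_succ (h2 : (2 : ZMod d) ≠ 0) (u : Fin (d + 1) → ZMod d)
    {w : ZMod d → ℂ} {a b : ZMod d} (h : ∀ j, w (j + 1) = chi (a * j + b) * w j) :
    0 ≤ phaseForm u w := by
  rw [eq_smul_quadPhase_of_succ h2 h, phaseForm_smul_quadPhase h2]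
  split_ifs
  · exact normSq_nonneg _
  · exact le_rfl

theorem phaseForm_nonneg_of_support (u : Fin (d + 1) → ZMod d)
    {w : ZMod d → ℂ} {j₀ : ZMod d} (h : ∀ j, j ≠ j₀ → w j = 0) : 0 ≤ phaseForm u w := by
  have hw : w = Pi.single j₀ (w j₀) := by
    funext j
    by_cases hj : j = j₀
    · subst hj; simp
    · rw [h j hj, Pi.single_eq_of_ne hj]
  rw [hw, phaseForm_single]
  split_ifs
  · exact mul_nonneg (by positivity) (normSq_nonneg _)
  · exact le_rfl

/-- The images of Z and X force the antidiagonal of `C` either to be supported on at most one point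
or to satisfy a first-order recurrence with affine phase. In both cases it is a multiple of a vector
from one of the unbiased bases. -/
theorem IsClifford.phaseForm_nonneg (h2 : (2 : ZMod d) ≠ 0) (u : Fin (d + 1) → ZMod d)
    {C : Matrix (ZMod d) (ZMod d) ℂ} (hC : IsClifford C) : 0 ≤ phaseForm u (antidiag C) := by
  obtain ⟨c, a, b, hZ⟩ := hC.exists_relation 0 1
  obtain ⟨c', a', b', hX⟩ := hC.exists_relation 1 0
  simp only [add_zero, one_mul] at hZ
  simp only [zero_mul, AddChar.map_zero_eq_one, mul_one] at hX
  have hstep : ∀ j, antidiag C (j + 1) =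
      chi (c' + b' * (-(j + 1) - a')) * C (-j - (1 + a')) j := by
    intro j
    rw [antidiag, hX]
    congr 2
    ring
  -- If Z is sent to a diagonal operator, `C` is supported on the line y = c + bx, which is met by
  -- the antidiagonal x + y = 0 in one point unless b = -1.
  by_cases ha : a = 0
  · subst ha
    have hsupp : ∀ x y, C x y ≠ 0 → y = c + b * x := by
      intro x y hxy
      have h := hZ x y
      rw [sub_zero, mul_comm] at h
      exact ZMod.injective_stdAddChar (mul_right_cancel₀ hxy h)
    by_cases hb : 1 + b = 0
    · obtain rfl : b = -1 := by linear_combination hb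
      by_cases ha' : 1 + a' = 0
      · refine phaseForm_nonneg_of_succ h2 u (a := -b') (b := c' - b' * (1 + a')) fun j => ?_
        rw [hstep, ha', sub_zero, antidiag]
        congr 2
        linear_combination (-b') * ha'
      -- Here the antidiagonal vanishes identically, because the X relation would put two parallel
      -- lines into the support; the point 0 is arbitrary.
      · refine phaseForm_nonneg_of_support u (j₀ := 0) fun j _ => ?_
        have hj := hstep (j - 1)
        rw [sub_add_cancel] at hj
        by_contra hne
        have h1 : C (-(j - 1) - (1 + a')) (j - 1) ≠ 0 := fun h => hne (by rw [hj, h, mul_zero])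
        have h2 := hsupp _ _ h1
        have h3 := hsupp _ _ hne
        exact ha' (by linear_combination h3 - h2)
    · refine phaseForm_nonneg_of_support u (j₀ := c / (1 + b)) fun j hj => ?_
      by_contra hne
      have h3 := hsupp _ _ hne
      apply hj
      rw [eq_div_iff hb]
      linear_combination h3
  -- Iterating the Z relation moves rows by any multiple of a at the cost of an affine phase. Taking
  -- n = (1 + a')/a returns the entry reached by the X relation to the antidiagonal.
  · have hiter : ∀ n : ℕ, ∃ p q r : ZMod d, ∀ x y,
        C (x - (n : ZMod d) * a) y = chi (p * x + q * y + r) * C x y := by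
      intro n
      induction n with
      | zero => exact ⟨0, 0, 0, fun x y => by simp⟩
      | succ n ih =>
        obtain ⟨p, q, r, h⟩ := ih
        refine ⟨p - b, q + 1, r - c - b * (-((n : ZMod d) * a) - a), fun x y => ?_⟩
        have h1 := hZ (x - (n : ZMod d) * a) y
        rw [h, show x - (n : ZMod d) * a - a = x - ((n + 1 : ℕ) : ZMod d) * a by
          push_cast; ring] at h1
        have h4 : C (x - ((n + 1 : ℕ) : ZMod d) * a) y =
            chi (-(c + b * (x - ((n + 1 : ℕ) : ZMod d) * a))) *
            (chi (c + b * (x - ((n + 1 : ℕ) : ZMod d) * a)) * C (x - ((n + 1 : ℕ) : ZMod d) * a) y) := by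
          rw [← mul_assoc, mul_comm (chi (-_)), chi_mul_neg, one_mul]
        rw [h4, ← h1, mul_right_comm, ← AddChar.map_add_eq_mul, ← mul_assoc,
          ← AddChar.map_add_eq_mul]
        congr 2
        push_cast
        ring
    obtain ⟨p, q, r, h⟩ := hiter ((1 + a') / a).val
    rw [ZMod.natCast_zmod_val, div_mul_cancel₀ _ ha] at h
    refine phaseForm_nonneg_of_succ h2 u (a := -b' - p + q) (b := c' - b' * (1 + a') + r)
      fun j => ?_
    rw [hstep, h, ← mul_assoc, ← AddChar.map_add_eq_mul, antidiag]
    congr 2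
    ring

/-- The Clifford gates with all entries non-zero. -/
def fullGate (α β γ δ ε : ZMod d) : Matrix (ZMod d) (ZMod d) ℂ :=
  Matrix.of fun y x => ((Real.sqrt d : ℝ) : ℂ)⁻¹ *
    chi (α * x ^ 2 + β * x * y + γ * y ^ 2 + δ * x + ε * y)

/-- The monomial Clifford gates `|x⟩ ↦ ω^(α x² + ε x)|l x + c⟩`. -/
def monoGate (l c α ε : ZMod d) : Matrix (ZMod d) (ZMod d) ℂ :=
  Matrix.of fun y x => if y = l * x + c then chi (α * x ^ 2 + ε * x) else 0

theorem fullGate_apply (α β γ δ ε y x : ZMod d) : fullGate α β γ δ ε y x =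
    ((Real.sqrt d : ℝ) : ℂ)⁻¹ * chi (α * x ^ 2 + β * x * y + γ * y ^ 2 + δ * x + ε * y) := rfl

theorem monoGate_apply (l c α ε y x : ZMod d) : monoGate l c α ε y x =
    if y = l * x + c then chi (α * x ^ 2 + ε * x) else 0 := rfl

theorem fullGate_mem_unitaryGroup (α γ δ ε : ZMod d) {β : ZMod d} (hβ : β ≠ 0) :
    fullGate α β γ δ ε ∈ Matrix.unitaryGroup (ZMod d) ℂ := by
  rw [Matrix.mem_unitaryGroup_iff']
  ext x x'
  have h : ∀ y, star (fullGate α β γ δ ε y x) * fullGate α β γ δ ε y x' =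
      (d : ℂ)⁻¹ * chi (α * (x' ^ 2 - x ^ 2) + δ * (x' - x)) * chi (y * (β * (x' - x))) := by
    intro y
    rw [fullGate_apply, fullGate_apply, ← sqrt_inv_mul_self, star_mul', star_inv₀, RCLike.star_def,
      Complex.conj_ofReal, star_chi, mul_mul_mul_comm, mul_assoc (_ * _),
      ← AddChar.map_add_eq_mul, ← AddChar.map_add_eq_mul]
    congr 2
    ring
  simp only [Matrix.star_eq_conjTranspose, Matrix.mul_apply, Matrix.conjTranspose_apply, h,
    ← Finset.mul_sum, sum_chi_mul, mul_eq_zero, hβ, false_or, sub_eq_zero, Matrix.one_apply]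
  by_cases hx : x = x'
  · subst hx
    simp [inv_mul_cancel₀ (natCast_dim_ne_zero (d := d))]
  · rw [if_neg (Ne.symm hx), if_neg hx, mul_zero]

theorem monoGate_mem_unitaryGroup (c α ε : ZMod d) {l : ZMod d} (hl : l ≠ 0) :
    monoGate l c α ε ∈ Matrix.unitaryGroup (ZMod d) ℂ := by
  rw [Matrix.mem_unitaryGroup_iff']
  ext x x'
  simp only [Matrix.star_eq_conjTranspose, Matrix.mul_apply, Matrix.conjTranspose_apply,
    monoGate_apply, apply_ite star, star_zero, ite_mul, zero_mul, RCLike.star_def, star_chi]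
  rw [Finset.sum_ite_eq' Finset.univ (l * x + c), if_pos (Finset.mem_univ _), Matrix.one_apply]
  by_cases hx : x = x'
  · subst hx
    rw [if_pos rfl, if_pos rfl, mul_comm, chi_mul_neg]
  · rw [if_neg, if_neg hx, mul_zero]
    intro h
    exact hx (mul_left_cancel₀ hl (add_right_cancel h))

theorem isClifford_fullGate (α γ δ ε : ZMod d) {β : ZMod d} (hβ : β ≠ 0) :
    IsClifford (fullGate α β γ δ ε) := by
  refine isClifford_of_relation (fullGate_mem_unitaryGroup α γ δ ε hβ) fun p q => ?_
  -- The displacement a is fixed by comparing the coefficients of x in the two exponents, which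
  -- needs β ≠ 0; the coefficient of y then gives b = βp + 2γa.
  obtain ⟨a, ha⟩ : ∃ a, β * a = -(2 * α * p + q) := ⟨-(2 * α * p + q) / β, by field_simp⟩
  refine ⟨α * p ^ 2 + δ * p - γ * a ^ 2 + ε * a + (β * p + 2 * γ * a) * a, a,
    β * p + 2 * γ * a, fun y x => ?_⟩
  rw [fullGate_apply, fullGate_apply, mul_assoc, ← AddChar.map_add_eq_mul, mul_left_comm,
    ← AddChar.map_add_eq_mul]
  congr 2
  linear_combination x * ha

theorem isClifford_monoGate (c α ε : ZMod d) {l : ZMod d} (hl : l ≠ 0) :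
    IsClifford (monoGate l c α ε) := by
  refine isClifford_of_relation (monoGate_mem_unitaryGroup c α ε hl) fun p q => ?_
  -- On the support y is affine in x with slope l, so b·l must match the x-coefficient 2αp + q.
  obtain ⟨b, hb⟩ : ∃ b, b * l = 2 * α * p + q := ⟨(2 * α * p + q) / l, by field_simp⟩
  refine ⟨α * p ^ 2 + ε * p - b * c, l * p, b, fun y x => ?_⟩
  have hiff : y - l * p = l * x + c ↔ y = l * (x + p) + c := by
    constructor
    · intro h; linear_combination h
    · intro h; linear_combination h
  rw [monoGate_apply, monoGate_apply]
  simp only [hiff]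
  split_ifs with h
  · rw [← AddChar.map_add_eq_mul, ← AddChar.map_add_eq_mul]
    congr 1
    rw [h]
    linear_combination (-x) * hb
  · simp

theorem antidiag_fullGate (α β γ δ ε : ZMod d) : antidiag (fullGate α β γ δ ε) =
    ((Real.sqrt d : ℝ) : ℂ)⁻¹ • quadPhase (α - β + γ) (δ - ε) := by
  funext j
  rw [antidiag, fullGate_apply, Pi.smul_apply, smul_eq_mul, quadPhase]
  congr 2
  ring

theorem antidiag_monoGate_neg_one (α ε : ZMod d) {c : ZMod d} (hc : c ≠ 0) :
    antidiag (monoGate (-1) c α ε) = 0 := by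
  funext j
  rw [antidiag, monoGate_apply, if_neg, Pi.zero_apply]
  intro h
  exact hc (by linear_combination -h)

/-- The antidiagonal lies in the basis y = α - β + γ with linear label δ - ε; another label of that
basis is orthogonal to the selected vector. These gates supply most of the saturating vertices. -/
theorem phaseForm_fullGate (h2 : (2 : ZMod d) ≠ 0) (u : Fin (d + 1) → ZMod d)
    {α β γ δ ε : ZMod d} (h : δ - ε ≠ kappa u (α - β + γ)) :
    phaseForm u (antidiag (fullGate α β γ δ ε)) = 0 := by
  rw [antidiag_fullGate, phaseForm_smul_quadPhase h2, if_neg (Ne.symm h)]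

/-- The support line meets the antidiagonal where (1 + l)j + c = 0. The hypothesis keeps that point
away from `u 0`, and for l = -1 it makes the antidiagonal zero. -/
theorem phaseForm_monoGate (u : Fin (d + 1) → ZMod d) {l c α ε : ZMod d}
    (h : (1 + l) * u 0 + c ≠ 0) : phaseForm u (antidiag (monoGate l c α ε)) = 0 := by
  by_cases hl : 1 + l = 0
  · obtain rfl : l = -1 := by linear_combination hl
    have hc : c ≠ 0 := by simpa using h
    have := phaseForm_single u 0 0
    rw [antidiag_monoGate_neg_one α ε hc, ← Pi.single_zero (0 : ZMod d), this]
    simp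
  · have hw : antidiag (monoGate l c α ε) =
        Pi.single (-c / (1 + l)) (antidiag (monoGate l c α ε) (-c / (1 + l))) := by
      funext j
      by_cases hj : j = -c / (1 + l)
      · subst hj; simp
      · rw [Pi.single_eq_of_ne hj, antidiag, monoGate_apply, if_neg]
        intro h'
        apply hj
        rw [eq_div_iff hl]
        linear_combination -h'
    rw [hw, phaseForm_single, if_neg]
    intro h'
    rw [← h'] at h
    apply h
    field_simp
    ring

end Clifford

-- Lower and upper bounds on the noise rate

section Polytope

theorem unitaryChannel_apply (C ρ : Matrix (ZMod d) (ZMod d) ℂ) :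
    unitaryChannel C ρ = C * (ρ * Cᴴ) := rfl

theorem fullyDepolarizing_apply (ρ : Matrix (ZMod d) (ZMod d) ℂ) :
    fullyDepolarizing d ρ = ρ.trace • ((d : ℂ)⁻¹ • (1 : Matrix (ZMod d) (ZMod d) ℂ)) := rfl

theorem choiState_apply (E : QuditMap d) (a b a' b' : ZMod d) :
    choiState E (a, b) (a', b') = (d : ℂ)⁻¹ * E (Matrix.single a a' 1) b b' := by
  simp only [choiState, Matrix.smul_apply, Matrix.sum_apply, Matrix.kronecker_apply, smul_eq_mul,
    Matrix.single_apply, ite_and, ite_mul, one_mul, zero_mul, Finset.sum_ite_irrel,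
    Finset.sum_const_zero, Finset.sum_ite_eq', Finset.mem_univ, if_true]

theorem choiState_add (E F : QuditMap d) : choiState (E + F) = choiState E + choiState F := by
  ext ⟨a, b⟩ ⟨a', b'⟩
  simp only [choiState_apply, Matrix.add_apply, LinearMap.add_apply, mul_add]

theorem choiState_smul (r : ℝ) (E : QuditMap d) : choiState (r • E) = r • choiState E := by
  ext ⟨a, b⟩ ⟨a', b'⟩
  simp only [choiState_apply, Matrix.smul_apply, LinearMap.smul_apply, mul_smul_comm]

theorem choiState_unitaryChannel (C : Matrix (ZMod d) (ZMod d) ℂ) :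
    choiState (unitaryChannel C) = vecMulVec (choiVec C) (star (choiVec C)) := by
  ext ⟨a, b⟩ ⟨a', b'⟩
  rw [choiState_apply, unitaryChannel_apply, Matrix.vecMulVec_apply, Pi.star_apply, choiVec_apply,
    choiVec_apply, ← sqrt_inv_mul_self, star_mul', star_inv₀, RCLike.star_def, Complex.conj_ofReal,
    mul_mul_mul_comm]
  congr 1
  simp [Matrix.mul_apply, Matrix.single_apply, ite_and]

theorem choiState_fullyDepolarizing :
    choiState (fullyDepolarizing d) = ((d : ℂ) ^ 2)⁻¹ • 1 := by
  ext ⟨a, b⟩ ⟨a', b'⟩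
  rw [choiState_apply, fullyDepolarizing_apply, Matrix.smul_apply, Matrix.smul_apply,
    Matrix.smul_apply, Matrix.trace]
  simp only [Matrix.diag_apply, Matrix.single_apply, Matrix.one_apply, smul_eq_mul, Prod.mk.injEq]
  by_cases h : a = a'
  · subst h
    simp only [and_self, Finset.sum_ite_eq, Finset.mem_univ, if_true, true_and]
    rw [sq, mul_inv]
    ring
  · have h' : ∀ x, ¬ (a = x ∧ a' = x) := fun x hx => h (hx.1.trans hx.2.symm)
    simp [h, h']

theorem trace_mul_vecMulVec {n : Type*} [Fintype n] (W : Matrix n n ℂ) (v : n → ℂ) :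
    (W * vecMulVec v (star v)).trace = star v ⬝ᵥ (W *ᵥ v) := by
  rw [Matrix.mul_vecMulVec, Matrix.trace_vecMulVec, dotProduct_comm]

theorem trace_mul_choiState_depolarized (W : Matrix (ZMod d × ZMod d) (ZMod d × ZMod d) ℂ)
    (hW : W.trace = 1) (U : Matrix (ZMod d) (ZMod d) ℂ) (p : ℝ) :
    (W * choiState (depolarized U p)).trace.re =
      (1 - p) * choiExpect W U + p * ((d : ℝ) ^ 2)⁻¹ := by
  rw [depolarized, choiState_add, choiState_smul, choiState_smul, choiState_unitaryChannel,
    choiState_fullyDepolarizing, Matrix.mul_add, Matrix.mul_smul, Matrix.mul_smul, Matrix.mul_smul,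
    Matrix.mul_one, Matrix.trace_add, Matrix.trace_smul, Matrix.trace_smul, Matrix.trace_smul, hW,
    trace_mul_vecMulVec, Complex.add_re, Complex.real_smul, Complex.real_smul,
    Complex.re_ofReal_mul, Complex.re_ofReal_mul]
  congr 2
  have : ((d : ℂ) ^ 2)⁻¹ = ((((d : ℝ) ^ 2)⁻¹ : ℝ) : ℂ) := by push_cast; rfl
  rw [smul_eq_mul, mul_one, this, Complex.ofReal_re]

theorem trace_mul_choiState_nonneg {W : Matrix (ZMod d × ZMod d) (ZMod d × ZMod d) ℂ}
    (hW : ∀ C : Matrix (ZMod d) (ZMod d) ℂ, IsClifford C → 0 ≤ choiExpect W C)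
    {E : QuditMap d} (hE : E ∈ cliffordPolytope d) : 0 ≤ (W * choiState E).trace.re := by
  have hconv : Convex ℝ {E : QuditMap d | 0 ≤ (W * choiState E).trace.re} := by
    intro E hE F hF a b ha hb _
    simp only [Set.mem_ofPred_eq] at hE hF ⊢
    rw [choiState_add, choiState_smul, choiState_smul, Matrix.mul_add, Matrix.mul_smul,
      Matrix.mul_smul, Matrix.trace_add, Matrix.trace_smul, Matrix.trace_smul, Complex.add_re,
      Complex.real_smul, Complex.real_smul, Complex.re_ofReal_mul, Complex.re_ofReal_mul]
    positivity
  refine convexHull_min ?_ hconv hE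
  rintro _ ⟨C, hC, rfl⟩
  rw [Set.mem_ofPred_eq, choiState_unitaryChannel, trace_mul_vecMulVec]
  exact hW C hC

/-- With v = ⟨J_U|W|J_U⟩ the witness takes the value (1-p)v + p/d², since the depolarizing map has
Choi state I/d² and W has trace one. This is affine in p and its zero is the threshold. -/
theorem certifies_threshold {W : Matrix (ZMod d × ZMod d) (ZMod d × ZMod d) ℂ}
    (hW : IsCliffordFacet W) {U : Matrix (ZMod d) (ZMod d) ℂ} (hU : choiExpect W U < 0) :
    Certifies W U (threshold W U) := by
  intro p hp hpt
  have hd : (0 : ℝ) < (d : ℝ) ^ 2 := by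
    have : (0 : ℝ) < d := by exact_mod_cast Nat.pos_of_ne_zero (NeZero.ne d)
    positivity
  have hneg : (W * choiState (depolarized U p)).trace.re < 0 := by
    rw [trace_mul_choiState_depolarized W hW.trace_eq_one]
    rw [threshold, abs_of_neg hU] at hpt
    have hpos : 0 < (d : ℝ) ^ 2 * -choiExpect W U + 1 := by nlinarith
    have h1 : 1 / ((d : ℝ) ^ 2 * -choiExpect W U + 1) < 1 - p := by linarith
    rw [div_lt_iff₀ hpos] at h1
    have h3 : p * ((d : ℝ) ^ 2)⁻¹ < -((1 - p) * choiExpect W U) := by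
      rw [← div_eq_mul_inv, div_lt_iff₀ hd]
      linarith
    linarith
  exact ⟨hneg, fun hmem => absurd (trace_mul_choiState_nonneg hW.nonneg hmem) (not_le.mpr hneg)⟩

theorem depolarized_apply (U ρ : Matrix (ZMod d) (ZMod d) ℂ) (p : ℝ) (i i' : ZMod d) :
    depolarized U p ρ i i' = (1 - p : ℂ) * unitaryChannel U ρ i i' +
      p * (ρ.trace * ((d : ℂ)⁻¹ * if i = i' then 1 else 0)) := by
  rw [depolarized, LinearMap.add_apply, LinearMap.smul_apply, LinearMap.smul_apply,
    fullyDepolarizing_apply, Matrix.add_apply, Matrix.smul_apply, Matrix.smul_apply,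
    Matrix.smul_apply, Matrix.smul_apply, Complex.real_smul, Complex.real_smul, Matrix.one_apply,
    smul_eq_mul, smul_eq_mul]
  push_cast
  rfl

theorem unitaryChannel_of_antidiagonal {U : Matrix (ZMod d) (ZMod d) ℂ} {g : ZMod d → ℂ}
    {c : ZMod d} (hU : ∀ y x, U y x = if y = -x + c then g x else 0)
    (ρ : Matrix (ZMod d) (ZMod d) ℂ) (i i' : ZMod d) :
    unitaryChannel U ρ i i' =
      g (c - i) * (starRingEnd ℂ) (g (c - i')) * ρ (c - i) (c - i') := by
  have e : ∀ y x : ZMod d, y = -x + c ↔ x = c - y := fun y x => by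
    constructor
    · rintro rfl; ring
    · rintro rfl; ring
  simp only [unitaryChannel_apply, Matrix.mul_apply, Matrix.conjTranspose_apply, hU, e, ite_mul,
    zero_mul, apply_ite star, star_zero, mul_ite, mul_zero, Finset.sum_ite_eq', Finset.mem_univ,
    if_true, RCLike.star_def]
  ring

variable [Fact d.Prime]

theorem normSq_ampl_eq (y k : ZMod d) (w : ZMod d → ℂ) :
    (normSq (ampl y k w) : ℂ) = ∑ i, ∑ j, (starRingEnd ℂ) (w i) * w j *
      (chi (y * (i ^ 2 - j ^ 2)) * chi (k * (i - j))) := by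
  rw [ampl_eq_sum, Complex.normSq_eq_conj_mul_self, map_sum, Finset.sum_mul_sum]
  refine Finset.sum_congr rfl fun i _ => Finset.sum_congr rfl fun j _ => ?_
  rw [map_mul, star_chi, ← AddChar.map_add_eq_mul, show y * (i ^ 2 - j ^ 2) +
    k * (i - j) = -(-(y * i ^ 2 + k * i)) + -(y * j ^ 2 + k * j) by ring,
    AddChar.map_add_eq_mul]
  ring

/-- Tomography by quadratic phases: the sums over y and k fix i² - j² and i - j. With i ≠ j and 2
invertible this determines i + j, hence the pair, and one off-diagonal entry of |w⟩⟨w| is recovered.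
-/
theorem sum_normSq_ampl_mul_chi (h2 : (2 : ZMod d) ≠ 0) (w : ZMod d → ℂ) {a b : ZMod d}
    (hab : a ≠ b) :
    ∑ y, ∑ k, (normSq (ampl y k w) : ℂ) * chi (y * (a ^ 2 - b ^ 2) + k * (a - b)) =
      (d : ℂ) ^ 2 * (w a * (starRingEnd ℂ) (w b)) := by
  have h1 : ∀ y k, (normSq (ampl y k w) : ℂ) * chi (y * (a ^ 2 - b ^ 2) + k * (a - b)) =
      ∑ i, ∑ j, (starRingEnd ℂ) (w i) * w j *
        (chi (y * (i ^ 2 - j ^ 2 + (a ^ 2 - b ^ 2))) * chi (k * (i - j + (a - b)))) := by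
    intro y k
    rw [normSq_ampl_eq, Finset.sum_mul]
    refine Finset.sum_congr rfl fun i _ => ?_
    rw [Finset.sum_mul]
    refine Finset.sum_congr rfl fun j _ => ?_
    rw [mul_assoc, ← AddChar.map_add_eq_mul, ← AddChar.map_add_eq_mul, ← AddChar.map_add_eq_mul]
    congr 2
    ring
  have h3 : ∀ i j, ∑ y, ∑ k, (starRingEnd ℂ) (w i) * w j *
        (chi (y * (i ^ 2 - j ^ 2 + (a ^ 2 - b ^ 2))) * chi (k * (i - j + (a - b)))) =
      if i = b then (if j = a then (d : ℂ) ^ 2 * (w a * (starRingEnd ℂ) (w b)) else 0) else 0 := by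
    intro i j
    simp only [← Finset.mul_sum, sum_chi_mul, ← Finset.sum_mul]
    by_cases hij : i = b ∧ j = a
    · obtain ⟨rfl, rfl⟩ := hij
      rw [if_pos (by ring), if_pos (by ring), if_pos rfl, if_pos rfl]
      ring
    · rw [← ite_and, if_neg hij]
      by_cases hx : i - j + (a - b) = 0
      · rw [if_neg, zero_mul, mul_zero]
        intro hy
        have hab' : a - b ≠ 0 := sub_ne_zero.mpr hab
        have h5 : (a - b) * (a + b - (i + j)) = 0 := by
          linear_combination hy - (i + j) * hx
        have h6 := (mul_eq_zero.mp h5).resolve_left hab'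
        apply hij
        constructor
        · apply mul_left_cancel₀ h2; linear_combination hx - h6
        · apply mul_left_cancel₀ h2; linear_combination -hx - h6
      · rw [if_neg hx, mul_zero, mul_zero]
  simp only [h1]
  calc _ = ∑ i, ∑ j, ∑ y, ∑ k, (starRingEnd ℂ) (w i) * w j *
        (chi (y * (i ^ 2 - j ^ 2 + (a ^ 2 - b ^ 2))) * chi (k * (i - j + (a - b)))) := by
        rw [Finset.sum_congr rfl fun y (_ : y ∈ Finset.univ) => Finset.sum_comm, Finset.sum_comm]
        refine Finset.sum_congr rfl fun i _ => ?_
        rw [Finset.sum_congr rfl fun y (_ : y ∈ Finset.univ) => Finset.sum_comm, Finset.sum_comm]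
    _ = _ := by simp [h3]

theorem sum_normSq_ampl (y : ZMod d) (w : ZMod d → ℂ) :
    ∑ k, normSq (ampl y k w) = d * ∑ j, normSq (w j) := by
  have : ((∑ k, normSq (ampl y k w) : ℝ) : ℂ) = ((d * ∑ j, normSq (w j) : ℝ) : ℂ) := by
    push_cast
    simp only [normSq_ampl_eq]
    rw [Finset.sum_comm, Finset.mul_sum]
    refine Finset.sum_congr rfl fun i _ => ?_
    rw [Finset.sum_comm]
    simp only [← Finset.mul_sum, sum_chi_mul, sub_eq_zero, mul_ite, mul_zero, Finset.sum_ite_eq,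
      Finset.mem_univ, if_true]
    rw [sub_self, mul_zero, AddChar.map_zero_eq_one, Complex.normSq_eq_conj_mul_self]
    ring
  exact_mod_cast this

/-- A depolarized antidiagonal gate at the noise rate where the witness vanishes is a mixture of
Clifford gates: quadratic antidiagonal phase gates, and shifted ones that act as dephasing. -/
theorem depolarized_mem_cliffordPolytope (h2 : (2 : ZMod d) ≠ 0) (u : Fin (d + 1) → ZMod d)
    {U : Matrix (ZMod d) (ZMod d) ℂ} {w : ZMod d → ℂ}
    (hU : ∀ y x, U y x = if y = -x then w x else 0) (hw : ∀ j, normSq (w j) = 1)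
    (hmin : ∀ y k, normSq (ampl y (kappa u y) w) ≤ normSq (ampl y k w))
    {p : ℝ} (hp0 : 0 ≤ p) (hp1 : p ≤ 1) (hp : p = -(1 - p) * (d : ℝ) ^ 2 * phaseForm u w) :
    depolarized U p ∈ cliffordPolytope d := by
  have hd : (d : ℝ) ≠ 0 := by exact_mod_cast NeZero.ne d
  have hdc : (d : ℂ) ≠ 0 := natCast_dim_ne_zero
  set N : ZMod d → ZMod d → ℝ := fun y k => normSq (ampl y k w) with hN
  -- Subtracting the minimal overlap in each basis leaves off-diagonal entries unchanged, as it is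
  -- constant in k, and lowers only the diagonal weight. The gates in `q` spend that weight: phases
  -- averaged over the second index dephase, nonzero shifts move the populations.
  set r : ZMod d × ZMod d → ℝ :=
    fun s => (1 - p) * ((d : ℝ) ^ 2)⁻¹ * (N s.1 s.2 - N s.1 (kappa u s.1)) with hr
  set q : ZMod d × ZMod d → ℝ := fun s => if s.1 = 0 then 0 else p * ((d : ℝ) ^ 2)⁻¹ with hq
  set V : (ZMod d × ZMod d) ⊕ (ZMod d × ZMod d) → QuditMap d := Sum.elim
    (fun s => unitaryChannel (monoGate (-1) 0 s.1 s.2))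
    (fun s => unitaryChannel (monoGate (-1) s.1 0 s.2)) with hV
  have hsumr : ∑ s, r s = 1 - p + p * (d : ℝ)⁻¹ := by
    have h4 : ∑ s, r s =
        (1 - p) * ((d : ℝ) ^ 2)⁻¹ * (∑ y, ∑ k, N y k - d * ∑ y, N y (kappa u y)) := by
      simp only [hr, ← Finset.mul_sum, Fintype.sum_prod_type, Finset.sum_sub_distrib,
        Finset.sum_const, Finset.card_univ, ZMod.card, nsmul_eq_mul]
    have h5 : ∑ y, ∑ k, N y k = (d : ℝ) ^ 3 := by
      simp only [hN, sum_normSq_ampl, hw]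
      simp
      ring
    have h6 : phaseForm u w = (d : ℝ)⁻¹ * (1 + (d : ℝ)⁻¹ * ∑ y, N y (kappa u y) - d) := by
      simp only [phaseForm, hw, hN]
      simp
    -- The equation for p says exactly that r has the mass 1 - p + p/d needed on the unshifted
    -- diagonal.
    rw [h6] at hp
    rw [h4, h5]
    field_simp at hp ⊢
    linear_combination (-1 : ℝ) * hp
  have hsumq : ∑ s, q s = p - p * (d : ℝ)⁻¹ := by
    have h4 : ∀ m : ZMod d, ∑ z : ZMod d, q (m, z) = if m = 0 then 0 else p * (d : ℝ)⁻¹ := by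
      intro m
      simp only [hq]
      split_ifs
      · simp
      · rw [Finset.sum_const, Finset.card_univ, ZMod.card, nsmul_eq_mul]
        field_simp
    rw [Fintype.sum_prod_type, Finset.sum_congr rfl fun m _ => h4 m,
      ← Finset.add_sum_erase _ _ (Finset.mem_univ (0 : ZMod d)), if_pos rfl,
      Finset.sum_congr rfl fun x hx => if_neg (Finset.ne_of_mem_erase hx), Finset.sum_const,
      Finset.card_erase_of_mem (Finset.mem_univ _), Finset.card_univ, ZMod.card, nsmul_eq_mul,
      Nat.cast_sub (NeZero.one_le)]
    push_cast
    field_simp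
    ring
  have hmain : depolarized U p = ∑ s, (Sum.elim r q s) • V s := by
    rw [Fintype.sum_sum_type]
    refine LinearMap.ext fun ρ => Matrix.ext fun i i' => ?_
    have hS : ∀ s : ZMod d × ZMod d, unitaryChannel (monoGate (-1) 0 s.1 s.2) ρ i i' =
        chi (s.1 * ((-i) ^ 2 - (-i') ^ 2) + s.2 * (-i - -i')) * ρ (-i) (-i') := by
      intro s
      rw [unitaryChannel_of_antidiagonal (c := 0) (g := fun x => chi (s.1 * x ^ 2 + s.2 * x))
        (fun y x => by rw [monoGate_apply, neg_one_mul]), star_chi, ← AddChar.map_add_eq_mul,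
        zero_sub, zero_sub]
      congr 2
      ring
    have hT : ∀ s : ZMod d × ZMod d, unitaryChannel (monoGate (-1) s.1 0 s.2) ρ i i' =
        chi (s.2 * (i' - i)) * ρ (s.1 - i) (s.1 - i') := by
      intro s
      rw [unitaryChannel_of_antidiagonal (c := s.1) (g := fun x => chi (0 * x ^ 2 + s.2 * x))
        (fun y x => by rw [monoGate_apply, neg_one_mul]), star_chi, ← AddChar.map_add_eq_mul]
      congr 2
      ring
    rw [depolarized_apply, unitaryChannel_of_antidiagonal (c := 0) (g := w)
      (fun y x => by rw [hU, add_zero])]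
    simp only [hV, Sum.elim_inl, Sum.elim_inr, LinearMap.add_apply, LinearMap.sum_apply,
      LinearMap.smul_apply, Matrix.add_apply, Matrix.sum_apply, Matrix.smul_apply, hS, hT,
      Complex.real_smul, zero_sub]
    have hq' : ∑ s, (q s : ℂ) * (chi (s.2 * (i' - i)) * ρ (s.1 - i) (s.1 - i')) =
        if i = i' then p * (d : ℂ)⁻¹ * (ρ.trace - ρ (-i) (-i')) else 0 := by
      have h4 : ∀ m : ZMod d, ∑ z : ZMod d,
          (q (m, z) : ℂ) * (chi (z * (i' - i)) * ρ (m - i) (m - i')) =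
          if m = 0 then 0 else p * ((d : ℂ) ^ 2)⁻¹ *
            ((if i' - i = 0 then (d : ℂ) else 0) * ρ (m - i) (m - i')) := by
        intro m
        simp only [hq]
        split_ifs with hm hi
        · simp
        · simp [hi]
          ring
        · rw [← Finset.mul_sum, ← Finset.sum_mul, sum_chi_mul, if_neg hi]
          simp
      rw [Fintype.sum_prod_type, Finset.sum_congr rfl fun m _ => h4 m]
      by_cases hi : i = i'
      · subst hi
        simp only [sub_self, if_true]
        have htr : ρ.trace = ∑ m, ρ (m - i) (m - i) := by
          rw [Matrix.trace, ← Equiv.sum_comp (Equiv.subRight i)]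
          rfl
        have hz : ρ (-i) (-i) = ρ (0 - i) (0 - i) := by rw [zero_sub]
        rw [htr, hz, ← Finset.sum_erase_eq_sub (Finset.mem_univ (0 : ZMod d)),
          ← Finset.add_sum_erase _ _ (Finset.mem_univ (0 : ZMod d)), if_pos rfl, zero_add,
          Finset.mul_sum]
        refine Finset.sum_congr rfl fun m hm => ?_
        rw [if_neg (Finset.ne_of_mem_erase hm)]
        field_simp
      · have hi' : i' - i ≠ 0 := sub_ne_zero.mpr (Ne.symm hi)
        simp [hi, hi']
    have hr' : ∑ s, (r s : ℂ) * (chi (s.1 * ((-i) ^ 2 - (-i') ^ 2) + s.2 * (-i - -i')) *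
          ρ (-i) (-i')) =
        if i = i' then (1 - p + p * (d : ℂ)⁻¹) * ρ (-i) (-i')
          else (1 - p) * (w (-i) * (starRingEnd ℂ) (w (-i'))) * ρ (-i) (-i') := by
      simp only [← mul_assoc, ← Finset.sum_mul]
      split_ifs with hi
      · subst hi
        simp only [sub_self, mul_zero, add_zero, AddChar.map_zero_eq_one, mul_one]
        congr 1
        have h9 := congrArg (fun x : ℝ => (x : ℂ)) hsumr
        push_cast at h9
        exact h9
      · congr 1
        have hne : -i ≠ -i' := fun h => hi (neg_injective h)
        -- The subtracted minima do not depend on k, so the sum over k kills them off the diagonal.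
        have hz : ∀ y : ZMod d, ∑ k, (N y (kappa u y) : ℂ) *
            chi (y * ((-i) ^ 2 - (-i') ^ 2) + k * (-i - -i')) = 0 := by
          intro y
          simp only [AddChar.map_add_eq_mul, ← Finset.mul_sum, sum_chi_mul]
          rw [if_neg (sub_ne_zero.mpr hne), mul_zero, mul_zero]
        have hs := sum_normSq_ampl_mul_chi h2 w hne
        have h7 : ∀ s : ZMod d × ZMod d, (r s : ℂ) *
            chi (s.1 * ((-i) ^ 2 - (-i') ^ 2) + s.2 * (-i - -i')) =
            (1 - p) * ((d : ℂ) ^ 2)⁻¹ * ((N s.1 s.2 : ℂ) *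
              chi (s.1 * ((-i) ^ 2 - (-i') ^ 2) + s.2 * (-i - -i')) -
              (N s.1 (kappa u s.1) : ℂ) *
              chi (s.1 * ((-i) ^ 2 - (-i') ^ 2) + s.2 * (-i - -i'))) := by
          intro s
          simp only [hr]
          push_cast
          ring
        simp only [h7, ← Finset.mul_sum, Finset.sum_sub_distrib, Fintype.sum_prod_type, hz]
        rw [hs]
        simp only [Finset.sum_const_zero]
        field_simp
        ring
    rw [hq', hr']
    split_ifs with hi
    · subst hi
      rw [Complex.mul_conj, hw]
      push_cast
      ring
    · ring
  rw [hmain]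
  refine (convex_convexHull ℝ _).sum_mem ?_ ?_ ?_
  · rintro (s | s) _
    · have h8 := hmin s.1 s.2
      exact mul_nonneg (mul_nonneg (by linarith) (by positivity)) (sub_nonneg.mpr h8)
    · simp only [Sum.elim_inr, hq]
      split_ifs <;> positivity
  · rw [Fintype.sum_sum_type]
    simp only [Sum.elim_inl, Sum.elim_inr]
    rw [hsumr, hsumq]
    ring
  · have hne : (-1 : ZMod d) ≠ 0 := neg_ne_zero.mpr one_ne_zero
    rintro (s | s) _
    · exact subset_convexHull ℝ _ ⟨_, isClifford_monoGate _ _ _ hne, rfl⟩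
    · exact subset_convexHull ℝ _ ⟨_, isClifford_monoGate _ _ _ hne, rfl⟩

end Polytope

-- Weyl coefficients and the annihilator of the saturating gates

section Weyl

variable [Fact d.Prime]

/-- The coefficients of an operator in the basis of the two-qudit Weyl operators with
displacements `(e,ξ)` and `(f,η)`. -/
def weylCoeff (H : Matrix (ZMod d × ZMod d) (ZMod d × ZMod d) ℂ) (e f ξ η : ZMod d) : ℂ :=
  ∑ x, ∑ y, H (x, y) (x + e, y + f) * chi (ξ * (x + e / 2) + η * (y + f / 2))

theorem eq_zero_of_weylCoeff_eq_zero {H : Matrix (ZMod d × ZMod d) (ZMod d × ZMod d) ℂ}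
    (h : ∀ e f ξ η, weylCoeff H e f ξ η = 0) : H = 0 := by
  ext ⟨x, y⟩ ⟨x', y'⟩
  set F : ZMod d → ZMod d → ℂ := fun a b => H (a, b) (a + (x' - x), b + (y' - y)) with hF
  have h1 : ∀ ξ η, ∑ a, chi (ξ * (a - x)) * ∑ b, chi (η * (b - y)) * F a b =
      chi (-(ξ * (x + (x' - x) / 2) + η * (y + (y' - y) / 2))) *
        weylCoeff H (x' - x) (y' - y) ξ η := by
    intro ξ η
    rw [weylCoeff, Finset.mul_sum]
    refine Finset.sum_congr rfl fun a _ => ?_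
    rw [Finset.mul_sum, Finset.mul_sum]
    refine Finset.sum_congr rfl fun b _ => ?_
    rw [← mul_assoc, ← AddChar.map_add_eq_mul, mul_left_comm, ← AddChar.map_add_eq_mul, mul_comm]
    congr 2
    ring
  have h2 : ∑ η, ∑ ξ, ∑ a, chi (ξ * (a - x)) * ∑ b, chi (η * (b - y)) * F a b =
      d * (d * F x y) := by
    rw [← sum_sum_chi_sub (fun b => F x b) y, Finset.mul_sum]
    refine Finset.sum_congr rfl fun η _ => ?_
    exact sum_sum_chi_sub (fun a => ∑ b, chi (η * (b - y)) * F a b) x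
  simp only [h1, h, mul_zero, Finset.sum_const_zero] at h2
  have h3 : F x y = 0 := by
    have hd : (d : ℂ) ≠ 0 := natCast_dim_ne_zero
    have h4 := (mul_eq_zero.mp h2.symm).resolve_left hd
    exact (mul_eq_zero.mp h4).resolve_left hd
  simpa [hF] using h3

/-- The increment of a quadratic form along (e,f) is linear in the midpoint. The midpoint convention
of `weylCoeff` therefore turns the quadratic part of the gate into the frequency (2αe + βf, βe +
2γf), and δ, ε remain as Fourier variables. -/
theorem expect_fullGate (h2 : (2 : ZMod d) ≠ 0)
    (H : Matrix (ZMod d × ZMod d) (ZMod d × ZMod d) ℂ) (α β γ δ ε : ZMod d) :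
    expect H (fullGate α β γ δ ε) = ((d : ℂ)⁻¹ * (d : ℂ)⁻¹) * ∑ e, ∑ f,
      weylCoeff H e f (2 * α * e + β * f) (β * e + 2 * γ * f) * chi (δ * e + ε * f) := by
  rw [expect_apply, mul_assoc]
  congr 1
  have h1 : ∀ a b, ∑ a', ∑ b', (starRingEnd ℂ) (fullGate α β γ δ ε b a) * H (a, b) (a', b') *
      fullGate α β γ δ ε b' a' = (d : ℂ)⁻¹ * ∑ e, ∑ f, H (a, b) (a + e, b + f) *
        chi ((2 * α * e + β * f) * (a + e / 2) + (β * e + 2 * γ * f) * (b + f / 2)) *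
        chi (δ * e + ε * f) := by
    intro a b
    rw [← Equiv.sum_comp (Equiv.addLeft a), Finset.mul_sum]
    refine Finset.sum_congr rfl fun e _ => ?_
    rw [← Equiv.sum_comp (Equiv.addLeft b), Finset.mul_sum]
    refine Finset.sum_congr rfl fun f _ => ?_
    simp only [Equiv.coe_addLeft, fullGate_apply, map_mul, map_inv₀, Complex.conj_ofReal,
      star_chi]
    have hsplit : (2 * α * e + β * f) * (a + e / 2) + (β * e + 2 * γ * f) * (b + f / 2) +
        (δ * e + ε * f) = -(α * a ^ 2 + β * a * b + γ * b ^ 2 + δ * a + ε * b) +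
        (α * (a + e) ^ 2 + β * (a + e) * (b + f) + γ * (b + f) ^ 2 + δ * (a + e) +
          ε * (b + f)) := by
      field_simp
      ring
    rw [← sqrt_inv_mul_self, mul_assoc (H _ _), ← AddChar.map_add_eq_mul, hsplit,
      AddChar.map_add_eq_mul _ (-(α * a ^ 2 + β * a * b + γ * b ^ 2 + δ * a + ε * b))]
    ring
  simp only [h1, ← Finset.mul_sum]
  congr 1
  simp only [weylCoeff, Finset.sum_mul]
  calc _ = ∑ a, ∑ e, ∑ b, ∑ f, _ := Finset.sum_congr rfl fun a _ => Finset.sum_comm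
    _ = ∑ e, ∑ a, ∑ f, ∑ b, _ := by
        rw [Finset.sum_comm]
        exact Finset.sum_congr rfl fun e _ => Finset.sum_congr rfl fun a _ => Finset.sum_comm
    _ = _ := Finset.sum_congr rfl fun e _ => Finset.sum_comm

/-- Averaging over the linear phase removes all coherences and leaves a sum of diagonal entries
along a line. -/
theorem sum_expect_monoGate (H : Matrix (ZMod d × ZMod d) (ZMod d × ZMod d) ℂ) (l c : ZMod d) :
    ∑ ε, expect H (monoGate l c 0 ε) = ∑ x, H (x, l * x + c) (x, l * x + c) := by
  have h1 : ∀ ε, expect H (monoGate l c 0 ε) = (d : ℂ)⁻¹ * ∑ a, ∑ a',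
      H (a, l * a + c) (a', l * a' + c) * chi (ε * (a' - a)) := by
    intro ε
    rw [expect_apply]
    congr 1
    refine Finset.sum_congr rfl fun a _ => ?_
    rw [Finset.sum_comm]
    refine Finset.sum_congr rfl fun a' _ => ?_
    simp only [monoGate_apply, mul_ite, mul_zero, apply_ite (starRingEnd ℂ), map_zero, ite_mul,
      zero_mul, Finset.sum_ite_eq', Finset.mem_univ, if_true, star_chi]
    rw [mul_right_comm, ← AddChar.map_add_eq_mul, mul_comm]
    congr 2
    ring
  simp only [h1, ← Finset.mul_sum]
  rw [Finset.sum_comm, Finset.mul_sum]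
  refine Finset.sum_congr rfl fun a _ => ?_
  rw [Finset.sum_comm]
  simp only [← Finset.mul_sum, sum_chi_mul, sub_eq_zero, mul_ite, mul_zero, Finset.sum_ite_eq',
    Finset.mem_univ, if_true]
  rw [mul_left_comm, inv_mul_cancel₀ natCast_dim_ne_zero, mul_one]

/-- A function whose Fourier transform is supported at one point is a multiple of a character. -/
theorem eq_chi_mul_of_fourier_support {g : ZMod d → ℂ} {k₀ : ZMod d}
    (h : ∀ k, k ≠ k₀ → ∑ e, g e * chi (k * e) = 0) (e : ZMod d) :
    g e = chi (-(k₀ * e)) * g 0 := by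
  have hd : (d : ℂ) ≠ 0 := natCast_dim_ne_zero
  have h1 : ∀ e, d * g e = chi (-(k₀ * e)) * ∑ e', g e' * chi (k₀ * e') := by
    intro e
    rw [← sum_sum_chi_sub g e, Finset.sum_eq_single k₀]
    · rw [Finset.mul_sum]
      refine Finset.sum_congr rfl fun x _ => ?_
      rw [mul_left_comm, ← AddChar.map_add_eq_mul, mul_comm]
      congr 2
      ring
    · intro k _ hk
      rw [← mul_zero (chi (-(k * e))), ← h k hk, Finset.mul_sum]
      refine Finset.sum_congr rfl fun x _ => ?_
      rw [mul_left_comm, ← AddChar.map_add_eq_mul, mul_comm]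
      congr 2
      ring
    · simp
  have h3 := h1 0
  rw [mul_zero, neg_zero, AddChar.map_zero_eq_one, one_mul] at h3
  apply mul_left_cancel₀ hd
  rw [h1 e, ← h3]
  ring

/-- Summing over ε along a line δ - ε = k, against a character, isolates e + f = t. What remains is
a one-variable transform in k supported at k₀. -/
theorem eq_chi_mul_of_sum_eq_zero {G : ZMod d → ZMod d → ℂ} {k₀ : ZMod d}
    (h : ∀ δ ε, δ - ε ≠ k₀ → ∑ e, ∑ f, G e f * chi (δ * e + ε * f) = 0) (t e : ZMod d) :
    G e (t - e) = chi (-(k₀ * e)) * G 0 t := by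
  have hd : (d : ℂ) ≠ 0 := natCast_dim_ne_zero
  have := eq_chi_mul_of_fourier_support (g := fun e => G e (t - e)) (k₀ := k₀) (fun k hk => ?_) e
  · simpa using this
  · have h1 : ∑ ε, chi (-(ε * t)) * ∑ e, ∑ f, G e f * chi ((k + ε) * e + ε * f) = 0 := by
      refine Finset.sum_eq_zero fun ε _ => ?_
      rw [h (k + ε) ε (by simpa using hk), mul_zero]
    have h2 : ∑ ε, chi (-(ε * t)) * ∑ e, ∑ f, G e f * chi ((k + ε) * e + ε * f) =
        ∑ e, ∑ f, G e f * chi (k * e) * ∑ ε, chi (ε * (f - (t - e))) := by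
      simp only [Finset.mul_sum]
      rw [Finset.sum_comm]
      refine Finset.sum_congr rfl fun e _ => ?_
      rw [Finset.sum_comm]
      refine Finset.sum_congr rfl fun f _ => Finset.sum_congr rfl fun ε _ => ?_
      rw [mul_left_comm, mul_assoc, ← AddChar.map_add_eq_mul, ← AddChar.map_add_eq_mul]
      congr 2
      ring
    rw [h2] at h1
    simp only [sum_chi_mul, sub_eq_zero, mul_ite, mul_zero, Finset.sum_ite_eq', Finset.mem_univ,
      if_true, ← Finset.sum_mul] at h1
    exact (mul_eq_zero.mp h1).resolve_right hd

/-- An operator without identity and weight-one parts whose expectation vanishes on the Clifford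
gates that saturate the witness is zero, if the labels are not affine. -/
theorem eq_zero_of_expect_eq_zero (h2 : (2 : ZMod d) ≠ 0) {k : ZMod d → ZMod d} {c₀ : ZMod d}
    (hk : ∃ x x' m, k x + k (x' + m) ≠ k (x + m) + k x')
    {H : Matrix (ZMod d × ZMod d) (ZMod d × ZMod d) ℂ}
    (hfull : ∀ α β γ δ ε, β ≠ 0 → δ - ε ≠ k (α - β + γ) → expect H (fullGate α β γ δ ε) = 0)
    (hmono : ∀ l c α ε, l ≠ 0 → (1 + l) * c₀ + c ≠ 0 → expect H (monoGate l c α ε) = 0)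
    (hS : traceSnd H = 0) (hF : traceFst H = 0) : H = 0 := by
  have hd : (d : ℂ) ≠ 0 := natCast_dim_ne_zero
  -- Since the expectation vanishes off δ - ε = k(α - β + γ), the Weyl coefficients on the graph of
  -- each symmetric form are determined, along e + f = t, by the one at e = 0.
  have hrel : ∀ α β γ, β ≠ 0 → ∀ t e,
      weylCoeff H e (t - e) (2 * α * e + β * (t - e)) (β * e + 2 * γ * (t - e)) =
        chi (-(k (α - β + γ) * e)) * weylCoeff H 0 t (β * t) (2 * γ * t) := by
    intro α β γ hβ t e
    have := eq_chi_mul_of_sum_eq_zero (k₀ := k (α - β + γ))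
      (G := fun e f => weylCoeff H e f (2 * α * e + β * f) (β * e + 2 * γ * f))
      (fun δ ε hδ => ?_) t e
    · simpa using this
    · have h := hfull α β γ δ ε hβ hδ
      rw [expect_fullGate h2] at h
      exact (mul_eq_zero.mp h).resolve_left (mul_ne_zero (inv_ne_zero hd) (inv_ne_zero hd))
  have hleft : ∀ e ξ, weylCoeff H e 0 ξ 0 = 0 := by
    intro e ξ
    refine Finset.sum_eq_zero fun x _ => ?_
    have h := congrFun (congrFun hS x) (x + e)
    rw [traceSnd_apply, Matrix.zero_apply] at h
    simp only [add_zero, zero_mul, ← Finset.sum_mul, h]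
  have hright : ∀ f η, weylCoeff H 0 f 0 η = 0 := by
    intro f η
    rw [weylCoeff, Finset.sum_comm]
    refine Finset.sum_eq_zero fun y _ => ?_
    have h := congrFun (congrFun hF y) (y + f)
    rw [traceFst_apply, Matrix.zero_apply] at h
    simp only [add_zero, zero_add, zero_mul, ← Finset.sum_mul, h]
  have hdiag : ∀ ξ η, ξ ≠ 0 → η ≠ 0 → weylCoeff H 0 0 ξ η = 0 := by
    intro ξ η hξ hη
    -- The slope is chosen so that ξx + ηy is constant on the lines y = lx + c. All line sums but
    -- one vanish by hypothesis, and the last one vanishes because the trace does.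
    obtain ⟨l, hl⟩ : ∃ l, l * η = -ξ := ⟨-ξ / η, by field_simp⟩
    have hl0 : l ≠ 0 := by
      rintro rfl
      apply hξ
      linear_combination hl
    set D : ZMod d → ℂ := fun c => ∑ x, H (x, l * x + c) (x, l * x + c) with hD
    have hD0 : ∀ c, (1 + l) * c₀ + c ≠ 0 → D c = 0 := by
      intro c hc
      rw [hD]
      simp only
      rw [← sum_expect_monoGate]
      exact Finset.sum_eq_zero fun ε _ => hmono l c 0 ε hl0 hc
    have hsum : ∀ θ : ZMod d → ℂ, ∑ x, ∑ y, H (x, y) (x, y) * θ (y - l * x) =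
        ∑ c, D c * θ c := by
      intro θ
      simp only [hD, Finset.sum_mul]
      refine Eq.trans ?_ Finset.sum_comm
      refine Finset.sum_congr rfl fun x _ => ?_
      rw [← Equiv.sum_comp (Equiv.addLeft (l * x))]
      refine Finset.sum_congr rfl fun c _ => ?_
      simp only [Equiv.coe_addLeft, add_sub_cancel_left]
    have hone : ∀ θ : ZMod d → ℂ, ∑ c, D c * θ c =
        D (-((1 + l) * c₀)) * θ (-((1 + l) * c₀)) := by
      intro θ
      refine Finset.sum_eq_single _ (fun c _ hc => ?_) (by simp)
      rw [hD0 c, zero_mul]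
      intro h
      exact hc (by linear_combination h)
    have htr := hleft 0 0
    simp only [weylCoeff, add_zero, zero_mul, AddChar.map_zero_eq_one] at htr
    have hstar : D (-((1 + l) * c₀)) = 0 := by
      have h := (hsum fun _ => 1).symm.trans htr
      rwa [hone, mul_one] at h
    have hw : weylCoeff H 0 0 ξ η = ∑ x, ∑ y, H (x, y) (x, y) * chi (η * (y - l * x)) := by
      refine Finset.sum_congr rfl fun x _ => Finset.sum_congr rfl fun y _ => ?_
      rw [add_zero, add_zero, zero_div, add_zero, add_zero]
      congr 2
      linear_combination x * hl
    rw [hw, hsum fun z => chi (η * z), hone, hstar, zero_mul]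
  have hvert : ∀ β γ t, β ≠ 0 → weylCoeff H 0 t (β * t) (2 * γ * t) = 0 := by
    intro β γ t hβ
    by_cases ht : t = 0
    · subst ht
      simpa using hleft 0 0
    by_contra hne
    -- Evaluating the relation at f = 0 gives a right side independent of γ', while the coefficient
    -- on the left is independent of s. If it is nonzero, k(s + γ') splits additively, against the
    -- assumed nonzero mixed difference.
    have hr : ∀ s γ', chi (-(k (s + γ') * t)) * weylCoeff H 0 t (β * t) (2 * γ' * t) =
        weylCoeff H t 0 (2 * (s + β) * t) (β * t) := by
      intro s γ'
      have h := hrel (s + β) β γ' hβ t t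
      rw [add_sub_cancel_right] at h
      rw [← h]
      simp
    obtain ⟨x, x', m, hx⟩ := hk
    have e1 := (hr (x - γ) γ).trans (hr (x - γ) (γ + m)).symm
    have e2 := (hr (x' - γ) γ).trans (hr (x' - γ) (γ + m)).symm
    rw [show x - γ + γ = x by ring, show x - γ + (γ + m) = x + m by ring] at e1
    rw [show x' - γ + γ = x' by ring, show x' - γ + (γ + m) = x' + m by ring] at e2
    have hne' : weylCoeff H 0 t (β * t) (2 * (γ + m) * t) ≠ 0 := by
      intro h0
      rw [h0, mul_zero] at e1
      exact hne ((mul_eq_zero.mp e1).resolve_left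
        fun h => by simpa [h] using chi_mul_neg (-(k x * t)))
    -- Cross-multiplying the two comparisons eliminates both Weyl coefficients.
    have e3 : chi (-(k x * t) + -(k (x' + m) * t)) = chi (-(k (x + m) * t) + -(k x' * t)) := by
      rw [AddChar.map_add_eq_mul, AddChar.map_add_eq_mul]
      apply mul_right_cancel₀ (mul_ne_zero hne hne')
      linear_combination (chi (-(k (x' + m) * t)) * weylCoeff H 0 t (β * t) (2 * (γ + m) * t)) * e1 -
        (chi (-(k (x + m) * t)) * weylCoeff H 0 t (β * t) (2 * (γ + m) * t)) * e2
    have e4 := ZMod.injective_stdAddChar e3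
    apply hx
    apply mul_right_cancel₀ ht
    linear_combination -e4
  refine eq_zero_of_weylCoeff_eq_zero fun e f ξ η => ?_
  -- Every point reached by a form with β ≠ 0 is a phase times a coefficient already known to
  -- vanish. The case analysis shows that only the weight-one and the purely diagonal points are not
  -- reached.
  have hgen : ∀ α β γ, β ≠ 0 → ξ = 2 * α * e + β * f → η = β * e + 2 * γ * f →
      weylCoeff H e f ξ η = 0 := by
    intro α β γ hβ h1 h3
    have h := hrel α β γ hβ (e + f) e
    rw [add_sub_cancel_left, hvert β γ _ hβ, mul_zero] at h
    rw [h1, h3, h]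
  by_cases he : e = 0 <;> by_cases hf : f = 0
  · subst he hf
    by_cases hξ : ξ = 0
    · subst hξ; exact hright _ _
    by_cases hη : η = 0
    · subst hη; exact hleft _ _
    exact hdiag ξ η hξ hη
  · subst he
    by_cases hξ : ξ = 0
    · subst hξ; exact hright _ _
    exact hgen 0 (ξ / f) (η / (2 * f)) (div_ne_zero hξ hf) (by field_simp; ring)
      (by field_simp; ring)
  · subst hf
    by_cases hη : η = 0
    · subst hη; exact hleft _ _
    exact hgen (ξ / (2 * e)) (η / e) 0 (div_ne_zero hη he) (by field_simp; ring)
      (by field_simp; ring)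
  · exact hgen ((ξ - f) / (2 * e)) 1 ((η - e) / (2 * f)) one_ne_zero (by field_simp; ring)
      (by field_simp; ring)

end Weyl

-- Dimension of the facet

section Rank

/-- Adding a complex relation between Hermitian matrices to its adjoint, or subtracting it, gives
real relations for the real and imaginary parts of the coefficients. A real basis of Hermitian
matrices is thus also complex independent. -/
theorem finrank_span_real_eq_complex {n : Type*} [Fintype n] (S : Set (Matrix n n ℂ))
    (hS : ∀ M ∈ S, M.IsHermitian) :
    Module.finrank ℝ (Submodule.span ℝ S) = Module.finrank ℂ (Submodule.span ℂ S) := by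
  obtain ⟨b, hbS, hspan, hli⟩ := exists_linearIndependent ℝ S
  have hspanC : Submodule.span ℂ b = Submodule.span ℂ S := by
    refine le_antisymm (Submodule.span_mono hbS) (Submodule.span_le.mpr fun M hM => ?_)
    have h1 : M ∈ Submodule.span ℝ b := hspan ▸ Submodule.subset_span hM
    exact Submodule.span_le_restrictScalars ℝ ℂ b h1
  have hliC : LinearIndependent ℂ (Subtype.val : b → Matrix n n ℂ) := by
    rw [linearIndependent_iff'] at hli ⊢
    intro s g hg
    have hH : ∀ i : b, (i : Matrix n n ℂ)ᴴ = i := fun i => hS _ (hbS i.2)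
    have hg' : ∑ i ∈ s, star (g i) • (i : Matrix n n ℂ) = 0 := by
      have h := congrArg Matrix.conjTranspose hg
      simpa only [Matrix.conjTranspose_sum, Matrix.conjTranspose_smul, hH,
        Matrix.conjTranspose_zero] using h
    have hre : ∑ i ∈ s, (g i).re • (i : Matrix n n ℂ) = 0 := by
      have h : ∀ i : b, (g i).re • (i : Matrix n n ℂ) =
          (1 / 2 : ℂ) • (g i • (i : Matrix n n ℂ) + star (g i) • (i : Matrix n n ℂ)) := by
        intro i
        rw [← add_smul, smul_smul, RCLike.star_def, Complex.add_conj, ← Complex.coe_smul]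
        congr 1
        push_cast
        ring
      simp only [h, ← Finset.smul_sum, Finset.sum_add_distrib, hg, hg', add_zero, smul_zero]
    have him : ∑ i ∈ s, (g i).im • (i : Matrix n n ℂ) = 0 := by
      have h : ∀ i : b, (g i).im • (i : Matrix n n ℂ) =
          (-Complex.I / 2) • (g i • (i : Matrix n n ℂ) - star (g i) • (i : Matrix n n ℂ)) := by
        intro i
        rw [← sub_smul, smul_smul, RCLike.star_def, Complex.sub_conj, ← Complex.coe_smul]
        congr 1
        push_cast
        linear_combination ((g i).im : ℂ) * Complex.I_sq
      simp only [h, ← Finset.smul_sum, Finset.sum_sub_distrib, hg, hg', sub_zero, smul_zero]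
    intro i hi
    exact Complex.ext (hli s _ hre i hi) (hli s _ him i hi)
  have hfin : b.Finite := hli.setFinite
  have := hfin.fintype
  rw [← hspan, ← hspanC, finrank_span_set_eq_card hli, finrank_span_set_eq_card hliC]

/-- The bilinear trace form `(A, M) ↦ tr (A M)`. -/
def traceBilin (n : Type*) [Fintype n] : LinearMap.BilinForm ℂ (Matrix n n ℂ) :=
  LinearMap.mk₂ ℂ (fun A M => (A * M).trace) (fun A B M => by rw [Matrix.add_mul, Matrix.trace_add])
    (fun c A M => by rw [Matrix.smul_mul, Matrix.trace_smul])
    (fun A M N => by rw [Matrix.mul_add, Matrix.trace_add])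
    (fun c A M => by rw [Matrix.mul_smul, Matrix.trace_smul])

theorem traceBilin_apply {n : Type*} [Fintype n] (A M : Matrix n n ℂ) :
    traceBilin n A M = (A * M).trace := rfl

theorem traceBilin_nondegenerate (n : Type*) [Fintype n] : (traceBilin n).Nondegenerate := by
  constructor
  · intro A hA
    refine Matrix.ext_iff_trace_mul_right.mpr fun M => ?_
    rw [Matrix.zero_mul, Matrix.trace_zero]
    exact hA M
  · intro A hA
    refine Matrix.ext_iff_trace_mul_left.mpr fun M => ?_
    rw [Matrix.mul_zero, Matrix.trace_zero]
    exact hA M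

/-- The operators `A ⊗ 1 + 1 ⊗ B + c W` with traceless `A` and `B`. -/
def weightOneAdd (W : Matrix (ZMod d × ZMod d) (ZMod d × ZMod d) ℂ) :
    (LinearMap.ker (Matrix.traceLinearMap (ZMod d) ℂ ℂ) ×
      LinearMap.ker (Matrix.traceLinearMap (ZMod d) ℂ ℂ)) × ℂ →ₗ[ℂ]
      Matrix (ZMod d × ZMod d) (ZMod d × ZMod d) ℂ where
  toFun p := (p.1.1 : Matrix (ZMod d) (ZMod d) ℂ) ⊗ₖ (1 : Matrix (ZMod d) (ZMod d) ℂ) +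
    (1 : Matrix (ZMod d) (ZMod d) ℂ) ⊗ₖ (p.1.2 : Matrix (ZMod d) (ZMod d) ℂ) + p.2 • W
  map_add' p q := by
    simp only [Prod.fst_add, Prod.snd_add, Submodule.coe_add, Matrix.add_kronecker,
      Matrix.kronecker_add, add_smul]
    abel
  map_smul' c p := by
    simp only [Prod.smul_fst, Prod.smul_snd, Submodule.coe_smul, Matrix.smul_kronecker,
      Matrix.kronecker_smul, smul_add, smul_smul, RingHom.id_apply, smul_eq_mul]

theorem traceSnd_kronecker (A B : Matrix (ZMod d) (ZMod d) ℂ) :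
    traceSnd (A ⊗ₖ B) = B.trace • A := by
  ext i j
  simp only [traceSnd_apply, Matrix.kronecker_apply, ← Finset.mul_sum, Matrix.smul_apply,
    smul_eq_mul, Matrix.trace, Matrix.diag_apply]
  rw [mul_comm]

theorem traceFst_kronecker (A B : Matrix (ZMod d) (ZMod d) ℂ) :
    traceFst (A ⊗ₖ B) = A.trace • B := by
  ext i j
  simp only [traceFst_apply, Matrix.kronecker_apply, ← Finset.sum_mul, Matrix.smul_apply,
    smul_eq_mul, Matrix.trace, Matrix.diag_apply]

theorem traceSnd_add (M N : Matrix (ZMod d × ZMod d) (ZMod d × ZMod d) ℂ) :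
    traceSnd (M + N) = traceSnd M + traceSnd N := by
  ext i j
  simp only [traceSnd_apply, Matrix.add_apply, Finset.sum_add_distrib]

theorem traceFst_add (M N : Matrix (ZMod d × ZMod d) (ZMod d × ZMod d) ℂ) :
    traceFst (M + N) = traceFst M + traceFst N := by
  ext i j
  simp only [traceFst_apply, Matrix.add_apply, Finset.sum_add_distrib]

/-- The trace detects the coefficient of W, and then the two partial traces detect A and B. -/
theorem weightOneAdd_injective {W : Matrix (ZMod d × ZMod d) (ZMod d × ZMod d) ℂ}
    (hW : W.trace = 1) : Function.Injective (weightOneAdd W) := by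
  have hd : (d : ℂ) ≠ 0 := natCast_dim_ne_zero
  rw [injective_iff_map_eq_zero]
  rintro ⟨⟨⟨A, hA⟩, ⟨B, hB⟩⟩, c⟩ h
  have hA' : A.trace = 0 := hA
  have hB' : B.trace = 0 := hB
  change A ⊗ₖ (1 : Matrix (ZMod d) (ZMod d) ℂ) + (1 : Matrix (ZMod d) (ZMod d) ℂ) ⊗ₖ B + c • W = 0
    at h
  have hc : c = 0 := by
    have h1 := congrArg Matrix.trace h
    simpa [Matrix.trace_add, Matrix.trace_kronecker, hA', hB', hW] using h1
  subst hc
  rw [zero_smul, add_zero] at h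
  have hz1 : traceSnd (0 : Matrix (ZMod d × ZMod d) (ZMod d × ZMod d) ℂ) = 0 := by
    ext i j; simp [traceSnd_apply]
  have hz2 : traceFst (0 : Matrix (ZMod d × ZMod d) (ZMod d × ZMod d) ℂ) = 0 := by
    ext i j; simp [traceFst_apply]
  have h1 := congrArg traceSnd h
  have h2 := congrArg traceFst h
  rw [traceSnd_add, traceSnd_kronecker, traceSnd_kronecker, hB', zero_smul, add_zero,
    Matrix.trace_one, ZMod.card, hz1] at h1
  rw [traceFst_add, traceFst_kronecker, traceFst_kronecker, hA', zero_smul, zero_add,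
    Matrix.trace_one, ZMod.card, hz2] at h2
  obtain rfl := (smul_eq_zero.mp h1).resolve_left hd
  obtain rfl := (smul_eq_zero.mp h2).resolve_left hd
  rfl

theorem finrank_range_weightOneAdd {W : Matrix (ZMod d × ZMod d) (ZMod d × ZMod d) ℂ}
    (hW : W.trace = 1) :
    Module.finrank ℂ (LinearMap.range (weightOneAdd W)) = 2 * (d ^ 2 - 1) + 1 := by
  have hd : (d : ℂ) ≠ 0 := natCast_dim_ne_zero
  have hker : Module.finrank ℂ (LinearMap.ker (Matrix.traceLinearMap (ZMod d) ℂ ℂ)) =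
      d ^ 2 - 1 := by
    have h := LinearMap.finrank_range_add_finrank_ker (Matrix.traceLinearMap (ZMod d) ℂ ℂ)
    have hsurj : LinearMap.range (Matrix.traceLinearMap (ZMod d) ℂ ℂ) = ⊤ := by
      rw [LinearMap.range_eq_top]
      intro c
      exact ⟨Matrix.single 0 0 c, by simp⟩
    rw [hsurj, finrank_top, Module.finrank_self, Module.finrank_matrix, ZMod.card,
      Module.finrank_self, mul_one, ← sq] at h
    omega
  rw [LinearMap.finrank_range_of_inj (weightOneAdd_injective hW), Module.finrank_prod,
    Module.finrank_prod, hker, Module.finrank_self]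
  ring

variable [Fact d.Prime]

theorem isCliffordFacet_witnessB (h2 : (2 : ZMod d) ≠ 0) (u : Fin (d + 1) → ZMod d)
    (hk : ∃ x x' m, kappa u x + kappa u (x' + m) ≠ kappa u (x + m) + kappa u x') :
    IsCliffordFacet (witnessB u) := by
  have hd : (d : ℂ) ≠ 0 := natCast_dim_ne_zero
  refine ⟨witnessB_isHermitian h2 u, trace_witnessB h2 u, fun C hC => ?_, ?_⟩
  · rw [choiExpect_witnessB h2 u hC.1]
    exact hC.phaseForm_nonneg h2 u
  set W := witnessB u with hW
  have hWtr : W.trace = 1 := trace_witnessB h2 u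
  set S : Set (Matrix (ZMod d × ZMod d) (ZMod d × ZMod d) ℂ) :=
    {V | ∃ C : Matrix (ZMod d) (ZMod d) ℂ, IsClifford C ∧ choiExpect W C = 0 ∧
      V = vecMulVec (choiVec C) (star (choiVec C))} with hS
  have hSH : ∀ M ∈ S, M.IsHermitian := by
    rintro _ ⟨C, -, -, rfl⟩
    rw [Matrix.IsHermitian, Matrix.conjTranspose_vecMulVec, star_star]
  rw [finrank_span_real_eq_complex S hSH]
  have hmem : ∀ H, H ∈ (traceBilin (ZMod d × ZMod d)).orthogonal (Submodule.span ℂ S) ↔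
      ∀ C : Matrix (ZMod d) (ZMod d) ℂ, IsClifford C → choiExpect W C = 0 → expect H C = 0 := by
    intro H
    rw [LinearMap.BilinForm.mem_orthogonal_iff]
    constructor
    · intro h C hC h0
      have := h _ (Submodule.subset_span ⟨C, hC, h0, rfl⟩)
      rwa [traceBilin_apply, Matrix.trace_mul_comm, trace_mul_vecMulVec] at this
    · intro h M hM
      induction hM using Submodule.span_induction with
      | mem M hM =>
        obtain ⟨C, hC, h0, rfl⟩ := hM
        rw [traceBilin_apply, Matrix.trace_mul_comm, trace_mul_vecMulVec]
        exact h C hC h0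
      | zero => simp
      | add M N _ _ hM hN => rw [map_add, LinearMap.add_apply, hM, hN, add_zero]
      | smul c M _ hM => rw [map_smul, LinearMap.smul_apply, hM, smul_zero]
  -- Orthogonality to the span means vanishing expectation on every saturating gate, so the
  -- annihilator can be computed by Weyl coefficients.
  have horth : (traceBilin (ZMod d × ZMod d)).orthogonal (Submodule.span ℂ S) =
      LinearMap.range (weightOneAdd W) := by
    have hrange : LinearMap.range (weightOneAdd W) ≤
        (traceBilin (ZMod d × ZMod d)).orthogonal (Submodule.span ℂ S) := by
      rintro _ ⟨⟨⟨⟨A, hA⟩, ⟨B, hB⟩⟩, c⟩, rfl⟩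
      have hA' : A.trace = 0 := hA
      have hB' : B.trace = 0 := hB
      rw [hmem]
      intro C hC h0
      change expect (A ⊗ₖ (1 : Matrix (ZMod d) (ZMod d) ℂ) +
        (1 : Matrix (ZMod d) (ZMod d) ℂ) ⊗ₖ B + c • W) C = 0
      rw [choiExpect_witnessB h2 u hC.1] at h0
      rw [expect_add, expect_add, expect_smul, expect_kronecker_one hC.1,
        expect_one_kronecker hC.1, hA', hB', expect_witnessB h2 u hC.1, h0]
      simp
    refine le_antisymm (fun H hH => ?_) hrange
    -- First the trace is removed with W, then the partial traces with weight-one operators; the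
    -- remainder meets the hypotheses of `eq_zero_of_expect_eq_zero`.
    set H₀ := H - H.trace • W with hH₀
    have hH₀tr : H₀.trace = 0 := by
      rw [hH₀, Matrix.trace_sub, Matrix.trace_smul, hWtr, smul_eq_mul, mul_one, sub_self]
    set A := (d : ℂ)⁻¹ • traceSnd H₀ with hA
    set B := (d : ℂ)⁻¹ • traceFst H₀ with hB
    have hAtr : A.trace = 0 := by
      rw [hA, Matrix.trace_smul, trace_traceSnd, hH₀tr, smul_zero]
    have hBtr : B.trace = 0 := by
      rw [hB, Matrix.trace_smul, trace_traceFst, hH₀tr, smul_zero]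
    set R := weightOneAdd W ((⟨A, hAtr⟩, ⟨B, hBtr⟩), H.trace) with hR
    have hReq : R = A ⊗ₖ (1 : Matrix (ZMod d) (ZMod d) ℂ) +
        (1 : Matrix (ZMod d) (ZMod d) ℂ) ⊗ₖ B + H.trace • W := rfl
    have hsplit : H₀ = (H - R) + (A ⊗ₖ (1 : Matrix (ZMod d) (ZMod d) ℂ) +
        (1 : Matrix (ZMod d) (ZMod d) ℂ) ⊗ₖ B) := by
      rw [hReq, hH₀]
      abel
    have hSnd : traceSnd (H - R) = 0 := by
      have h := congrArg traceSnd hsplit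
      rw [traceSnd_add, traceSnd_add, traceSnd_kronecker, traceSnd_kronecker, hBtr, zero_smul,
        add_zero, Matrix.trace_one, ZMod.card, hA, smul_smul, mul_inv_cancel₀ hd, one_smul] at h
      exact right_eq_add.mp h
    have hFst : traceFst (H - R) = 0 := by
      have h := congrArg traceFst hsplit
      rw [traceFst_add, traceFst_add, traceFst_kronecker, traceFst_kronecker, hAtr, zero_smul,
        zero_add, Matrix.trace_one, ZMod.card, hB, smul_smul, mul_inv_cancel₀ hd, one_smul] at h
      exact right_eq_add.mp h
    have hdiff := (hmem (H - R)).mp (Submodule.sub_mem _ hH (hrange ⟨_, rfl⟩))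
    have hzero : H - R = 0 := by
      refine eq_zero_of_expect_eq_zero h2 (c₀ := u 0) hk (fun α β γ δ ε hβ h => ?_)
        (fun l c α ε hl h => ?_) hSnd hFst
      · have hC := isClifford_fullGate α γ δ ε hβ
        refine hdiff _ hC ?_
        rw [choiExpect_witnessB h2 u hC.1, phaseForm_fullGate h2 u h]
      · have hC := isClifford_monoGate c α ε hl
        refine hdiff _ hC ?_
        rw [choiExpect_witnessB h2 u hC.1, phaseForm_monoGate u h]
    exact ⟨_, (sub_eq_zero.mp hzero).symm⟩
  have hfin := LinearMap.BilinForm.finrank_orthogonal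
    (traceBilin_nondegenerate (ZMod d × ZMod d)) (Submodule.span ℂ S)
  have hle := Submodule.finrank_le (Submodule.span ℂ S)
  rw [horth, finrank_range_weightOneAdd hWtr] at hfin
  rw [Module.finrank_matrix, Fintype.card_prod, ZMod.card, Module.finrank_self, mul_one] at hfin hle
  -- With n = d² - 1 the count is (n+1)² - (2n+1) = n², free of truncated subtraction.
  obtain ⟨n, hn⟩ : ∃ n, d ^ 2 = n + 1 :=
    Nat.exists_eq_succ_of_ne_zero (pow_ne_zero 2 (NeZero.ne d))
  rw [← sq d, hn] at hfin hle
  rw [hn, Nat.add_sub_cancel]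
  rw [Nat.add_sub_cancel] at hfin
  have h3 : (n + 1) * (n + 1) = n ^ 2 + (2 * n + 1) := by ring
  rw [h3] at hfin hle
  omega

end Rank

-- Exact robustness of antidiagonal gates

section AntidiagonalGate

variable [Fact d.Prime]

/-- For an antidiagonal unitary gate and the witness whose labels minimize the overlaps with the
mutually unbiased bases, the witness threshold is the exact robustness of the gate. -/
theorem antidiagonal_gate_robustness (h2 : (2 : ZMod d) ≠ 0) (u : Fin (d + 1) → ZMod d)
    (hk : ∃ x x' m, kappa u x + kappa u (x' + m) ≠ kappa u (x + m) + kappa u x')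
    {U : Matrix (ZMod d) (ZMod d) ℂ} {w : ZMod d → ℂ}
    (hU : ∀ y x, U y x = if y = -x then w x else 0) (hw : ∀ j, normSq (w j) = 1)
    (hmin : ∀ y k, normSq (ampl y (kappa u y) w) ≤ normSq (ampl y k w))
    (hneg : phaseForm u w < 0) :
    U ∈ Matrix.unitaryGroup (ZMod d) ℂ ∧ IsCliffordFacet (witnessB u) ∧
      choiExpect (witnessB u) U = phaseForm u w ∧
      Certifies (witnessB u) U (threshold (witnessB u) U) ∧
      IsLeast (cliffordNoise U) (threshold (witnessB u) U) := by
  have hUnit : U ∈ Matrix.unitaryGroup (ZMod d) ℂ := by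
    rw [Matrix.mem_unitaryGroup_iff']
    ext x x'
    simp only [Matrix.star_eq_conjTranspose, Matrix.mul_apply, Matrix.conjTranspose_apply, hU,
      apply_ite star, star_zero, ite_mul, zero_mul]
    rw [Finset.sum_ite_eq' Finset.univ (-x), if_pos (Finset.mem_univ _), Matrix.one_apply]
    by_cases hx : x = x'
    · subst hx
      rw [if_pos rfl, if_pos rfl, RCLike.star_def, ← Complex.normSq_eq_conj_mul_self, hw,
        Complex.ofReal_one]
    · rw [if_neg fun h => hx (neg_injective h), if_neg hx, mul_zero]
  have hfacet := isCliffordFacet_witnessB h2 u hk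
  have hanti : antidiag U = w := by
    funext j
    rw [antidiag, hU, if_pos rfl]
  have hval : choiExpect (witnessB u) U = phaseForm u w := by
    rw [choiExpect_witnessB h2 u hUnit, hanti]
  have hcert : Certifies (witnessB u) U (threshold (witnessB u) U) :=
    certifies_threshold hfacet (by rw [hval]; exact hneg)
  refine ⟨hUnit, hfacet, hval, hcert, ?_, ?_⟩
  · have hd : (0 : ℝ) < (d : ℝ) ^ 2 := by
      have : (0 : ℝ) < d := by exact_mod_cast Nat.pos_of_ne_zero (NeZero.ne d)
      positivity
    have hD : 0 ≤ (d : ℝ) ^ 2 * -phaseForm u w := by nlinarith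
    set D := (d : ℝ) ^ 2 * -phaseForm u w with hDdef
    have ht : threshold (witnessB u) U = 1 - 1 / (D + 1) := by
      rw [threshold, hval, abs_of_neg hneg]
    have hle : 1 / (D + 1) ≤ 1 := by
      rw [div_le_one (by linarith)]
      linarith
    have hnn : 0 ≤ 1 / (D + 1) := by positivity
    have h0 : 0 ≤ threshold (witnessB u) U := by rw [ht]; linarith
    have h1 : threshold (witnessB u) U ≤ 1 := by rw [ht]; linarith
    refine ⟨⟨h0, h1⟩, depolarized_mem_cliffordPolytope h2 u hU hw hmin h0 h1 ?_⟩
    have hD1 : D + 1 ≠ 0 := by linarith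
    -- At the threshold p/(1-p) = D, which is the equation the mixture requires.
    have hrw : -(1 - threshold (witnessB u) U) * (d : ℝ) ^ 2 * phaseForm u w =
        (1 - threshold (witnessB u) U) * D := by rw [hDdef]; ring
    rw [hrw, ht]
    field_simp
    ring
  · rintro p ⟨⟨hp0, -⟩, hp⟩
    by_contra hlt
    exact (hcert p hp0 (not_le.mp hlt)).2 hp

end AntidiagonalGate

local instance fact_prime_five : Fact (Nat.Prime 5) := ⟨by norm_num⟩

local instance fact_prime_seven : Fact (Nat.Prime 7) := ⟨by norm_num⟩

-- The three gates as antidiagonal phases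

section Gates

theorem forall_zmod_three {P : ZMod 3 → Prop} (h0 : P 0) (h1 : P 1) (h2 : P 2) (j : ZMod 3) :
    P j := by
  change Fin 3 at j
  fin_cases j <;> assumption

theorem forall_zmod_five {P : ZMod 5 → Prop} (h0 : P 0) (h1 : P 1) (h2 : P 2) (h3 : P 3)
    (h4 : P 4) (j : ZMod 5) : P j := by
  change Fin 5 at j
  fin_cases j <;> assumption

theorem forall_zmod_seven {P : ZMod 7 → Prop} (h0 : P 0) (h1 : P 1) (h2 : P 2) (h3 : P 3)
    (h4 : P 4) (h5 : P 5) (h6 : P 6) (j : ZMod 7) : P j := by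
  change Fin 7 at j
  fin_cases j <;> assumption

theorem exp_eq_chi (n : ℤ) {z : ℂ} (h : z = 2 * Real.pi * Complex.I * n / d) :
    Complex.exp z = chi (n : ZMod d) := by
  rw [h]
  exact (ZMod.stdAddChar_coe n).symm

/-- The antidiagonal phases of the qutrit gate. -/
def qutritPhase : ZMod 3 → ℂ :=
  (![1, Complex.exp (-(2 * Real.pi * Complex.I / 9)), Complex.exp (2 * Real.pi * Complex.I / 9)] :
    Fin 3 → ℂ)

theorem qutritU_apply (y x : ZMod 3) : qutritU y x = if y = -x then qutritPhase x else 0 := by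
  revert y x
  apply forall_zmod_three <;> apply forall_zmod_three <;>
    first
    | rw [if_neg (by decide)]; rfl
    | rw [if_pos (by decide)]; rfl

/-- The cubes of 1, 2, 3, 4 modulo 5 are 1, 3, 2, 4: the gate is a cubic phase followed by x ↦ -x.
-/
theorem ququintU_apply (y x : ZMod 5) : ququintU y x = if y = -x then chi (x ^ 3) else 0 := by
  have e1 : Complex.exp (2 * Real.pi * Complex.I / 5) = chi (1 : ZMod 5) := by
    rw [exp_eq_chi (d := 5) 1 (by push_cast; ring), Int.cast_one]
  have e2 : Complex.exp (4 * Real.pi * Complex.I / 5) = chi (2 : ZMod 5) := by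
    rw [exp_eq_chi (d := 5) 2 (by push_cast; ring)]; rfl
  have e3 : Complex.exp (-(4 * Real.pi * Complex.I / 5)) = chi (3 : ZMod 5) := by
    rw [exp_eq_chi (d := 5) (-2) (by push_cast; ring)]; rfl
  have e4 : Complex.exp (-(2 * Real.pi * Complex.I / 5)) = chi (4 : ZMod 5) := by
    rw [exp_eq_chi (d := 5) (-1) (by push_cast; ring)]; rfl
  rw [ququintU, e1, e2, e3, e4]
  revert y x
  apply forall_zmod_five <;> apply forall_zmod_five <;>
    first
    | rw [if_neg (by decide)]; rfl
    | rw [if_pos (by decide)]; rfl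
    | rw [if_pos (by decide)]; exact (AddChar.map_zero_eq_one _).symm

theorem quseptU_apply (y x : ZMod 7) :
    quseptU y x = if y = -x then chi (2 * x ^ 3 - x ^ 2 - x) else 0 := by
  have e1 : Complex.exp (10 * Real.pi * Complex.I / 7) = chi (5 : ZMod 7) := by
    rw [exp_eq_chi (d := 7) 5 (by push_cast; ring)]; rfl
  have e2 : Complex.exp (6 * Real.pi * Complex.I / 7) = chi (3 : ZMod 7) := by
    rw [exp_eq_chi (d := 7) 3 (by push_cast; ring)]; rfl
  rw [quseptU, e1, e2]
  revert y x
  apply forall_zmod_seven <;> apply forall_zmod_seven <;>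
    first
    | rw [if_neg (by decide)]; rfl
    | rw [if_pos (by decide)]; rfl
    | rw [if_pos (by decide)]; exact (AddChar.map_zero_eq_one _).symm

end Gates

-- Minimal overlaps and witness values

section Values

theorem chi_add_chi_neg (n : ℤ) :
    chi (n : ZMod d) + chi (-(n : ZMod d)) = ((2 * Real.cos (2 * Real.pi * n / d) : ℝ) : ℂ) := by
  rw [← Int.cast_neg, ← exp_eq_chi (d := d) n rfl, ← exp_eq_chi (d := d) (-n) rfl]
  push_cast
  rw [Complex.two_cos]
  congr 2 <;> ring

theorem kappa_ququint (y : ZMod 5) : kappa (d := 5) ![0, 0, 0, 1, 3, 1] y = 3 * y ^ 2 := by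
  revert y
  decide

/-- These labels complete the cube: j³ - yj² - 3y²j = (j + 3y)³ + 3y³ modulo 5. Cubing permutes the
residues modulo 5, so the exponential sum vanishes, and zero is certainly minimal. -/
theorem ampl_ququint (y : ZMod 5) : ampl y (3 * y ^ 2) (fun j : ZMod 5 => chi (j ^ 3)) = 0 := by
  have h : ampl y (3 * y ^ 2) (fun j : ZMod 5 => chi (j ^ 3)) =
      chi (3 * y ^ 3) * ∑ j : ZMod 5, chi ((j + 3 * y) ^ 3) := by
    rw [ampl_eq_sum, Finset.mul_sum]
    refine Finset.sum_congr rfl fun j _ => ?_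
    rw [← AddChar.map_add_eq_mul, ← AddChar.map_add_eq_mul]
    congr 1
    revert y j
    decide
  have hcube : Function.Bijective fun j : ZMod 5 => j ^ 3 := by decide
  have h0 : ∑ j : ZMod 5, chi ((j + 3 * y) ^ 3) = ∑ j : ZMod 5, chi (j * 1) := by
    simp only [mul_one]
    exact (Equiv.sum_comp (Equiv.addRight (3 * y)) fun j : ZMod 5 => chi (j ^ 3)).trans
      (hcube.sum_comp fun j : ZMod 5 => chi j)
  rw [h, h0, sum_chi_mul, if_neg (by decide), mul_zero]

theorem phaseForm_ququint :
    phaseForm (d := 5) ![0, 0, 0, 1, 3, 1] (fun j => chi (j ^ 3)) = -(4 / 5) := by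
  simp only [phaseForm, kappa_ququint, ampl_ququint, normSq_chi, map_zero, Finset.sum_const_zero,
    Finset.sum_const, Finset.card_univ, ZMod.card]
  norm_num

theorem kappa_qusept (y : ZMod 7) :
    kappa (d := 7) ![0, 0, 0, 3, 2, 4, 2, 3] y = (1 + y) ^ 2 - 1 := by
  revert y
  decide

/-- The cubic exponential sums modulo 7. -/
def cubicSum (m : ZMod 7) : ℂ := ∑ j : ZMod 7, chi (2 * j ^ 3 + m * j)

/-- The translation by 1 + y removes the quadratic term, since 6 = -1 modulo 7. The overlap then
depends on y and k only through the remaining linear coefficient, and the labels in `kappa_qusept`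
make that coefficient zero. -/
theorem normSq_ampl_qusept (y k : ZMod 7) :
    normSq (ampl y k (fun j : ZMod 7 => chi (2 * j ^ 3 - j ^ 2 - j))) =
      normSq (cubicSum ((1 + y) ^ 2 - 1 - k)) := by
  have h : ampl y k (fun j : ZMod 7 => chi (2 * j ^ 3 - j ^ 2 - j)) =
      chi (-(2 * (1 + y) ^ 3) - ((1 + y) ^ 2 - 1 - k) * (1 + y)) *
        cubicSum ((1 + y) ^ 2 - 1 - k) := by
    rw [ampl_eq_sum, cubicSum, ← Equiv.sum_comp (Equiv.addRight (1 + y)) fun j : ZMod 7 =>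
      chi (2 * j ^ 3 + ((1 + y) ^ 2 - 1 - k) * j), Finset.mul_sum]
    refine Finset.sum_congr rfl fun j _ => ?_
    rw [← AddChar.map_add_eq_mul, ← AddChar.map_add_eq_mul]
    congr 1
    have h7 : (7 : ZMod 7) = 0 := by decide
    simp only [Equiv.coe_addRight]
    linear_combination (-(1 + y) * j ^ 2 - (1 + y) ^ 2 * j) * h7
  rw [h, normSq_mul, normSq_chi, one_mul]

theorem sum_zmod_seven (f : ZMod 7 → ℂ) :
    ∑ j, f j = f 0 + f 1 + f 2 + f 3 + f 4 + f 5 + f 6 :=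
  Fin.sum_univ_seven f

/-- Double and triple angle formulas express every conjugate pair by c = 2cos(2π/7), and the
vanishing sum of the seventh roots of unity becomes the cubic equation. -/
theorem exists_chi_seven : ∃ c : ℝ, 1.24697 < c ∧ c < 1.24699 ∧ c ^ 3 + c ^ 2 - 2 * c - 1 = 0 ∧
    chi (1 : ZMod 7) + chi (6 : ZMod 7) = (c : ℂ) ∧
    chi (2 : ZMod 7) + chi (5 : ZMod 7) = ((c ^ 2 - 2 : ℝ) : ℂ) ∧
    chi (3 : ZMod 7) + chi (4 : ZMod 7) = ((c ^ 3 - 3 * c : ℝ) : ℂ) := by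
  set c : ℝ := 2 * Real.cos (2 * Real.pi / 7) with hc
  have hpi := Real.pi_pos
  have h1 : chi (1 : ZMod 7) + chi (6 : ZMod 7) = (c : ℂ) := by
    have h := chi_add_chi_neg (d := 7) 1
    rw [show 2 * Real.pi * ((1 : ℤ) : ℝ) / ((7 : ℕ) : ℝ) = 2 * Real.pi / 7 by push_cast; ring] at h
    exact h
  have h2 : chi (2 : ZMod 7) + chi (5 : ZMod 7) = ((c ^ 2 - 2 : ℝ) : ℂ) := by
    have h := chi_add_chi_neg (d := 7) 2
    rw [show 2 * Real.pi * ((2 : ℤ) : ℝ) / ((7 : ℕ) : ℝ) = 2 * (2 * Real.pi / 7) by push_cast; ring,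
      Real.cos_two_mul] at h
    rw [hc, show (2 * Real.cos (2 * Real.pi / 7)) ^ 2 - 2 =
      2 * (2 * Real.cos (2 * Real.pi / 7) ^ 2 - 1) by ring]
    exact h
  have h3 : chi (3 : ZMod 7) + chi (4 : ZMod 7) = ((c ^ 3 - 3 * c : ℝ) : ℂ) := by
    have h := chi_add_chi_neg (d := 7) 3
    rw [show 2 * Real.pi * ((3 : ℤ) : ℝ) / ((7 : ℕ) : ℝ) = 3 * (2 * Real.pi / 7) by push_cast; ring,
      Real.cos_three_mul] at h
    rw [hc, show (2 * Real.cos (2 * Real.pi / 7)) ^ 3 - 3 * (2 * Real.cos (2 * Real.pi / 7)) =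
      2 * (4 * Real.cos (2 * Real.pi / 7) ^ 3 - 3 * Real.cos (2 * Real.pi / 7)) by ring]
    exact h
  have hcubic : c ^ 3 + c ^ 2 - 2 * c - 1 = 0 := by
    have hs : chi (0 : ZMod 7) + chi (1 : ZMod 7) + chi (2 : ZMod 7) + chi (3 : ZMod 7) +
        chi (4 : ZMod 7) + chi (5 : ZMod 7) + chi (6 : ZMod 7) = 0 := by
      have hs := sum_chi_mul (1 : ZMod 7)
      simp only [mul_one] at hs
      rw [sum_zmod_seven, if_neg (by decide)] at hs
      exact hs
    have h0 : chi (0 : ZMod 7) = 1 := AddChar.map_zero_eq_one _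
    have : ((c ^ 3 + c ^ 2 - 2 * c - 1 : ℝ) : ℂ) = 0 := by
      push_cast at h1 h2 h3 ⊢
      linear_combination hs - h1 - h2 - h3 - h0
    exact_mod_cast this
  -- This separates c from the other two roots of the cubic, which are negative, so the signs of the
  -- cubic yield the decimal bounds.
  have hc1 : 1 < c := by
    have h := Real.cos_lt_cos_of_nonneg_of_le_pi_div_two (x := 2 * Real.pi / 7) (y := Real.pi / 3)
      (by positivity) (by linarith) (by linarith)
    rw [Real.cos_pi_div_three] at h
    rw [hc]
    linarith
  have hlo : 1.24697 < c := by
    by_contra hle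
    rw [not_lt] at hle
    nlinarith [mul_nonneg (sub_nonneg.mpr hle) (sub_nonneg.mpr hc1.le), sq_nonneg c]
  have hhi : c < 1.24699 := by
    by_contra hle
    rw [not_lt] at hle
    nlinarith [mul_nonneg (sub_nonneg.mpr hle) (sub_nonneg.mpr hc1.le), sq_nonneg c,
      mul_nonneg (sub_nonneg.mpr hle) (mul_nonneg (sub_nonneg.mpr hle) (sub_nonneg.mpr hc1.le))]
  exact ⟨c, hlo, hhi, hcubic, h1, h2, h3⟩

theorem cubicSum_eq (m : ZMod 7) {a₁ a₂ a₃ a₄ a₅ a₆ : ZMod 7}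
    (h : (2 + m, 2 + m * 2, 5 + m * 3, 2 + m * 4, 5 + m * 5, 5 + m * 6) =
      (a₁, a₂, a₃, a₄, a₅, a₆)) :
    cubicSum m = 1 + chi a₁ + chi a₂ + chi a₃ + chi a₄ + chi a₅ + chi a₆ := by
  simp only [Prod.mk.injEq] at h
  obtain ⟨rfl, rfl, rfl, rfl, rfl, rfl⟩ := h
  rw [cubicSum, sum_zmod_seven]
  congr 1
  congr 1
  congr 1
  congr 1
  congr 1
  congr 1
  · rw [show (2 * 0 ^ 3 + m * 0 : ZMod 7) = 0 by ring, AddChar.map_zero_eq_one]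
  all_goals
    congr 1
    revert m
    decide

theorem normSq_eq_sq {z : ℂ} {x : ℝ} (h : z = x) : normSq z = x ^ 2 := by
  rw [h, Complex.normSq_ofReal, sq]

/-- The substitution j → vj with v³ = 1, v in {1, 2, 4}, leaves the sum unchanged and replaces m by
vm. Only the classes of m = 0, {1, 2, 4} and {3, 5, 6} need comparison, and all three sums are real
polynomials in c. -/
theorem cubicSum_values : ∃ c : ℝ, 1.24697 < c ∧ c < 1.24699 ∧
    normSq (cubicSum 0) = (3 * c ^ 2 - 5) ^ 2 ∧
    ∀ m, normSq (cubicSum 0) ≤ normSq (cubicSum m) := by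
  obtain ⟨c, hlo, hhi, hcubic, h1, h2, h3⟩ := exists_chi_seven
  have h0 : chi (0 : ZMod 7) = 1 := AddChar.map_zero_eq_one _
  have n0 : normSq (cubicSum 0) = (3 * c ^ 2 - 5) ^ 2 := by
    have : cubicSum 0 = ((3 * c ^ 2 - 5 : ℝ) : ℂ) := by
      rw [cubicSum_eq 0 (a₁ := 2) (a₂ := 2) (a₃ := 5) (a₄ := 2) (a₅ := 5) (a₆ := 5) (by decide)]
      push_cast at h2 ⊢
      linear_combination 3 * h2
    exact normSq_eq_sq this
  have hA : ∀ m : ZMod 7, cubicSum m =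
      1 + (chi (1 : ZMod 7) + chi (6 : ZMod 7)) + 2 * (chi (3 : ZMod 7) + chi (4 : ZMod 7)) →
      normSq (cubicSum m) = (1 + c + 2 * (c ^ 3 - 3 * c)) ^ 2 := by
    intro m hm
    refine normSq_eq_sq ?_
    rw [hm, h1, h3]
    push_cast
    rfl
  have hB : ∀ m : ZMod 7, cubicSum m =
      3 + (chi (1 : ZMod 7) + chi (6 : ZMod 7)) + (chi (2 : ZMod 7) + chi (5 : ZMod 7)) →
      normSq (cubicSum m) = (3 + c + (c ^ 2 - 2)) ^ 2 := by
    intro m hm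
    refine normSq_eq_sq ?_
    rw [hm, h1, h2]
    push_cast
    rfl
  have hsq : 1.5549 < c ^ 2 ∧ c ^ 2 < 1.555 := by constructor <;> nlinarith
  have hbA : (3 * c ^ 2 - 5) ^ 2 ≤ (1 + c + 2 * (c ^ 3 - 3 * c)) ^ 2 := by
    rw [show 1 + c + 2 * (c ^ 3 - 3 * c) = -(2 * c ^ 2 + c - 3) by linear_combination 2 * hcubic,
      neg_sq]
    apply sq_le_sq'
    all_goals linarith [hsq.1, hsq.2]
  have hbB : (3 * c ^ 2 - 5) ^ 2 ≤ (3 + c + (c ^ 2 - 2)) ^ 2 := by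
    apply sq_le_sq'
    all_goals linarith [hsq.1, hsq.2]
  refine ⟨c, hlo, hhi, n0, ?_⟩
  rw [n0]
  apply forall_zmod_seven
  · exact n0.ge
  · refine hbA.trans_eq (hA 1 ?_).symm
    rw [cubicSum_eq 1 (a₁ := 3) (a₂ := 4) (a₃ := 1) (a₄ := 6) (a₅ := 3) (a₆ := 4) (by decide)]
    ring
  · refine hbA.trans_eq (hA 2 ?_).symm
    rw [cubicSum_eq 2 (a₁ := 4) (a₂ := 6) (a₃ := 4) (a₄ := 3) (a₅ := 1) (a₆ := 3) (by decide)]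
    ring
  · refine hbB.trans_eq (hB 3 ?_).symm
    rw [cubicSum_eq 3 (a₁ := 5) (a₂ := 1) (a₃ := 0) (a₄ := 0) (a₅ := 6) (a₆ := 2) (by decide), h0]
    ring
  · refine hbA.trans_eq (hA 4 ?_).symm
    rw [cubicSum_eq 4 (a₁ := 6) (a₂ := 3) (a₃ := 3) (a₄ := 4) (a₅ := 4) (a₆ := 1) (by decide)]
    ring
  · refine hbB.trans_eq (hB 5 ?_).symm
    rw [cubicSum_eq 5 (a₁ := 0) (a₂ := 5) (a₃ := 6) (a₄ := 1) (a₅ := 2) (a₆ := 0) (by decide), h0]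
    ring
  · refine hbB.trans_eq (hB 6 ?_).symm
    rw [cubicSum_eq 6 (a₁ := 1) (a₂ := 0) (a₃ := 2) (a₄ := 5) (a₅ := 0) (a₆ := 6) (by decide), h0]
    ring

/-- The witness value of the gate for `d = 7`, with the overlaps it minimizes. -/
theorem phaseForm_qusept : ∃ s : ℝ, 0.1122 < s ∧ s < 0.1124 ∧
    phaseForm (d := 7) ![0, 0, 0, 3, 2, 4, 2, 3] (fun j => chi (2 * j ^ 3 - j ^ 2 - j)) =
      (s - 6) / 7 := by
  obtain ⟨c, hlo, hhi, h0, -⟩ := cubicSum_values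
  refine ⟨(3 * c ^ 2 - 5) ^ 2, ?_, ?_, ?_⟩
  · have : 0.335 < 5 - 3 * c ^ 2 := by nlinarith
    nlinarith
  · have : 5 - 3 * c ^ 2 < 0.33525 := by nlinarith
    have : 0 < 5 - 3 * c ^ 2 := by nlinarith
    nlinarith
  · simp only [phaseForm, kappa_qusept, normSq_ampl_qusept, sub_self, h0, normSq_chi,
      Finset.sum_const, Finset.card_univ, ZMod.card]
    push_cast
    simp only [nsmul_eq_mul]
    push_cast
    ring

theorem normSq_ampl_qusept_le (y k : ZMod 7) :
    normSq (ampl y (kappa (d := 7) ![0, 0, 0, 3, 2, 4, 2, 3] y)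
      (fun j : ZMod 7 => chi (2 * j ^ 3 - j ^ 2 - j))) ≤
      normSq (ampl y k (fun j : ZMod 7 => chi (2 * j ^ 3 - j ^ 2 - j))) := by
  obtain ⟨c, -, -, -, h⟩ := cubicSum_values
  rw [kappa_qusept, normSq_ampl_qusept, normSq_ampl_qusept, sub_self]
  exact h _

theorem qutritPhase_pair (k : ℤ) :
    chi (-(k : ZMod 3)) * Complex.exp (-(2 * Real.pi * Complex.I / 9)) +
      chi (k : ZMod 3) * Complex.exp (2 * Real.pi * Complex.I / 9) =
      ((2 * Real.cos (2 * Real.pi / 9 + 2 * Real.pi * k / 3) : ℝ) : ℂ) := by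
  rw [← Int.cast_neg, ← exp_eq_chi (d := 3) k rfl, ← exp_eq_chi (d := 3) (-k) rfl,
    ← Complex.exp_add, ← Complex.exp_add, add_comm]
  push_cast
  rw [Complex.two_cos]
  congr 2 <;> ring

/-- Both nonzero j have j² = 1, so they share the factor ω^(-y), and their phases are conjugate. -/
theorem ampl_qutrit (y : ZMod 3) (k : ℤ) : ampl y (k : ZMod 3) qutritPhase =
    1 + chi (-y) * ((2 * Real.cos (2 * Real.pi / 9 + 2 * Real.pi * k / 3) : ℝ) : ℂ) := by
  rw [ampl_eq_sum, ← qutritPhase_pair]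
  have hsum : ∀ f : ZMod 3 → ℂ, ∑ j, f j = f 0 + f 1 + f 2 := Fin.sum_univ_three
  have e1 : -(y * 1 ^ 2 + (k : ZMod 3) * 1) = -y + -(k : ZMod 3) := by ring
  have e2 : -(y * 2 ^ 2 + (k : ZMod 3) * 2) = -y + (k : ZMod 3) := by
    have h3 : (3 : ZMod 3) = 0 := by decide
    linear_combination (-y - (k : ZMod 3)) * h3
  rw [hsum, e1, e2, show -(y * 0 ^ 2 + (k : ZMod 3) * 0) = 0 by ring,
    AddChar.map_zero_eq_one, AddChar.map_add_eq_mul, AddChar.map_add_eq_mul,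
    show qutritPhase 0 = 1 from rfl,
    show qutritPhase 1 = Complex.exp (-(2 * Real.pi * Complex.I / 9)) from rfl,
    show qutritPhase 2 = Complex.exp (2 * Real.pi * Complex.I / 9) from rfl]
  ring

theorem normSq_qutritPhase (j : ZMod 3) : normSq (qutritPhase j) = 1 := by
  have h : ∀ x : ℝ, normSq (Complex.exp (x * Complex.I)) = 1 := fun x => by
    rw [Complex.normSq_eq_norm_sq, Complex.norm_exp_ofReal_mul_I, one_pow]
  revert j
  apply forall_zmod_three
  · exact map_one normSq
  · change normSq (Complex.exp (-(2 * Real.pi * Complex.I / 9))) = 1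
    rw [← h (-(2 * Real.pi / 9))]
    congr 2
    push_cast
    ring
  · change normSq (Complex.exp (2 * Real.pi * Complex.I / 9)) = 1
    rw [← h (2 * Real.pi / 9)]
    congr 2
    push_cast
    ring

theorem normSq_one_add_chi_mul (y : ZMod 3) (c : ℝ) :
    normSq (1 + chi (-y) * (c : ℂ)) = if y = 0 then (1 + c) ^ 2 else 1 - c + c ^ 2 := by
  have hre : ∀ n : ℤ, (n = 1 ∨ n = 2) → (chi (n : ZMod 3)).re = -(1 / 2) := by
    intro n hn
    rw [← exp_eq_chi (d := 3) n rfl,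
      show 2 * (Real.pi : ℂ) * Complex.I * n / (3 : ℕ) =
        ((2 * Real.pi * n / 3 : ℝ) : ℂ) * Complex.I by push_cast; ring,
      Complex.exp_ofReal_mul_I_re]
    rcases hn with rfl | rfl
    · rw [show 2 * Real.pi * ((1 : ℤ) : ℝ) / 3 = Real.pi - Real.pi / 3 by push_cast; ring,
        Real.cos_pi_sub, Real.cos_pi_div_three]
    · rw [show 2 * Real.pi * ((2 : ℤ) : ℝ) / 3 = Real.pi / 3 + Real.pi by push_cast; ring,
        Real.cos_add_pi, Real.cos_pi_div_three]
  rw [Complex.normSq_add, normSq_mul, normSq_chi, Complex.normSq_ofReal, map_one]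
  simp only [map_mul, Complex.conj_ofReal, one_mul, Complex.re_mul_ofReal, Complex.conj_re]
  revert y
  apply forall_zmod_three
  · rw [if_pos rfl, neg_zero, AddChar.map_zero_eq_one, Complex.one_re]
    ring
  · rw [if_neg (by decide), show (-1 : ZMod 3) = ((2 : ℤ) : ZMod 3) by decide, hre 2 (by simp)]
    ring
  · rw [if_neg (by decide), show (-2 : ZMod 3) = ((1 : ℤ) : ZMod 3) by decide, hre 1 (by simp)]
    ring

/-- The triple angle formula at π/3 gives the cubic; the bound above 1/2 singles out its only
positive root. -/
theorem cos_pi_div_nine_bounds : 8 * Real.cos (Real.pi / 9) ^ 3 - 6 * Real.cos (Real.pi / 9) = 1 ∧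
    0.93969 < Real.cos (Real.pi / 9) ∧ Real.cos (Real.pi / 9) < 0.9397 := by
  have hpi := Real.pi_pos
  have h3 := Real.cos_three_mul (Real.pi / 9)
  rw [show 3 * (Real.pi / 9) = Real.pi / 3 by ring, Real.cos_pi_div_three] at h3
  have h1 : 1 / 2 < Real.cos (Real.pi / 9) := by
    rw [← Real.cos_pi_div_three]
    exact Real.cos_lt_cos_of_nonneg_of_le_pi_div_two (by positivity) (by linarith) (by linarith)
  set x := Real.cos (Real.pi / 9)
  refine ⟨by linarith, ?_, ?_⟩
  · by_contra hle
    rw [not_lt] at hle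
    nlinarith [mul_nonneg (sub_nonneg.mpr hle) (sub_nonneg.mpr h1.le), sq_nonneg x,
      mul_nonneg (sub_nonneg.mpr hle) (sq_nonneg x)]
  · by_contra hle
    rw [not_lt] at hle
    nlinarith [mul_nonneg (sub_nonneg.mpr hle) (sub_nonneg.mpr h1.le), sq_nonneg x,
      mul_nonneg (sub_nonneg.mpr hle) (sq_nonneg x)]

/-- The squared overlaps of the qutrit gate, in terms of `cos (π / 9)`. -/
def qutritOverlap (x : ℝ) (y k : ZMod 3) : ℝ :=
  if y = 0 then (1 + (![4 * x ^ 2 - 2, -(2 * x), 2 * x + 2 - 4 * x ^ 2] : Fin 3 → ℝ) k) ^ 2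
  else 1 - (![4 * x ^ 2 - 2, -(2 * x), 2 * x + 2 - 4 * x ^ 2] : Fin 3 → ℝ) k +
    (![4 * x ^ 2 - 2, -(2 * x), 2 * x + 2 - 4 * x ^ 2] : Fin 3 → ℝ) k ^ 2

theorem normSq_ampl_qutrit (y k : ZMod 3) :
    normSq (ampl y k qutritPhase) = qutritOverlap (Real.cos (Real.pi / 9)) y k := by
  obtain ⟨hx, -, -⟩ := cos_pi_div_nine_bounds
  have h : ∀ n : ℤ, 2 * Real.cos (2 * Real.pi / 9 + 2 * Real.pi * n / 3) =
      (![4 * Real.cos (Real.pi / 9) ^ 2 - 2, -(2 * Real.cos (Real.pi / 9)),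
        2 * Real.cos (Real.pi / 9) + 2 - 4 * Real.cos (Real.pi / 9) ^ 2] : Fin 3 → ℝ)
          (n : ZMod 3) →
      normSq (ampl y (n : ZMod 3) qutritPhase) =
        qutritOverlap (Real.cos (Real.pi / 9)) y (n : ZMod 3) := by
    intro n hn
    rw [ampl_qutrit, hn, normSq_one_add_chi_mul, qutritOverlap]
  have hdouble : Real.cos (2 * Real.pi / 9) = 2 * Real.cos (Real.pi / 9) ^ 2 - 1 := by
    rw [← Real.cos_two_mul]
    congr 1
    ring
  revert k
  apply forall_zmod_three
  · refine h 0 ?_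
    rw [show 2 * Real.pi / 9 + 2 * Real.pi * ((0 : ℤ) : ℝ) / 3 = 2 * Real.pi / 9 by
      push_cast; ring, hdouble]
    change _ = 4 * Real.cos (Real.pi / 9) ^ 2 - 2
    ring
  · refine h 1 ?_
    rw [show 2 * Real.pi / 9 + 2 * Real.pi * ((1 : ℤ) : ℝ) / 3 = Real.pi - Real.pi / 9 by
      push_cast; ring, Real.cos_pi_sub]
    change _ = -(2 * Real.cos (Real.pi / 9))
    ring
  · refine h 2 ?_
    -- This is 2cos(4π/9), of degree four in cos(π/9); the cubic equation lowers it to degree two.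
    rw [show 2 * Real.pi / 9 + 2 * Real.pi * ((2 : ℤ) : ℝ) / 3 =
      2 * Real.pi - 2 * (2 * Real.pi / 9) by push_cast; ring, Real.cos_two_pi_sub,
      Real.cos_two_mul, hdouble]
    change _ = 2 * Real.cos (Real.pi / 9) + 2 - 4 * Real.cos (Real.pi / 9) ^ 2
    linear_combination 2 * Real.cos (Real.pi / 9) * hx

theorem kappa_qutrit (y : ZMod 3) : kappa (d := 3) ![0, 2, 2, 0] y = 1 + y ^ 2 := by
  revert y
  decide

/-- The real parameter is about 1.53, -1.88, 0.35 for k = 0, 1, 2. The second minimizes (1 + c)²,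
used for y = 0, and the third minimizes 1 - c + c², used for y ≠ 0. -/
theorem normSq_ampl_qutrit_le (y k : ZMod 3) :
    normSq (ampl y (kappa (d := 3) ![0, 2, 2, 0] y) qutritPhase) ≤
      normSq (ampl y k qutritPhase) := by
  obtain ⟨-, hlo, hhi⟩ := cos_pi_div_nine_bounds
  rw [kappa_qutrit, normSq_ampl_qutrit, normSq_ampl_qutrit]
  set x := Real.cos (Real.pi / 9)
  have hsq : 0.883 < x ^ 2 ∧ x ^ 2 < 0.8831 := by constructor <;> nlinarith
  obtain ⟨hsl, hsh⟩ := hsq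
  revert y k
  have h0 : ∀ k, qutritOverlap x 0 1 ≤ qutritOverlap x 0 k := by
    apply forall_zmod_three
    · change (1 + -(2 * x)) ^ 2 ≤ (1 + (4 * x ^ 2 - 2)) ^ 2
      nlinarith
    · exact le_rfl
    · change (1 + -(2 * x)) ^ 2 ≤ (1 + (2 * x + 2 - 4 * x ^ 2)) ^ 2
      nlinarith
  have h1 : ∀ y, y ≠ 0 → ∀ k, qutritOverlap x y 2 ≤ qutritOverlap x y k := by
    intro y hy
    simp only [qutritOverlap, if_neg hy]
    apply forall_zmod_three
    · change 1 - (2 * x + 2 - 4 * x ^ 2) + (2 * x + 2 - 4 * x ^ 2) ^ 2 ≤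
        1 - (4 * x ^ 2 - 2) + (4 * x ^ 2 - 2) ^ 2
      nlinarith
    · change 1 - (2 * x + 2 - 4 * x ^ 2) + (2 * x + 2 - 4 * x ^ 2) ^ 2 ≤
        1 - -(2 * x) + (-(2 * x)) ^ 2
      nlinarith
    · exact le_rfl
  apply forall_zmod_three
  · exact h0
  · exact h1 1 (by decide)
  · exact h1 2 (by decide)

/-- The witness value of the qutrit gate. -/
theorem phaseForm_qutrit :
    phaseForm (d := 3) ![0, 2, 2, 0] qutritPhase =
      (1 / 9) * (3 - √3 * Real.cos (Real.pi / 18) - 6 * Real.cos (Real.pi / 9)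
        - 3 * Real.sin (Real.pi / 18) + 2 * √3 * Real.sin (Real.pi / 9)) ∧
    -0.40893 < phaseForm (d := 3) ![0, 2, 2, 0] qutritPhase ∧
    phaseForm (d := 3) ![0, 2, 2, 0] qutritPhase < -0.40886 := by
  obtain ⟨hx, hlo, hhi⟩ := cos_pi_div_nine_bounds
  have hval : phaseForm (d := 3) ![0, 2, 2, 0] qutritPhase =
      (12 * Real.cos (Real.pi / 9) ^ 2 - 12 * Real.cos (Real.pi / 9) - 3) / 9 := by
    have hsum : ∀ f : ZMod 3 → ℝ, ∑ j, f j = f 0 + f 1 + f 2 := Fin.sum_univ_three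
    have hw : ∀ j, normSq (qutritPhase j) = 1 := normSq_qutritPhase
    simp only [phaseForm, hw, kappa_qutrit, normSq_ampl_qutrit, hsum]
    set x := Real.cos (Real.pi / 9)
    have e0 : qutritOverlap x 0 (1 + 0 ^ 2) = (1 + -(2 * x)) ^ 2 := rfl
    have e1 : qutritOverlap x 1 (1 + 1 ^ 2) =
      1 - (2 * x + 2 - 4 * x ^ 2) + (2 * x + 2 - 4 * x ^ 2) ^ 2 := by
        rw [qutritOverlap, if_neg (by decide)]
        rfl
    have e2 : qutritOverlap x 2 (1 + 2 ^ 2) =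
      1 - (2 * x + 2 - 4 * x ^ 2) + (2 * x + 2 - 4 * x ^ 2) ^ 2 := by
        rw [qutritOverlap, if_neg (by decide)]
        rfl
    rw [e0, e1, e2]
    push_cast
    linear_combination (4 * x / 9 - 4 / 9) * hx
  have hdouble : Real.cos (2 * Real.pi / 9) = 2 * Real.cos (Real.pi / 9) ^ 2 - 1 := by
    rw [← Real.cos_two_mul]
    congr 1
    ring
  have hquad : Real.cos (4 * Real.pi / 9) =
      Real.cos (Real.pi / 9) + 1 - 2 * Real.cos (Real.pi / 9) ^ 2 := by
    rw [show 4 * Real.pi / 9 = 2 * (2 * Real.pi / 9) by ring, Real.cos_two_mul, hdouble]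
    linear_combination Real.cos (Real.pi / 9) * hx
  -- Since √3 = 2cos(π/6) = 2sin(π/3), the products in the closed form are sums and differences of
  -- cosines of multiples of π/9.
  have t1 : √3 * Real.cos (Real.pi / 18) =
      Real.cos (2 * Real.pi / 9) + Real.cos (Real.pi / 9) := by
    rw [show 2 * Real.pi / 9 = Real.pi / 6 + Real.pi / 18 by ring,
      show Real.pi / 9 = Real.pi / 6 - Real.pi / 18 by ring, Real.cos_add, Real.cos_sub,
      Real.cos_pi_div_six]
    ring
  have t2 : Real.sin (Real.pi / 18) = Real.cos (4 * Real.pi / 9) := by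
    rw [← Real.cos_pi_div_two_sub]
    congr 1
    ring
  have t3 : √3 * Real.sin (Real.pi / 9) =
      Real.cos (2 * Real.pi / 9) - Real.cos (4 * Real.pi / 9) := by
    rw [show 2 * Real.pi / 9 = Real.pi / 3 - Real.pi / 9 by ring,
      show 4 * Real.pi / 9 = Real.pi / 3 + Real.pi / 9 by ring, Real.cos_add, Real.cos_sub,
      Real.sin_pi_div_three]
    ring
  refine ⟨?_, ?_, ?_⟩
  · rw [hval, t1, mul_assoc, t3, t2, hquad, hdouble]
    ring
  · rw [hval]
    nlinarith
  · rw [hval]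
    nlinarith

end Values

-- The explicit lists as B-type witnesses

section ExplicitFacets

theorem sum_map_list_eq_sum {l : List (ZMod d)} (hl : l.Nodup) (hmem : ∀ x, x ∈ l)
    {M : Type*} [AddCommMonoid M] (f : ZMod d → M) : (l.map f).sum = ∑ x, f x := by
  rw [← List.sum_toFinset f hl]
  congr 1
  ext x
  simp [hmem]

theorem projSum_append (l l' : List (ZMod d × ZMod d × ZMod d × ZMod d × ZMod d)) :
    projSum (l ++ l') = projSum l + projSum l' := by
  rw [projSum, List.map_append, List.sum_append]
  rfl

theorem projSum_flatMap {l : List (ZMod d)} (hl : l.Nodup) (hmem : ∀ x, x ∈ l)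
    (f : ZMod d → ZMod d → ZMod d × ZMod d × ZMod d × ZMod d × ZMod d) :
    projSum (l.flatMap fun z₁ => l.map (f z₁)) =
      ∑ z₁, ∑ z₂, eigenProj (pauliTwo (f z₁ z₂).1 (f z₁ z₂).2.1 (f z₁ z₂).2.2.1
        (f z₁ z₂).2.2.2.1) (f z₁ z₂).2.2.2.2 := by
  rw [projSum, List.map_flatMap, List.flatMap, List.sum_flatten, List.map_map,
    sum_map_list_eq_sum hl hmem]
  refine Finset.sum_congr rfl fun z₁ _ => ?_
  rw [Function.comp_apply, List.map_map, sum_map_list_eq_sum hl hmem]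
  rfl

theorem eigenProj_diagonal_apply (z₁ z₂ : ZMod d) (p q : ZMod d × ZMod d) :
    eigenProj (pauliTwo 0 0 z₁ z₂) (0 : ZMod d) p q =
      if p = q ∧ z₁ * q.1 + z₂ * q.2 = 0 then 1 else 0 := by
  have h : pauliTwo 0 0 z₁ z₂ =
      Matrix.diagonal fun q : ZMod d × ZMod d => chi (z₁ * q.1 + z₂ * q.2) := by
    ext p q
    rw [pauliTwo_apply, Matrix.diagonal_apply, add_zero, add_zero]
    by_cases h : p = q
    · rw [if_pos ⟨congrArg Prod.fst h, congrArg Prod.snd h⟩, if_pos h, h]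
    · rw [if_neg fun h' => h (Prod.ext h'.1 h'.2), if_neg h]
  rw [eigenProj, Matrix.smul_apply, Matrix.sum_apply, smul_eq_mul]
  simp only [h, Matrix.smul_apply, Matrix.diagonal_pow, Matrix.diagonal_apply, Pi.pow_apply,
    smul_eq_mul, ZMod.val_zero, mul_zero, pow_zero, one_mul, ← AddChar.map_nsmul_eq_pow,
    nsmul_eq_mul]
  rw [sum_range_eq_sum_zmod fun m : ZMod d =>
    if p = q then chi (m * (z₁ * p.1 + z₂ * p.2)) else 0]
  by_cases hpq : p = q
  · subst hpq
    simp only [if_true, sum_chi_mul, true_and]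
    split_ifs
    · exact inv_mul_cancel₀ natCast_dim_ne_zero
    · exact mul_zero _
  · simp [hpq]

section Prime

variable [Fact d.Prime]

/-- Along the orbit, the coordinates change by x and -x at each step, so the accumulated phases have
the triangular coefficient x(z₁ - z₂). -/
theorem pauliTwo_pow_apply (h2 : (2 : ZMod d) ≠ 0) (x z₁ z₂ : ZMod d) (m : ℕ)
    (p q : ZMod d × ZMod d) :
    (pauliTwo x (-x) z₁ z₂ ^ m) p q = if p.1 = q.1 + m * x ∧ p.2 = q.2 - m * x then
      chi ((m : ZMod d) * (z₁ * q.1 + z₂ * q.2) + x * (z₁ - z₂) * tri (m : ZMod d)) else 0 := by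
  induction m generalizing p q with
  | zero =>
    rw [pow_zero, Matrix.one_apply, Nat.cast_zero, zero_mul, add_zero, sub_zero,
      show tri (0 : ZMod d) = 0 by simp [tri], zero_mul, mul_zero, add_zero,
      AddChar.map_zero_eq_one]
    by_cases h : p = q
    · rw [if_pos h, if_pos ⟨congrArg Prod.fst h, congrArg Prod.snd h⟩]
    · rw [if_neg h, if_neg fun h' => h (Prod.ext h'.1 h'.2)]
  | succ n ih =>
    rw [pow_succ, Matrix.mul_apply, Finset.sum_eq_single (q.1 + x, q.2 - x)]
    · rw [ih, pauliTwo_apply x, if_pos (show _ ∧ _ from ⟨rfl, sub_eq_add_neg q.2 x⟩)]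
      have e1 : q.1 + x + (n : ZMod d) * x = q.1 + ((n + 1 : ℕ) : ZMod d) * x := by
        push_cast; ring
      have e2 : q.2 - x - (n : ZMod d) * x = q.2 - ((n + 1 : ℕ) : ZMod d) * x := by
        push_cast; ring
      rw [e1, e2]
      split_ifs
      · rw [← AddChar.map_add_eq_mul, Nat.cast_succ, tri_succ h2]
        congr 1
        ring
      · exact zero_mul _
    · intro r _ hr
      rw [pauliTwo_apply, if_neg, mul_zero]
      rintro ⟨h1, h3⟩
      exact hr (Prod.ext h1 (by rw [h3, sub_eq_add_neg]))
    · simp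

theorem eigenProj_pauliTwo_apply (h2 : (2 : ZMod d) ≠ 0) (x z₁ z₂ k : ZMod d)
    (p q : ZMod d × ZMod d) :
    eigenProj (pauliTwo x (-x) z₁ z₂) k p q = (d : ℂ)⁻¹ * ∑ m : ZMod d,
      if p.1 = q.1 + m * x ∧ p.2 = q.2 - m * x then
        chi (m * (z₁ * q.1 + z₂ * q.2) + x * (z₁ - z₂) * tri m - m * k) else 0 := by
  rw [eigenProj, Matrix.smul_apply, Matrix.sum_apply, smul_eq_mul, ← sum_range_eq_sum_zmod]
  congr 1
  refine Finset.sum_congr rfl fun m _ => ?_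
  rw [Matrix.smul_apply, pauliTwo_pow_apply h2, omega_inv_pow, smul_eq_mul, Nat.cast_mul,
    ZMod.natCast_zmod_val]
  split_ifs
  · rw [← AddChar.map_add_eq_mul]
    congr 1
    ring
  · exact mul_zero _

/-- The sum of the projectors of the Pauli operators with shift part `(x, -x)`. -/
def shiftBlock (x : ZMod d) (k : ZMod d → ZMod d) :
    Matrix (ZMod d × ZMod d) (ZMod d × ZMod d) ℂ :=
  ∑ z₁, ∑ z₂, eigenProj (pauliTwo x (-x) z₁ z₂) (k (z₁ - z₂))

/-- The labels depend only on b = z₁ - z₂. At fixed b the sum over z₂ enforces m(j + j') = 0, which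
for m ≠ 0 is the projection onto the parity code. -/
theorem shiftBlock_apply (h2 : (2 : ZMod d) ≠ 0) {x : ZMod d} (hx : x ≠ 0)
    (k : ZMod d → ZMod d) (p : ZMod d × ZMod d) (j j' m : ZMod d)
    (h1 : p.1 = j + m * x) :
    shiftBlock x k p (j, j') = if p.2 = j' - m * x ∧ (m = 0 ∨ j + j' = 0) then
      ∑ b, chi (b * (m * j + x * tri m) - m * k b) else 0 := by
  have hterm : ∀ z₁ z₂, eigenProj (pauliTwo x (-x) z₁ z₂) (k (z₁ - z₂)) p (j, j') =
      (d : ℂ)⁻¹ * if p.2 = j' - m * x then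
        chi (z₂ * (m * (j + j'))) * chi ((z₁ - z₂) * (m * j + x * tri m) - m * k (z₁ - z₂))
        else 0 := by
    intro z₁ z₂
    rw [eigenProj_pauliTwo_apply h2, Finset.sum_eq_single m]
    · simp only [h1, true_and]
      congr 2
      rw [← AddChar.map_add_eq_mul]
      congr 1
      ring
    · intro m' _ hm'
      rw [if_neg]
      rintro ⟨h, -⟩
      rw [h1] at h
      exact hm' (mul_right_cancel₀ hx (add_left_cancel h)).symm
    · simp
  simp only [shiftBlock, Matrix.sum_apply, hterm, ← Finset.mul_sum]
  by_cases h3 : p.2 = j' - m * x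
  · simp only [h3, true_and, if_true]
    rw [Finset.sum_comm]
    have hre : ∀ z₂ : ZMod d, ∑ z₁, chi (z₂ * (m * (j + j'))) *
        chi ((z₁ - z₂) * (m * j + x * tri m) - m * k (z₁ - z₂)) =
        chi (z₂ * (m * (j + j'))) * ∑ b, chi (b * (m * j + x * tri m) - m * k b) := by
      intro z₂
      rw [← Finset.mul_sum]
      congr 1
      exact Equiv.sum_comp (Equiv.subRight z₂) fun b =>
        chi (b * (m * j + x * tri m) - m * k b)
    simp only [hre, ← Finset.sum_mul, sum_chi_mul, mul_eq_zero]
    split_ifs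
    · rw [← mul_assoc, inv_mul_cancel₀ natCast_dim_ne_zero, one_mul]
    · rw [zero_mul, mul_zero]
  · simp [h3]

theorem shiftBlock_apply_self (h2 : (2 : ZMod d) ≠ 0) {x : ZMod d} (hx : x ≠ 0)
    (k : ZMod d → ZMod d) (i i' j' : ZMod d) :
    shiftBlock x k (i, i') (i, j') = if i' = j' then (d : ℂ) else 0 := by
  rw [shiftBlock_apply h2 hx k (i, i') i j' 0 (by ring)]
  simp [tri]

/-- For x ≠ 0 the multiples of x are all displacements, so a single block has every off-diagonal
entry. The substitution b = 2xy turns its sum into the one for A(u), whatever x is. -/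
theorem shiftBlock_apply_of_ne (h2 : (2 : ZMod d) ≠ 0) {x : ZMod d} (hx : x ≠ 0)
    {k : ZMod d → ZMod d} {u : Fin (d + 1) → ZMod d}
    (hk : ∀ y, k (2 * x * y) = -x * (kappa u y + x * y)) {i j : ZMod d} (hij : i ≠ j)
    (i' j' : ZMod d) :
    shiftBlock x k (i, i') (j, j') = if i' = -i ∧ j' = -j then
      ∑ y, chi (y * (i ^ 2 - j ^ 2) + kappa u y * (i - j)) else 0 := by
  have hm : (i - j) / x * x = i - j := div_mul_cancel₀ _ hx
  have hm0 : (i - j) / x ≠ 0 := div_ne_zero (sub_ne_zero.mpr hij) hx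
  rw [shiftBlock_apply h2 hx k (i, i') j j' ((i - j) / x) (by rw [hm]; ring), hm]
  have hiff : (i' = j' - (i - j) ∧ ((i - j) / x = 0 ∨ j + j' = 0)) ↔ (i' = -i ∧ j' = -j) := by
    simp only [hm0, false_or]
    constructor
    · rintro ⟨rfl, h⟩
      have hj : j' = -j := eq_neg_of_add_eq_zero_right h
      exact ⟨by rw [hj]; ring, hj⟩
    · rintro ⟨rfl, rfl⟩
      exact ⟨by ring, by ring⟩
  simp only [hiff]
  congr 1
  refine (Equiv.sum_comp (Equiv.mulLeft₀ (2 * x) (mul_ne_zero h2 hx)) fun b =>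
    chi (b * ((i - j) / x * j + x * tri ((i - j) / x)) - (i - j) / x * k b)).symm.trans ?_
  refine Finset.sum_congr rfl fun y _ => ?_
  congr 1
  simp only [Equiv.mulLeft₀_apply, hk, tri]
  field_simp
  ring

theorem encoded_apply (A : Matrix (ZMod d) (ZMod d) ℂ) (i i' j j' : ZMod d) :
    (parityEncoder d * A * (parityEncoder d)ᴴ) (i, i') (j, j') =
      if i' = -i ∧ j' = -j then A i j else 0 := by
  simp only [Matrix.mul_apply, parityEncoder, Matrix.conjTranspose_apply, Matrix.of_apply,
    Prod.mk.injEq, ite_and, ite_mul, one_mul, zero_mul, apply_ite star, star_one, star_zero,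
    mul_ite, mul_one, mul_zero]
  simp only [Finset.sum_ite_eq, Finset.mem_univ, if_true]
  split_ifs <;> rfl

theorem phasePoint_apply_self (h2 : (2 : ZMod d) ≠ 0) (u : Fin (d + 1) → ZMod d) (i : ZMod d) :
    phasePoint u i i = if i = u 0 then (d : ℂ)⁻¹ else 0 := by
  rw [phasePoint_apply h2]
  simp only [sub_self, mul_zero, add_zero, AddChar.map_zero_eq_one, true_and, if_true,
    Finset.sum_const, Finset.card_univ, ZMod.card, nsmul_eq_mul, mul_one]
  rw [inv_mul_cancel₀ natCast_dim_ne_zero, add_sub_cancel_right, mul_ite, mul_one, mul_zero]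

theorem witnessB_apply (h2 : (2 : ZMod d) ≠ 0) (u : Fin (d + 1) → ZMod d) (i i' j j' : ZMod d) :
    witnessB u (i, i') (j, j') = (if i' = -i ∧ j' = -j then d * phasePoint u i j else 0) +
      if i = j ∧ i' = j' then 2 * ((d : ℂ) ^ 2)⁻¹ -
        (d : ℂ)⁻¹ * ((if i = u 0 then 1 else 0) + if -i' = u 0 then 1 else 0) else 0 := by
  have hd : (d : ℂ) ≠ 0 := natCast_dim_ne_zero
  rw [witnessB, trace_encoded h2, inv_inv, weightTwoPart_eq, trace_encoded h2]
  simp only [Matrix.smul_apply, Matrix.add_apply, Matrix.sub_apply, Matrix.kronecker_apply,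
    traceSnd_apply, traceFst_apply, encoded_apply, Matrix.one_apply, smul_eq_mul, Prod.mk.injEq]
  have e1 : ∑ k, (if k = -i ∧ k = -j then phasePoint u i j else 0) =
      if i = j then (if i = u 0 then (d : ℂ)⁻¹ else 0) else 0 := by
    by_cases hij : i = j
    · subst hij
      simp only [and_self, Finset.sum_ite_eq', Finset.mem_univ, if_true,
        phasePoint_apply_self h2]
    · rw [if_neg hij]
      refine Finset.sum_eq_zero fun k _ => if_neg ?_
      rintro ⟨rfl, h⟩
      exact hij (neg_injective h)
  have e2 : ∑ k, (if i' = -k ∧ j' = -k then phasePoint u k k else 0) =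
      if i' = j' then (if -i' = u 0 then (d : ℂ)⁻¹ else 0) else 0 := by
    by_cases hij : i' = j'
    · subst hij
      have hk' : ∀ k, i' = -k ↔ k = -i' := fun k => ⟨fun h => by rw [h, neg_neg],
        fun h => by rw [h, neg_neg]⟩
      simp only [and_self, hk', Finset.sum_ite_eq', Finset.mem_univ, if_true,
        phasePoint_apply_self h2]
    · rw [if_neg hij]
      refine Finset.sum_eq_zero fun k _ => if_neg ?_
      rintro ⟨h, h'⟩
      exact hij (h.trans h'.symm)
  rw [e1, e2]
  by_cases h1 : i = j <;> by_cases h3 : i' = j' <;> simp only [h1, h3, if_true, if_false,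
    and_self, and_false, false_and, mul_zero, mul_one, zero_mul, add_zero, sub_zero, mul_ite]
  all_goals split_ifs <;> field_simp <;> ring

theorem witnessB_apply_of_ne (h2 : (2 : ZMod d) ≠ 0) (u : Fin (d + 1) → ZMod d) {i j : ZMod d}
    (hij : i ≠ j) (i' j' : ZMod d) :
    witnessB u (i, i') (j, j') = if i' = -i ∧ j' = -j then
      (d : ℂ)⁻¹ * ∑ y, chi (y * (i ^ 2 - j ^ 2) + kappa u y * (i - j)) else 0 := by
  rw [witnessB_apply h2, if_neg (c := i = j ∧ i' = j') fun h => hij h.1, add_zero,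
    phasePoint_apply h2, if_neg hij, if_neg (c := i = j ∧ j = u 0) fun h => hij h.1, zero_add,
    sub_zero, ← mul_assoc (d : ℂ),
    mul_inv_cancel₀ natCast_dim_ne_zero, one_mul]

theorem witnessB_apply_self (h2 : (2 : ZMod d) ≠ 0) (u : Fin (d + 1) → ZMod d) (i i' j' : ZMod d) :
    witnessB u (i, i') (i, j') = if i' = j' then
      (if i' = -i ∧ i = u 0 then 1 else 0) + 2 * ((d : ℂ) ^ 2)⁻¹ -
        (d : ℂ)⁻¹ * ((if i = u 0 then 1 else 0) + if -i' = u 0 then 1 else 0) else 0 := by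
  rw [witnessB_apply h2, phasePoint_apply_self h2]
  by_cases h : i' = j'
  · subst h
    simp only [and_self, if_true, mul_ite, mul_inv_cancel₀ (natCast_dim_ne_zero (d := d)),
      mul_zero, ite_and]
    ring
  · rw [if_neg, if_neg fun h' => h h'.2, if_neg h, add_zero]
    rintro ⟨h1, h3⟩
    exact h (h1.trans h3.symm)

end Prime

theorem qutritW_eq_witnessB : qutritW = witnessB (d := 3) ![0, 2, 2, 0] := by
  have h2 : (2 : ZMod 3) ≠ 0 := by decide
  have hl : qutritList = ([(0, 0, 1, 1, 0), (0, 0, 1, 2, 0)] :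
      List (ZMod 3 × ZMod 3 × ZMod 3 × ZMod 3 × ZMod 3)) ++
        ([0, 1, 2] : List (ZMod 3)).flatMap fun z₁ : ZMod 3 =>
          ([0, 1, 2] : List (ZMod 3)).map fun z₂ : ZMod 3 =>
            -- This polynomial solves k(2y) = -(κ(y) + y) for κ(y) = 1 + y² modulo 3, with b = z₁ -
            -- z₂ = 2y.
            ((1, -1, z₁, z₂, (z₁ - z₂) - (z₁ - z₂) ^ 2 - 1) :
              ZMod 3 × ZMod 3 × ZMod 3 × ZMod 3 × ZMod 3) := by decide
  have hs : projSum qutritList = eigenProj (pauliTwo 0 0 (1 : ZMod 3) 1) (0 : ZMod 3) +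
      eigenProj (pauliTwo 0 0 (1 : ZMod 3) 2) (0 : ZMod 3) +
      shiftBlock (1 : ZMod 3) fun b => b - b ^ 2 - 1 := by
    rw [hl, projSum_append, projSum_flatMap (by decide) (by decide)]
    congr 1
    simp [projSum]
  ext ⟨i, i'⟩ ⟨j, j'⟩
  rw [qutritW, hs]
  simp only [Matrix.smul_apply, Matrix.sub_apply, Matrix.add_apply, Matrix.one_apply,
    eigenProj_diagonal_apply, smul_eq_mul, Prod.mk.injEq]
  by_cases hij : i = j
  · subst hij
    rw [shiftBlock_apply_self h2 (by decide), witnessB_apply_self h2]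
    by_cases hij' : i' = j'
    · subst hij'
      simp only [true_and, if_true]
      revert i i'
      apply forall_zmod_three <;> apply forall_zmod_three <;> simp +decide <;> norm_num
    · simp [hij']
  · rw [shiftBlock_apply_of_ne (u := ![0, 2, 2, 0]) h2 (by decide) (by decide) hij,
      witnessB_apply_of_ne h2 _ hij]
    simp only [hij, false_and, if_false, mul_zero, add_zero, sub_zero]
    simp

theorem ququintW_eq_witnessB : ququintW = witnessB (d := 5) ![0, 0, 0, 1, 3, 1] := by
  have hl : ququintList = ([(0, 0, 1, 1, 0), (0, 0, 1, 2, 0), (0, 0, 1, 3, 0), (0, 0, 1, 4, 0),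
      (0, 0, 2, 1, 0), (0, 0, 2, 2, 0), (0, 0, 2, 3, 0), (0, 0, 2, 4, 0)] :
      List (ZMod 5 × ZMod 5 × ZMod 5 × ZMod 5 × ZMod 5)) ++
        (([0, 1, 2, 3, 4] : List (ZMod 5)).flatMap fun z₁ : ZMod 5 =>
          ([0, 1, 2, 3, 4] : List (ZMod 5)).map fun z₂ : ZMod 5 =>
            -- The two label polynomials solve k(2xy) = -x(κ(y) + xy) for κ(y) = 3y² modulo 5, at x
            -- = 1 and x = 2. Each block reproduces the off-diagonal part, whence the prefactor 1/10
            -- in place of 1/5.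
            ((1, -1, z₁, z₂, 3 * (z₁ - z₂) ^ 2 + 2 * (z₁ - z₂)) :
              ZMod 5 × ZMod 5 × ZMod 5 × ZMod 5 × ZMod 5)) ++
        (([0, 1, 2, 3, 4] : List (ZMod 5)).flatMap fun z₁ : ZMod 5 =>
          ([0, 1, 2, 3, 4] : List (ZMod 5)).map fun z₂ : ZMod 5 =>
            ((2, -2, z₁, z₂, 4 * (z₁ - z₂) ^ 2 + 4 * (z₁ - z₂)) :
              ZMod 5 × ZMod 5 × ZMod 5 × ZMod 5 × ZMod 5)) := by decide
  have h2 : (2 : ZMod 5) ≠ 0 := by decide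
  have hs : projSum ququintList =
      (∑ z₁ ∈ ({1, 2} : Finset (ZMod 5)), ∑ z₂ ∈ ({1, 2, 3, 4} : Finset (ZMod 5)),
        eigenProj (pauliTwo 0 0 z₁ z₂) (0 : ZMod 5)) +
      shiftBlock (1 : ZMod 5) (fun b => 3 * b ^ 2 + 2 * b) +
      shiftBlock (2 : ZMod 5) (fun b => 4 * b ^ 2 + 4 * b) := by
    rw [hl, projSum_append, projSum_append, projSum_flatMap (by decide) (by decide),
      projSum_flatMap (by decide) (by decide)]
    congr 2
    simp +decide [projSum, Finset.sum_insert, add_assoc]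
  ext ⟨i, i'⟩ ⟨j, j'⟩
  rw [ququintW, hs]
  simp only [Matrix.smul_apply, Matrix.sub_apply, Matrix.add_apply, Matrix.one_apply,
    Matrix.sum_apply, eigenProj_diagonal_apply, smul_eq_mul, Prod.mk.injEq]
  by_cases hij : i = j
  · subst hij
    rw [shiftBlock_apply_self h2 (by decide), shiftBlock_apply_self h2 (by decide),
      witnessB_apply_self h2]
    by_cases hij' : i' = j'
    · subst hij'
      -- The diagonal projectors contribute the number of listed (z₁,z₂) with z₁i + z₂i' = 0, so the
      -- diagonal comparison is a finite check.
      have hcount : ∀ i i' : ZMod 5, ∑ z₁ ∈ ({1, 2} : Finset (ZMod 5)),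
          (Finset.filter (fun z₂ => z₁ * i + z₂ * i' = 0) ({1, 2, 3, 4} : Finset (ZMod 5))).card =
          if i = 0 ∧ i' = 0 then 8 else if i = 0 ∨ i' = 0 then 0 else 2 := by decide
      simp only [true_and, if_true, Finset.sum_boole, ← Nat.cast_sum, hcount]
      clear hcount hs hl
      revert i i'
      apply forall_zmod_five <;> apply forall_zmod_five <;> simp +decide <;> norm_num
    · simp [hij']
  · rw [shiftBlock_apply_of_ne (u := ![0, 0, 0, 1, 3, 1]) h2 (by decide) (by decide) hij,
      shiftBlock_apply_of_ne (u := ![0, 0, 0, 1, 3, 1]) h2 (by decide) (by decide) hij,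
      witnessB_apply_of_ne h2 _ hij]
    simp only [hij, false_and, if_false, mul_zero, Finset.sum_const_zero, zero_add, sub_zero]
    split_ifs
    · push_cast
      ring
    · ring

end ExplicitFacets

end

end QuditClifford

-- Assembly for d = 3, 5, 7

open QuditClifford in
theorem mainTheorem4 :
      (qutritU ∈ Matrix.unitaryGroup (ZMod 3) ℂ ∧
        qutritW = witnessB (d := 3) ![0, 2, 2, 0] ∧
        IsCliffordFacet qutritW ∧
        choiExpect qutritW qutritU =
          (1 / 9) * (3 - √3 * Real.cos (Real.pi / 18) - 6 * Real.cos (Real.pi / 9)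
            - 3 * Real.sin (Real.pi / 18) + 2 * √3 * Real.sin (Real.pi / 9)) ∧
        Certifies qutritW qutritU (threshold qutritW qutritU) ∧
        IsLeast (cliffordNoise qutritU) (threshold qutritW qutritU) ∧
        |threshold qutritW qutritU - 0.7863| ≤ 0.00005) ∧
      (ququintU ∈ Matrix.unitaryGroup (ZMod 5) ℂ ∧
        ququintW = witnessB (d := 5) ![0, 0, 0, 1, 3, 1] ∧
        IsCliffordFacet ququintW ∧
        choiExpect ququintW ququintU = -(4 / 5) ∧
        Certifies ququintW ququintU (threshold ququintW ququintU) ∧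
        IsLeast (cliffordNoise ququintU) (threshold ququintW ququintU) ∧
        threshold ququintW ququintU = 20 / 21) ∧
      (quseptU ∈ Matrix.unitaryGroup (ZMod 7) ℂ ∧
        IsCliffordFacet quseptW ∧
        |choiExpect quseptW quseptU - (-0.8411)| ≤ 0.00005 ∧
        Certifies quseptW quseptU (threshold quseptW quseptU) ∧
        IsLeast (cliffordNoise quseptU) (threshold quseptW quseptU) ∧
        |threshold quseptW quseptU - 0.9763| ≤ 0.00005) := by
  refine ⟨?_, ?_, ?_⟩
  · obtain ⟨hv, hlo, hhi⟩ := phaseForm_qutrit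
    -- The triple (0, 1, 1) exhibits κ(0) + κ(2) ≠ 2κ(1), a nonzero second difference.
    obtain ⟨hU, hF, he, hC, hL⟩ := antidiagonal_gate_robustness (d := 3) (by decide)
      ![0, 2, 2, 0] ⟨0, 1, 1, by decide⟩ qutritU_apply normSq_qutritPhase normSq_ampl_qutrit_le
      (by linarith)
    rw [← qutritW_eq_witnessB] at hF he hC hL
    refine ⟨hU, qutritW_eq_witnessB, hF, he.trans hv, hC, hL, ?_⟩
    rw [threshold, he]
    generalize phaseForm (d := 3) ![0, 2, 2, 0] qutritPhase = v at hlo hhi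
    have hneg : v < 0 := by linarith
    rw [abs_of_neg hneg]
    have hpos : 0 < ((3 : ℕ) : ℝ) ^ 2 * -v + 1 := by
      push_cast
      linarith
    rw [abs_le]
    constructor
    -- The bounds 0.2137 and 0.21365 are 1 - 0.7863 and 1 - 0.78635.
    · have : 1 / (((3 : ℕ) : ℝ) ^ 2 * -v + 1) ≤ 0.2137 := by
        rw [div_le_iff₀ hpos]
        push_cast
        linarith
      linarith
    · have : 0.21365 ≤ 1 / (((3 : ℕ) : ℝ) ^ 2 * -v + 1) := by
        rw [le_div_iff₀ hpos]
        push_cast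
        linarith
      linarith
  · have hv := phaseForm_ququint
    obtain ⟨hU, hF, he, hC, hL⟩ :=
      @antidiagonal_gate_robustness 5 inferInstance fact_prime_five (by decide)
      ![0, 0, 0, 1, 3, 1] ⟨0, 1, 1, by decide⟩ _ _ ququintU_apply
      (fun j => normSq_chi _) (fun y k => by
        rw [kappa_ququint, ampl_ququint, map_zero]
        exact normSq_nonneg _)
      (by rw [hv]; norm_num)
    rw [hv] at he
    rw [← ququintW_eq_witnessB] at hF he hC hL
    refine ⟨hU, ququintW_eq_witnessB, hF, he, hC, hL, ?_⟩
    rw [threshold, he, abs_neg, abs_of_pos (by norm_num)]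
    norm_num
  · obtain ⟨s, hlo, hhi, hv⟩ := phaseForm_qusept
    obtain ⟨hU, hF, he, hC, hL⟩ :=
      @antidiagonal_gate_robustness 7 inferInstance fact_prime_seven (by decide)
      ![0, 0, 0, 3, 2, 4, 2, 3] ⟨0, 1, 1, by decide⟩ _ _ quseptU_apply (fun j => normSq_chi _)
      normSq_ampl_qusept_le (by rw [hv]; linarith)
    rw [hv] at he
    refine ⟨hU, hF, ?_, hC, hL, ?_⟩
    · rw [quseptW, he, abs_le]
      constructor <;> linarith
    · have hneg : (s - 6) / 7 < 0 := by linarith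
      rw [threshold, quseptW, he, abs_of_neg hneg]
      have hpos : 0 < ((7 : ℕ) : ℝ) ^ 2 * -((s - 6) / 7) + 1 := by
        push_cast
        linarith
      rw [abs_le]
      constructor
      · have : 1 / (((7 : ℕ) : ℝ) ^ 2 * -((s - 6) / 7) + 1) ≤ 0.0237 := by
          rw [div_le_iff₀ hpos]
          push_cast
          linarith
        linarith
      · have : 0.02368 ≤ 1 / (((7 : ℕ) : ℝ) ^ 2 * -((s - 6) / 7) + 1) := by
          rw [le_div_iff₀ hpos]
          push_cast
          linarith
        linarith
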